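/- **Notions.** Fix a countably infinite set $\mathcal N$ of names. A list of pairwise distinct names with underlying set $A$ is called an enumeration of $A$. $A\uplus B$ denotes the union of disjoint sets, and is undefined otherwise. *PROPs and SMTs.* A PROP is a strict symmetric monoidal category with objects $\mathbb N$ and tensor $\oplus$ given by addition on objects; composition $;$ is written in diagrammatic order. An isomorphism of PROPs is an identity-on-objects strict symmetric monoidal functor that is bijective on arrows. A symmetric monoidal theory (SMT) $\langle\Sigma,E\rangle$ consists of a set $\Sigma$ of generators $\gamma:m\to n$ and a set $E$ of equations between parallel $\Sigma$-terms; $\Sigma$-terms are built from the generators, the empty diagram $0\to0$, $id:1\to1$ and $\sigma:2\to2$ by $;$ and $\oplus$. $\mathrm{Prop}\langle\Sigma,E\rangle$ is the PROP of $\Sigma$-terms modulo the congruence generated by $E$ and the equations: $;$ is associative with units $id_n$; $\oplus$ is associative with the empty diagram as unit; $\sigma;\sigma=id_2$; $(s;t)\oplus(u;v)=(s\oplus u);(t\oplus v)$; and $(s\oplus t);\sigma_{n,p}=\sigma_{m,o};(t\oplus s)$ for $s:m\to n$, $t:o\to p$. *Nominal PROPs.* A nominal PROP (nPROP) is a category with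 objects the finite subsets of $\mathcal N$, with an arrow $A\to B$ for each bijection $A\to B$ (functorially; distinct bijections may become equal), and with a partial operation $\uplus$ on arrows, defined for pairs with disjoint domains and disjoint codomains, which extends $\uplus$ of bijections, is commutative, associative, has the empty function as unit and satisfies $(f;f')\uplus(g;g')=(f\uplus g);(f'\uplus g')$ for composable $f,f'$ and composable $g,g'$ whenever all of $f\uplus g$, $f'\uplus g'$ are defined. For a finite permutation $\pi$ of $\mathcal N$ and $f:A\to B$ put $\pi\cdot f=\pi_A^{-1};f;\pi_B$, where $\pi_A:A\to\pi[A]$ is the restriction of $\pi$. Isomorphisms of nPROPs are identity-on-objects functors, bijective on arrows, that preserve $\uplus$ and the bijections. *NMTs.* A nominal monoidal theory (NMT) $\langle\Sigma,E\rangle$ consists of a set $\Sigma$ of generators $\gamma:m\to n$ and a set $E$ of equations between parallel nominal terms (usually $E$ is required to be closed under permutations; this is not needed here). Nominal terms are built from $[\boldsymbol a\rangle\gamma\langle\boldsymbol b]:A\to B$ (for enumerations $\boldsymbol a$ of $A$ and $\boldsymbol b$ of $B$ of lengths $m$ and $n$), the empty diagram $\varnothing\to\varnothing$, $id_a:\{a\}\to\{a\}$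 and $\delta_{ab}:\{a\}\to\{b\}$ by $;$, by $\uplus$ (when defined) and by formal permutations $\pi\cdot t:\pi[A]\to\pi[B]$ for $t:A\to B$. $\mathrm{nProp}\langle\Sigma,E\rangle$ is the nPROP of nominal terms modulo the least equivalence relation that is compatible with $;$, $\uplus$ and $\pi\cdot$ and contains $E$ and the equations: the laws of a category; $\uplus$ is an associative and commutative operation with unit the empty diagram; interchange of $;$ and $\uplus$; the laws of a permutation action and its compatibility with the term constructors, in particular $\pi\cdot[\boldsymbol a\rangle\gamma\langle\boldsymbol b]=[\pi\boldsymbol a\rangle\gamma\langle\pi\boldsymbol b]$ and $\pi\cdot\delta_{ab}=\delta_{\pi a\,\pi b}$; $\delta_{aa}=id_a$; $\delta_{ab};\delta_{bc}=\delta_{ac}$; $(\delta_{xa_i}\uplus id);[a_1,\dots,a_i,\dots,a_m\rangle\gamma\langle\boldsymbol b]=[a_1,\dots,x,\dots,a_m\rangle\gamma\langle\boldsymbol b]$; and $[\boldsymbol a\rangle\gamma\langle b_1,\dots,b_i,\dots,b_n];(id\uplus\delta_{b_ix})=[\boldsymbol a\rangle\gamma\langle b_1,\dots,x,\dots,b_n]$.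 The bijections of $\mathrm{nProp}\langle\Sigma,E\rangle$ are the terms $\delta_{a_1b_1}\uplus\cdots\uplus\delta_{a_nb_n}$. *$\mathrm{ORD}$.* For enumerations $\boldsymbol a,\boldsymbol a'$ of one set, $\langle\boldsymbol a|\boldsymbol a'\rangle$ denotes the composite of symmetries that realises the bijection $i\mapsto j$ whenever $a_i=a'_j$; for enumerations $\boldsymbol a,\boldsymbol b$ of equal length, $[\boldsymbol a|\boldsymbol b]$ denotes the bijection $a_i\mapsto b_i$. For an nPROP $\mathcal T$, $\mathrm{ORD}(\mathcal T)$ is the PROP generated by symbols $\langle\boldsymbol a]f[\boldsymbol b\rangle:n\to m$, for all arrows $f:A\to B$ of $\mathcal T$ and all enumerations $\boldsymbol a=[a_1,\dots,a_n]$ of $A$, $\boldsymbol b=[b_1,\dots,b_m]$ of $B$, subject to $\langle\boldsymbol a]f;g[\boldsymbol c\rangle=\langle\boldsymbol a]f[\boldsymbol b\rangle;\langle\boldsymbol b]g[\boldsymbol c\rangle$, $\langle\boldsymbol a\boldsymbol a']f\uplus g[\boldsymbol b\boldsymbol b'\rangle=\langle\boldsymbol a]f[\boldsymbol b\rangle\oplus\langle\boldsymbol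 a']g[\boldsymbol b'\rangle$, $\langle\boldsymbol a]id[\boldsymbol a\rangle=id$, $\langle\boldsymbol a][\boldsymbol a'|\boldsymbol b];f[\boldsymbol c\rangle=\langle\boldsymbol a|\boldsymbol a'\rangle;\langle\boldsymbol b]f[\boldsymbol c\rangle$, $\langle\boldsymbol a]f;[\boldsymbol b|\boldsymbol c][\boldsymbol c'\rangle=\langle\boldsymbol a]f[\boldsymbol b\rangle;\langle\boldsymbol c|\boldsymbol c'\rangle$, and $\langle\boldsymbol a]f[\boldsymbol b\rangle=\langle\pi\cdot\boldsymbol a]\pi\cdot f[\pi\cdot\boldsymbol b\rangle$. *$\mathrm{Smt}$.* Choose an enumeration of each finite set of names. For a nominal term $t:A\to B$ and enumerations $\boldsymbol a$, $\boldsymbol b$ of $A$, $B$ define the $\Sigma$-term $\mathrm{nf}(\langle\boldsymbol a]t[\boldsymbol b\rangle)$ recursively by $\mathrm{nf}(\langle\boldsymbol a][\boldsymbol a'\rangle\gamma\langle\boldsymbol b'][\boldsymbol b\rangle)=\langle\boldsymbol a|\boldsymbol a'\rangle;\gamma;\langle\boldsymbol b'|\boldsymbol b\rangle$; $\mathrm{nf}(\langle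 a]id_a[a\rangle)=id=\mathrm{nf}(\langle a]\delta_{ab}[b\rangle)$; the empty diagram is sent to the empty diagram; $\mathrm{nf}(\langle\boldsymbol a]f;g[\boldsymbol c\rangle)=\mathrm{nf}(\langle\boldsymbol a]f[\boldsymbol b\rangle);\mathrm{nf}(\langle\boldsymbol b]g[\boldsymbol c\rangle)$; $\mathrm{nf}(\langle\boldsymbol a]f\uplus g[\boldsymbol b\rangle)=\langle\boldsymbol a|\boldsymbol a_1\boldsymbol a_2\rangle;(\mathrm{nf}(\langle\boldsymbol a_1]f[\boldsymbol b_1\rangle)\oplus\mathrm{nf}(\langle\boldsymbol a_2]g[\boldsymbol b_2\rangle));\langle\boldsymbol b_1\boldsymbol b_2|\boldsymbol b\rangle$; $\mathrm{nf}(\langle\boldsymbol a]\pi\cdot f[\boldsymbol b\rangle)=\mathrm{nf}(\langle\pi^{-1}\cdot\boldsymbol a]f[\pi^{-1}\cdot\boldsymbol b\rangle)$, where the enumerations that occur only on the right-hand side are the chosen ones. For an NMT $\langle\Sigma,E\rangle$, $\mathrm{Smt}\langle\Sigma,E\rangle$ is the SMT with generators $\Sigma$ and all equations $\mathrm{nf}(\langle\boldsymbol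 a]s[\boldsymbol b\rangle)=\mathrm{nf}(\langle\boldsymbol a]t[\boldsymbol b\rangle)$ where $s=t$ is in $E$ and $\boldsymbol a$, $\boldsymbol b$ enumerate the domain and codomain of $s$ and $t$. An SMT $\langle\Sigma,E\rangle$ is complete for a PROP $\mathbb C$ if $\mathrm{Prop}\langle\Sigma,E\rangle\cong\mathbb C$, and an NMT $\langle\Sigma,E\rangle$ is complete for an nPROP $\mathsf n\mathbb C$ if $\mathrm{nProp}\langle\Sigma,E\rangle\cong\mathsf n\mathbb C$. **Theorem (Completeness of SMTs).** Let $\langle\Sigma,E\rangle$ be an NMT. For every choice of enumerations in the definition of $\mathrm{Smt}$, $$\mathrm{ORD}(\mathrm{nProp}\langle\Sigma,E\rangle)\;\cong\;\mathrm{Prop}(\mathrm{Smt}\langle\Sigma,E\rangle).$$ Consequently, if $\langle\Sigma,E\rangle$ is complete for an nPROP $\mathsf n\mathbb C$ and $\mathbb C$ is a PROP with $\mathrm{ORD}(\mathsf n\mathbb C)\cong\mathbb C$, then $\mathrm{Smt}\langle\Sigma,E\rangle$ is complete for $\mathbb C$, that is, $\mathrm{Prop}(\mathrm{Smt}\langle\Sigma,E\rangle)\cong\mathbb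 C$. -/

import Mathlib

universe u v w s

/-! ## PROPs -/

/-- A PROP: a strict symmetric monoidal category whose objects are the natural numbers and whose
tensor product is addition on objects. Composition is written in diagrammatic order. The tensor of
arrows takes proofs `m + o = k`, `n + p = l`, so that strict associativity and unitality are plain
equations. -/
structure PROP where
  /-- arrows `m → n` -/
  Hom : ℕ → ℕ → Type u
  /-- identities -/
  id : ∀ n, Hom n n
  /-- sequential composition `f ; g` -/
  comp : ∀ {m n o}, Hom m n → Hom n o → Hom m o
  /-- parallel composition `f ⊕ g` -/
  tensor : ∀ {m n o p k l}, Hom m n → Hom o p → m + o = k → n + p = l → Hom k l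
  /-- the symmetry `σ_{m,n}` -/
  symm : ∀ m n, Hom (m + n) (n + m)
  id_comp : ∀ {m n} (f : Hom m n), comp (id m) f = f
  comp_id : ∀ {m n} (f : Hom m n), comp f (id n) = f
  assoc : ∀ {m n o p} (f : Hom m n) (g : Hom n o) (h : Hom o p),
    comp (comp f g) h = comp f (comp g h)
  tensor_assoc : ∀ {m₁ n₁ m₂ n₂ m₃ n₃ i j i' j' k l}
    (f : Hom m₁ n₁) (g : Hom m₂ n₂) (h : Hom m₃ n₃)
    (h₁ : m₁ + m₂ = i) (h₂ : n₁ + n₂ = j) (h₃ : i + m₃ = k) (h₄ : j + n₃ = l)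
    (h₅ : m₂ + m₃ = i') (h₆ : n₂ + n₃ = j') (h₇ : m₁ + i' = k) (h₈ : n₁ + j' = l),
    tensor (tensor f g h₁ h₂) h h₃ h₄ = tensor f (tensor g h h₅ h₆) h₇ h₈
  unit_tensor : ∀ {m n} (f : Hom m n), tensor (id 0) f (Nat.zero_add m) (Nat.zero_add n) = f
  tensor_unit : ∀ {m n} (f : Hom m n), tensor f (id 0) (Nat.add_zero m) (Nat.add_zero n) = f
  tensor_id : ∀ m n, tensor (id m) (id n) rfl rfl = id (m + n)
  interchange : ∀ {m n o m' n' o'} (f : Hom m n) (g : Hom n o) (f' : Hom m' n') (g' : Hom n' o'),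
    tensor (comp f g) (comp f' g') rfl rfl =
      comp (tensor f f' rfl rfl) (tensor g g' rfl rfl)
  symm_natural : ∀ {m n o p} (f : Hom m n) (g : Hom o p),
    comp (tensor f g rfl rfl) (symm n p) = comp (symm m o) (tensor g f rfl rfl)
  symm_symm : ∀ m n, comp (symm m n) (symm n m) = id (m + n)
  hexagon : ∀ m n p, symm m (n + p) =
    comp (tensor (symm m n) (id p) (Nat.add_assoc m n p) (Nat.add_right_comm n m p))
      (tensor (id n) (symm m p) ((Nat.add_assoc n m p).symm.trans (Nat.add_right_comm n m p))
        (Nat.add_assoc n p m).symm)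

/-- An isomorphism of PROPs: an identity-on-objects strict symmetric monoidal functor that is
bijective on arrows. -/
structure PROP.Iso (P : PROP.{u}) (Q : PROP.{v}) where
  /-- the bijection on arrows -/
  equiv : ∀ m n, P.Hom m n ≃ Q.Hom m n
  map_id : ∀ n, equiv n n (P.id n) = Q.id n
  map_comp : ∀ {m n o} (f : P.Hom m n) (g : P.Hom n o),
    equiv m o (P.comp f g) = Q.comp (equiv m n f) (equiv n o g)
  map_tensor : ∀ {m n o p k l} (f : P.Hom m n) (g : P.Hom o p) (hk : m + o = k) (hl : n + p = l),
    equiv k l (P.tensor f g hk hl) = Q.tensor (equiv m n f) (equiv o p g) hk hl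
  map_symm : ∀ m n, equiv (m + n) (n + m) (P.symm m n) = Q.symm m n

/-! ## Symmetric monoidal theories -/

/-- A set of generators, each with an arity and a co-arity. -/
structure Signature where
  /-- the generators -/
  Gen : Type s
  /-- the arity -/
  ar : Gen → ℕ
  /-- the co-arity -/
  coar : Gen → ℕ

/-- The terms over a signature. The empty diagram `empty : 0 → 0` is the unit of `⊕`. -/
inductive Trm (S : Signature.{s}) : ℕ → ℕ → Type s
  | gen (γ : S.Gen) : Trm S (S.ar γ) (S.coar γ)
  | empty : Trm S 0 0
  | id : Trm S 1 1
  | sym : Trm S 2 2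
  | par {m n o p k l : ℕ} (t : Trm S m n) (t' : Trm S o p) (hk : m + o = k) (hl : n + p = l) :
      Trm S k l
  | seq {m n o : ℕ} (t : Trm S m n) (t' : Trm S n o) : Trm S m o

namespace Trm

variable {S : Signature.{s}}

/-- Transport of a term along equalities of arities. -/
def cast {m n m' n' : ℕ} (hm : m = m') (hn : n = n') (t : Trm S m n) : Trm S m' n' :=
  hm ▸ hn ▸ t

/-- The term `id_n : n → n`. -/
def idn : (n : ℕ) → Trm S n n
  | 0 => empty
  | n + 1 => par (idn n) id rfl rfl

/-- The term `σ_{1,n} : 1 + n → n + 1`, which moves the first wire past the `n` others. -/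
def symOne : (n : ℕ) → Trm S (1 + n) (n + 1)
  | 0 => id
  | n + 1 => seq (par (symOne n) id rfl rfl : Trm S (1 + n + 1) (n + 1 + 1))
      (par (idn n) sym rfl rfl)

/-- The canonical symmetry `σ_{m,n} : m + n → n + m`. -/
def symT : (m n : ℕ) → Trm S (m + n) (n + m)
  | 0, n => par empty (idn n) rfl (Nat.add_comm 0 n)
  | m + 1, n => seq (par (idn m) (symOne n) (Nat.add_assoc m 1 n).symm rfl)
      (par (symT m n) id (Nat.add_assoc m n 1) rfl)

/-- The term `n + 1 → n + 1` that moves the first wire to position `k`. -/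
def move {n : ℕ} (k : Fin (n + 1)) : Trm S (n + 1) (n + 1) :=
  par (symT 1 k) (idn (n - k)) (by have := k.isLt; omega) (by have := k.isLt; omega)

/-- A term for the bijection `e` that only consists of wires and crossings: the `i`-th input wire is
connected to the `e i`-th output wire. First route the wires other than the first one, then move
the first wire to its position. -/
def bij : {n m : ℕ} → (Fin n ≃ Fin m) → Trm S n m
  | 0, 0, _ => empty
  | 0, _ + 1, e => (e.symm 0).elim0
  | _ + 1, 0, e => (e 0).elim0
  | n + 1, m + 1, e =>
      seq (par id (bij (Equiv.removeNone
          ((finSuccEquiv n).symm.trans (e.trans (finSuccEquiv' (e 0))))))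
        (Nat.add_comm 1 n) (Nat.add_comm 1 m)) (move (e 0))

end Trm

/-- A family of equations between terms of equal arity and co-arity. -/
abbrev TrmEqs (S : Signature.{s}) := ∀ m n : ℕ, Trm S m n → Trm S m n → Prop

open Trm in
/-- The equations that hold in every symmetric monoidal theory. -/
inductive SMTAx (S : Signature.{s}) : ∀ m n : ℕ, Trm S m n → Trm S m n → Prop
  | seq_assoc {m n o p} (t : Trm S m n) (t' : Trm S n o) (t'' : Trm S o p) :
      SMTAx S _ _ (seq (seq t t') t'') (seq t (seq t' t''))
  | id_seq {m n} (t : Trm S m n) : SMTAx S _ _ (seq (idn m) t) t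
  | seq_id {m n} (t : Trm S m n) : SMTAx S _ _ (seq t (idn n)) t
  | par_assoc {m₁ n₁ m₂ n₂ m₃ n₃ i j i' j' k l}
      (t₁ : Trm S m₁ n₁) (t₂ : Trm S m₂ n₂) (t₃ : Trm S m₃ n₃)
      (h₁ : m₁ + m₂ = i) (h₂ : n₁ + n₂ = j) (h₃ : i + m₃ = k) (h₄ : j + n₃ = l)
      (h₅ : m₂ + m₃ = i') (h₆ : n₂ + n₃ = j') (h₇ : m₁ + i' = k) (h₈ : n₁ + j' = l) :
      SMTAx S k l (par (par t₁ t₂ h₁ h₂) t₃ h₃ h₄) (par t₁ (par t₂ t₃ h₅ h₆) h₇ h₈)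
  | empty_par {m n} (t : Trm S m n) :
      SMTAx S m n (par empty t (Nat.zero_add m) (Nat.zero_add n)) t
  | par_empty {m n} (t : Trm S m n) :
      SMTAx S m n (par t empty (Nat.add_zero m) (Nat.add_zero n)) t
  | sym_sym : SMTAx S 2 2 (seq sym sym) (idn 2)
  | interchange {m n o m' n' o' i j k} (t : Trm S m n) (t' : Trm S n o)
      (u : Trm S m' n') (u' : Trm S n' o') (hi : m + m' = i) (hj : n + n' = j) (hk : o + o' = k) :
      SMTAx S i k (par (seq t t') (seq u u') hi hk) (seq (par t u hi hj) (par t' u' hj hk))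
  | natural {m n o p} (t : Trm S m n) (t' : Trm S o p) :
      SMTAx S _ _ (seq (par t t' rfl rfl) (symT n p)) (seq (symT m o) (par t' t rfl rfl))

/-- The deductive closure of a set of equations between terms. -/
inductive Th {S : Signature.{s}} (R : TrmEqs S) : ∀ m n : ℕ, Trm S m n → Trm S m n → Prop
  | ax {m n} {t t' : Trm S m n} : R m n t t' → Th R m n t t'
  | refl {m n} (t : Trm S m n) : Th R m n t t
  | symm {m n} {t t' : Trm S m n} : Th R m n t t' → Th R m n t' t
  | trans {m n} {t t' t'' : Trm S m n} : Th R m n t t' → Th R m n t' t'' → Th R m n t t''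
  | seq {m n o} {t u : Trm S m n} {t' u' : Trm S n o} :
      Th R m n t u → Th R n o t' u' → Th R m o (t.seq t') (u.seq u')
  | par {m n o p k l} {t u : Trm S m n} {t' u' : Trm S o p} (hk : m + o = k) (hl : n + p = l) :
      Th R m n t u → Th R o p t' u' → Th R k l (t.par t' hk hl) (u.par u' hk hl)

/-- A symmetric monoidal theory `⟨Σ, E⟩`. -/
structure SMT where
  /-- the generators -/
  sig : Signature.{s}
  /-- the equations -/
  eqs : TrmEqs sig

/-- Provable equality `Th(E ∪ SMT)` of terms of a symmetric monoidal theory. -/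
def SMT.Eqv (T : SMT.{s}) (m n : ℕ) : Trm T.sig m n → Trm T.sig m n → Prop :=
  Th (fun m n t t' => T.eqs m n t t' ∨ SMTAx T.sig m n t t') m n

namespace SMT

open Trm

variable {T : SMT.{s}}

theorem eqvAx {m n} {t t' : Trm T.sig m n} (h : SMTAx T.sig m n t t') : T.Eqv m n t t' :=
  Th.ax (Or.inr h)

theorem eqv_equivalence (T : SMT.{s}) (m n : ℕ) : Equivalence (T.Eqv m n) :=
  ⟨Th.refl, Th.symm, Th.trans⟩

/-- Arrows of the presented PROP: terms modulo provable equality. -/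
instance setoid (T : SMT.{s}) (m n : ℕ) : Setoid (Trm T.sig m n) :=
  ⟨T.Eqv m n, T.eqv_equivalence m n⟩

/-- Arrows of the presented PROP. -/
def Arr (T : SMT.{s}) (m n : ℕ) : Type s := Quotient (T.setoid m n)

/-- The class of a term. -/
def cls {m n : ℕ} (t : Trm T.sig m n) : T.Arr m n := Quotient.mk _ t

theorem cls_eq {m n} {t t' : Trm T.sig m n} : cls t = cls t' ↔ T.Eqv m n t t' := Quotient.eq

theorem cls_ax {m n} {t t' : Trm T.sig m n} (h : SMTAx T.sig m n t t') : cls t = cls t' :=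
  Quotient.sound (eqvAx h)

/-- Sequential composition of classes. -/
def comp {m n o : ℕ} (f : T.Arr m n) (g : T.Arr n o) : T.Arr m o :=
  Quotient.map₂ Trm.seq (fun _ _ h _ _ h' => Th.seq h h') f g

/-- Parallel composition of classes. -/
def tensor {m n o p k l : ℕ} (f : T.Arr m n) (g : T.Arr o p) (hk : m + o = k) (hl : n + p = l) :
    T.Arr k l :=
  Quotient.map₂ (fun t t' => Trm.par t t' hk hl) (fun _ _ h _ _ h' => Th.par hk hl h h') f g

theorem cls_seq {m n o} (t : Trm T.sig m n) (t' : Trm T.sig n o) :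
    cls (seq t t') = comp (cls t) (cls t') := rfl

theorem cls_par {m n o p k l} (t : Trm T.sig m n) (t' : Trm T.sig o p) (hk : m + o = k)
    (hl : n + p = l) : cls (par t t' hk hl) = tensor (cls t) (cls t') hk hl := rfl

theorem exists_cls {m n} (f : T.Arr m n) : ∃ t, cls t = f := Quotient.exists_rep f

theorem id_comp {m n} (f : T.Arr m n) : comp (cls (idn m)) f = f := by
  obtain ⟨t, rfl⟩ := exists_cls f; exact cls_ax (.id_seq t)

theorem comp_id {m n} (f : T.Arr m n) : comp f (cls (idn n)) = f := by
  obtain ⟨t, rfl⟩ := exists_cls f; exact cls_ax (.seq_id t)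

theorem assoc {m n o p} (f : T.Arr m n) (g : T.Arr n o) (h : T.Arr o p) :
    comp (comp f g) h = comp f (comp g h) := by
  obtain ⟨t, rfl⟩ := exists_cls f
  obtain ⟨t', rfl⟩ := exists_cls g
  obtain ⟨t'', rfl⟩ := exists_cls h
  exact cls_ax (.seq_assoc t t' t'')

theorem tensor_assoc {m₁ n₁ m₂ n₂ m₃ n₃ i j i' j' k l}
    (f : T.Arr m₁ n₁) (g : T.Arr m₂ n₂) (h : T.Arr m₃ n₃)
    (h₁ : m₁ + m₂ = i) (h₂ : n₁ + n₂ = j) (h₃ : i + m₃ = k) (h₄ : j + n₃ = l)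
    (h₅ : m₂ + m₃ = i') (h₆ : n₂ + n₃ = j') (h₇ : m₁ + i' = k) (h₈ : n₁ + j' = l) :
    tensor (tensor f g h₁ h₂) h h₃ h₄ = tensor f (tensor g h h₅ h₆) h₇ h₈ := by
  obtain ⟨t, rfl⟩ := exists_cls f
  obtain ⟨t', rfl⟩ := exists_cls g
  obtain ⟨t'', rfl⟩ := exists_cls h
  exact cls_ax (.par_assoc t t' t'' _ _ _ _ _ _ _ _)

theorem unit_tensor {m n} (f : T.Arr m n) :
    tensor (cls (idn 0)) f (Nat.zero_add m) (Nat.zero_add n) = f := by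
  obtain ⟨t, rfl⟩ := exists_cls f; exact cls_ax (.empty_par t)

theorem tensor_unit {m n} (f : T.Arr m n) :
    tensor f (cls (idn 0)) (Nat.add_zero m) (Nat.add_zero n) = f := by
  obtain ⟨t, rfl⟩ := exists_cls f; exact cls_ax (.par_empty t)

theorem interchange {m n o m' n' o' i j k} (f : T.Arr m n) (g : T.Arr n o)
    (f' : T.Arr m' n') (g' : T.Arr n' o') (hi : m + m' = i) (hj : n + n' = j) (hk : o + o' = k) :
    tensor (comp f g) (comp f' g') hi hk = comp (tensor f f' hi hj) (tensor g g' hj hk) := by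
  obtain ⟨t, rfl⟩ := exists_cls f
  obtain ⟨t', rfl⟩ := exists_cls g
  obtain ⟨u, rfl⟩ := exists_cls f'
  obtain ⟨u', rfl⟩ := exists_cls g'
  exact cls_ax (.interchange t t' u u' hi hj hk)

theorem tensor_id (m n k : ℕ) (h : m + n = k) :
    tensor (T := T) (cls (idn m)) (cls (idn n)) h h = cls (idn k) := by
  induction n generalizing k with
  | zero => subst h; exact tensor_unit _
  | succ n ih =>
    subst h
    change tensor (cls (idn m)) (tensor (cls (idn n)) (cls .id) rfl rfl) _ _ =
      tensor (cls (idn (m + n))) (cls .id) rfl rfl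
    rw [← ih (m + n) rfl]
    exact (tensor_assoc _ _ _ _ _ _ _ _ _ _ _).symm

theorem symm_natural {m n o p} (f : T.Arr m n) (g : T.Arr o p) :
    comp (tensor f g rfl rfl) (cls (symT n p)) = comp (cls (symT m o)) (tensor g f rfl rfl) := by
  obtain ⟨t, rfl⟩ := exists_cls f
  obtain ⟨t', rfl⟩ := exists_cls g
  exact cls_ax (.natural t t')


theorem comp_tensor_id {m n o i j k} (p : ℕ) (f : T.Arr m n) (g : T.Arr n o) (hi : m + p = i)
    (hj : n + p = j) (hk : o + p = k) :
    tensor (comp f g) (cls (idn p)) hi hk =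
      comp (tensor f (cls (idn p)) hi hj) (tensor g (cls (idn p)) hj hk) := by
  rw [← interchange, id_comp]

theorem id_tensor_comp {m n o i j k} (p : ℕ) (f : T.Arr m n) (g : T.Arr n o) (hi : p + m = i)
    (hj : p + n = j) (hk : p + o = k) :
    tensor (cls (idn p)) (comp f g) hi hk =
      comp (tensor (cls (idn p)) f hi hj) (tensor (cls (idn p)) g hj hk) := by
  rw [← interchange, id_comp]

theorem tensor_comm {m n m' n' i j j' k} (f : T.Arr m n) (g : T.Arr m' n') (hi : m + m' = i)
    (hj : m + n' = j) (hj' : n + m' = j') (hk : n + n' = k) :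
    comp (tensor (cls (idn m)) g hi hj) (tensor f (cls (idn n')) hj hk) =
      comp (tensor f (cls (idn m')) hi hj') (tensor (cls (idn n)) g hj' hk) := by
  rw [← interchange, ← interchange, id_comp, comp_id, comp_id, id_comp]

theorem tensor_id_id (m n p : ℕ) {a b i j k l} (f : T.Arr a b) (hi : a + m = i) (hj : b + m = j)
    (hk : i + n = k) (hl : j + n = l) (hp : m + n = p) (hk' : a + p = k) (hl' : b + p = l) :
    tensor (tensor f (cls (idn m)) hi hj) (cls (idn n)) hk hl =
      tensor f (cls (idn p)) hk' hl' := by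
  rw [← tensor_id m n p hp]
  exact tensor_assoc _ _ _ _ _ _ _ _ _ _ _

theorem id_id_tensor (m n p : ℕ) {a b i j k l} (f : T.Arr a b) (hi : n + a = i) (hj : n + b = j)
    (hk : m + i = k) (hl : m + j = l) (hp : m + n = p) (hk' : p + a = k) (hl' : p + b = l) :
    tensor (cls (idn m)) (tensor (cls (idn n)) f hi hj) hk hl =
      tensor (cls (idn p)) f hk' hl' := by
  rw [← tensor_id m n p hp]
  exact (tensor_assoc _ _ _ _ _ _ _ _ _ _ _).symm

theorem cls_id : cls (T := T) .id = cls (idn 1) := (cls_ax (.empty_par .id)).symm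

/-- The class of `σ_{1,n}`, with flexible arities. -/
def sOne (T : SMT.{s}) (n : ℕ) {k l : ℕ} (hk : 1 + n = k) (hl : n + 1 = l) : T.Arr k l :=
  hk ▸ hl ▸ cls (symOne n)

/-- The class of `σ_{m,n}`, with flexible arities. -/
def sT (T : SMT.{s}) (m n : ℕ) {k l : ℕ} (hk : m + n = k) (hl : n + m = l) : T.Arr k l :=
  hk ▸ hl ▸ cls (symT m n)

theorem sOne_zero {k} (hk : 1 + 0 = k) (hl : 0 + 1 = k) : T.sOne 0 hk hl = cls (idn k) := by
  subst hk; exact cls_id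

theorem sOne_succ (n : ℕ) {k l i j i'} (hk : 1 + (n + 1) = k) (hl : n + 1 + 1 = l)
    (h₁ : 1 + n = i) (h₂ : n + 1 = j) (h₃ : i + 1 = k) (h₄ : j + 1 = i') (h₅ : n + 2 = i')
    (h₆ : n + 2 = l) :
    T.sOne (n + 1) hk hl = comp (tensor (T.sOne n h₁ h₂) (cls (idn 1)) h₃ h₄)
      (tensor (cls (idn n)) (cls .sym) h₅ h₆) := by
  subst h₁ h₂ h₃ h₄ h₆
  rw [← cls_id]; rfl

theorem sOne_add (n p : ℕ) {k l i j i'} (hk : 1 + (n + p) = k) (hl : n + p + 1 = l)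
    (h₁ : 1 + n = i) (h₂ : n + 1 = j) (h₃ : i + p = k) (h₄ : j + p = i')
    {x y} (h₅ : 1 + p = x) (h₆ : p + 1 = y) (h₇ : n + x = i') (h₈ : n + y = l) :
    T.sOne (n + p) hk hl = comp (tensor (T.sOne n h₁ h₂) (cls (idn p)) h₃ h₄)
      (tensor (cls (idn n)) (T.sOne p h₅ h₆) h₇ h₈) := by
  induction p generalizing k l i' x y with
  | zero =>
    subst h₁ h₂ h₃ h₄ h₅ h₆ h₈
    rw [sOne_zero, tensor_id, comp_id, tensor_unit]
    rfl
  | succ p ih =>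
    subst h₆
    change T.sOne (n + p + 1) hk hl = _
    rw [sOne_succ (T := T) (n + p) (i := n + p + 1) (j := n + p + 1) (i' := l) (by omega)
      (by omega) (by omega) (by omega) (by omega) (by omega) (by omega) (by omega),
      sOne_succ (T := T) p (i := p + 1) (j := p + 1) (i' := p + 1 + 1) h₅ rfl (by omega) (by omega)
        (by omega) (by omega) (by omega) (by omega),
      id_tensor_comp (j := l) n _ _ _ (by omega) _,
      ih (i' := n + p + 1) (x := p + 1) (y := p + 1) (by omega) (by omega)
        (by omega) (by omega) (by omega) (by omega) (by omega) (by omega),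
      comp_tensor_id (j := i') 1 _ _ _ (by omega) _, assoc,
      tensor_id_id (T := T) p 1 (p + 1) (T.sOne n h₁ h₂) _ _ _ (by omega) (by omega) (by omega)
        (by omega),
      tensor_assoc (i' := x) (j' := p + 1 + 1) _ _ _ _ _ _ _ (by omega) (by omega) (by omega) (by omega),
      id_id_tensor (T := T) n p (n + p) (cls .sym) _ _ _ _ rfl (by omega) (by omega)]

theorem sT_zero (n : ℕ) {k} (hk : 0 + n = k) (hl : n + 0 = k) : T.sT 0 n hk hl = cls (idn k) := by
  have key : ∀ (l k k' : ℕ) (h : 0 + n = k) (h' : 0 + n = l) (h'' : l = k'),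
      (h ▸ h'' ▸ cls (Trm.par .empty (idn n) rfl h' : Trm T.sig (0 + n) l) : T.Arr k k') =
        cls (Trm.par .empty (idn n) h (h'.trans h'')) := by
    rintro l k k' rfl h' rfl; rfl
  refine (key _ _ _ hk _ hl).trans ?_
  obtain rfl : n = k := hl
  exact cls_ax (.empty_par _)

theorem sT_succ (m n : ℕ) {k l i j x y} (hk : m + 1 + n = k) (hl : n + (m + 1) = l)
    (h₁ : 1 + n = i) (h₂ : n + 1 = j) (h₃ : m + i = k) (h₄ : m + j = x)
    (h₅ : m + n = y) {z} (h₆ : n + m = z) (h₇ : y + 1 = x) (h₈ : z + 1 = l) :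
    T.sT (m + 1) n hk hl = comp (tensor (cls (idn m)) (T.sOne n h₁ h₂) h₃ h₄)
      (tensor (T.sT m n h₅ h₆) (cls (idn 1)) h₇ h₈) := by
  subst h₁ h₂ h₄ h₅ h₆ h₈ hk
  rw [← cls_id]; rfl

theorem sT_add (m n p : ℕ) {k l i j x} (hk : m + (n + p) = k) (hl : n + p + m = l)
    (h₁ : m + n = i) (h₂ : n + m = j) (h₃ : i + p = k) (h₄ : j + p = x)
    {y z} (h₅ : m + p = y) (h₆ : p + m = z) (h₇ : n + y = x) (h₈ : n + z = l) :
    T.sT m (n + p) hk hl = comp (tensor (T.sT m n h₁ h₂) (cls (idn p)) h₃ h₄)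
      (tensor (cls (idn n)) (T.sT m p h₅ h₆) h₇ h₈) := by
  induction m generalizing k l i j x y z with
  | zero =>
    obtain rfl : i = j := by omega
    obtain rfl : k = l := by omega
    obtain rfl : y = z := by omega
    obtain rfl : k = x := by omega
    rw [sT_zero, sT_zero, sT_zero, tensor_id, tensor_id, comp_id]
  | succ m ih =>
    rw [sT_succ (T := T) m (n + p) (i := n + p + 1) (j := n + p + 1) (x := k) (y := m + (n + p))
        (z := n + p + m) (by omega) (by omega) (by omega) (by omega) (by omega) (by omega)
        (by omega) (by omega) (by omega) (by omega),
      sT_succ (T := T) m n (i := n + 1) (j := n + 1) (x := i) (y := m + n)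
        (z := n + m) (by omega) (by omega) (by omega) (by omega) (by omega) (by omega)
        (by omega) (by omega) (by omega) (by omega),
      sT_succ (T := T) m p (i := p + 1) (j := p + 1) (x := y) (y := m + p)
        (z := p + m) (by omega) (by omega) (by omega) (by omega) (by omega) (by omega)
        (by omega) (by omega) (by omega) (by omega),
      sOne_add (T := T) n p (i := n + 1) (j := n + 1) (i' := n + p + 1) (x := p + 1) (y := p + 1)
        (by omega) (by omega) (by omega) (by omega) (by omega) (by omega) (by omega) (by omega)
        (by omega) (by omega),
      ih (k := m + (n + p)) (l := n + p + m) (i := m + n) (j := n + m) (x := n + m + p)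
        (y := m + p) (z := p + m) (by omega) (by omega) (by omega) (by omega) (by omega) (by omega)
        (by omega) (by omega) (by omega) (by omega),
      id_tensor_comp (j := k) m _ _ _ (by omega) _,
      comp_tensor_id (j := x) 1 _ _ _ (by omega) _,
      comp_tensor_id (j := k) p _ _ _ (by omega) _,
      id_tensor_comp (j := x) n _ _ _ (by omega) _,
      tensor_assoc (i' := n + p + 1) (j' := n + p + 1) (cls (idn m)) (T.sOne n _ _) (cls (idn p))
        _ _ _ _ (by omega) (by omega) (by omega) (by omega),
      id_id_tensor m n (m + n) (T.sOne p _ _) _ _ _ _ rfl (by omega) (by omega),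
      id_id_tensor n m (n + m) (T.sOne p _ _) _ _ _ _ rfl (by omega) (by omega),
      tensor_id_id p 1 (p + 1) (T.sT m n _ _) _ _ _ _ rfl (by omega) (by omega),
      tensor_id_id 1 p (p + 1) (T.sT m n _ _) _ _ _ _ (by omega) (by omega) (by omega),
      tensor_assoc (i' := y) (j' := z) (cls (idn n)) (T.sT m p _ _) (cls (idn 1))
        _ _ _ _ (by omega) (by omega) (by omega) (by omega),
      assoc, assoc, ← assoc (tensor (cls (idn (m + n))) _ _ _),
      tensor_comm (j' := x) (T.sT m n _ _) (T.sOne p _ _) _ _ (by omega) _, assoc]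

theorem sOne_comp (n : ℕ) {k l} (hk : 1 + n = k) (hl : n + 1 = l) :
    comp (T.sOne n hk hl) (T.sT n 1 hl hk) = cls (idn k) := by
  induction n generalizing k l with
  | zero =>
    obtain rfl : k = l := by omega
    rw [sOne_zero, sT_zero, comp_id]
  | succ n ih =>
    have hs : T.sOne 1 (k := 2) (l := 2) rfl rfl = cls .sym := by
      rw [sOne_succ (T := T) 0 (i := 1) (j := 1) (i' := 2) rfl rfl rfl rfl rfl rfl rfl rfl,
        sOne_zero, tensor_id, id_comp]
      exact cls_ax (.empty_par _)
    subst hl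
    rw [sOne_succ (T := T) n (i := n + 1) (j := n + 1) (i' := n + 2) (by omega) (by omega)
        (by omega) (by omega) (by omega) (by omega) (by omega) (by omega),
      sT_succ (T := T) n 1 (i := 2) (j := 2) (x := n + 1 + 1) (y := n + 1) (z := n + 1)
        rfl hk rfl rfl rfl rfl rfl (by omega) rfl (by omega), hs, assoc,
      ← assoc (tensor (cls (idn n)) _ _ _), ← id_tensor_comp n (.sym |> cls) (.sym |> cls),
      ← cls_seq, cls_ax .sym_sym, tensor_id, id_comp, ← comp_tensor_id, ih, tensor_id]

theorem sT_right_zero (m : ℕ) {k} (hk : m + 0 = k) (hl : 0 + m = k) :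
    T.sT m 0 hk hl = cls (idn k) := by
  induction m generalizing k with
  | zero => exact sT_zero 0 hk hl
  | succ m ih =>
    rw [sT_succ (T := T) m 0 (i := 1) (j := 1) (x := k) (y := m) (z := m) (by omega) (by omega)
      (by omega) (by omega) (by omega) (by omega) (by omega) (by omega) (by omega) (by omega),
      ih, sOne_zero, tensor_id, comp_id]

theorem sT_comp (m n : ℕ) {k l} (hk : m + n = k) (hl : n + m = l) :
    comp (T.sT m n hk hl) (T.sT n m hl hk) = cls (idn k) := by
  induction m generalizing k l with
  | zero =>
    obtain rfl : k = l := by omega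
    rw [sT_zero, sT_right_zero, comp_id]
  | succ m ih =>
    subst hl
    rw [sT_succ (T := T) m n (i := n + 1) (j := n + 1) (x := k) (y := m + n) (z := n + m)
        (by omega) (by omega) (by omega) (by omega) (by omega) (by omega) (by omega) (by omega)
        (by omega) (by omega),
      sT_add (T := T) n m 1 (i := n + m) (j := m + n) (x := k) (y := n + 1) (z := n + 1)
        (by omega) (by omega) (by omega) (by omega) (by omega) (by omega) (by omega) (by omega)
        (by omega) (by omega), assoc, ← assoc (tensor (T.sT m n _ _) _ _ _), ← comp_tensor_id,
      ih, tensor_id, id_comp, ← id_tensor_comp, sOne_comp, tensor_id]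

/-- The PROP `Trm(Σ)/Th(E ∪ SMT)` presented by a symmetric monoidal theory. -/
def toPROP (T : SMT.{s}) : PROP.{s} where
  Hom := T.Arr
  id n := cls (idn n)
  comp := comp
  tensor := tensor
  symm m n := cls (symT m n)
  id_comp := id_comp
  comp_id := comp_id
  assoc := assoc
  tensor_assoc := tensor_assoc
  unit_tensor := unit_tensor
  tensor_unit := tensor_unit
  tensor_id m n := tensor_id m n _ rfl
  interchange f g f' g' := interchange f g f' g' rfl rfl rfl
  symm_natural := symm_natural
  symm_symm m n := sT_comp m n rfl rfl
  hexagon m n p := sT_add m n p rfl rfl rfl rfl _ _ rfl rfl _ _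

end SMT

/-! ## Names, finite permutations and enumerations of finite sets of names -/

/-- `C` is the union of the disjoint finite sets `A` and `B`, that is, `A ⊎ B` is defined and equal
to `C`. -/
structure IsDisjUnion {𝒩 : Type w} (A B C : Finset 𝒩) : Prop where
  disjoint : Disjoint A B
  mem_iff : ∀ x, x ∈ C ↔ x ∈ A ∨ x ∈ B

theorem IsDisjUnion.symm {𝒩 : Type w} {A B C : Finset 𝒩} (h : IsDisjUnion A B C) :
    IsDisjUnion B A C := ⟨h.disjoint.symm, fun x => (h.mem_iff x).trans or_comm⟩

theorem IsDisjUnion.empty_left {𝒩 : Type w} (A : Finset 𝒩) : IsDisjUnion ∅ A A :=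
  ⟨Finset.disjoint_empty_left A, by simp⟩

theorem IsDisjUnion.exists_assoc {𝒩 : Type w} {A B C X Y : Finset 𝒩} (h : IsDisjUnion B C X)
    (h' : IsDisjUnion A X Y) : ∃ Z, IsDisjUnion A B Z ∧ IsDisjUnion Z C Y := by
  classical
  have h1 := h.mem_iff
  have h2 := h'.mem_iff
  have h3 := Finset.disjoint_left.1 h.disjoint
  have h4 := Finset.disjoint_left.1 h'.disjoint
  refine ⟨A ∪ B, ⟨Finset.disjoint_left.2 ?_, by simp⟩, ⟨Finset.disjoint_left.2 ?_, ?_⟩⟩ <;>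
    intro x <;> have := @h3 x <;> have := @h4 x <;> simp only [Finset.mem_union, h1, h2] at * <;>
    tauto

theorem IsDisjUnion.unique {𝒩 : Type w} {A B C C' : Finset 𝒩} (h : IsDisjUnion A B C)
    (h' : IsDisjUnion A B C') : C = C' := by
  ext x; rw [h.mem_iff, h'.mem_iff]

open Classical in
/-- The bijection `A ⊕ B ≃ C` if `C` is the disjoint union of `A` and `B`. -/
noncomputable def IsDisjUnion.sumEquiv {𝒩 : Type w} {A B C : Finset 𝒩} (h : IsDisjUnion A B C) :
    A ⊕ B ≃ C where
  toFun := Sum.elim (fun x => ⟨x, (h.mem_iff x).2 (Or.inl x.2)⟩)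
    (fun x => ⟨x, (h.mem_iff x).2 (Or.inr x.2)⟩)
  invFun x := if hx : (x : 𝒩) ∈ A then Sum.inl ⟨x, hx⟩
    else Sum.inr ⟨x, ((h.mem_iff x).1 x.2).resolve_left hx⟩
  left_inv := by
    rintro (x | x)
    · simp
    · have : (x : 𝒩) ∉ A := fun hx => Finset.disjoint_left.1 h.disjoint hx x.2
      simp [this]
  right_inv x := by
    by_cases hx : (x : 𝒩) ∈ A <;> simp [hx]

/-- The bijection `e ⊎ e' : A ⊎ A' → B ⊎ B'`. -/
noncomputable def IsDisjUnion.congr {𝒩 : Type w} {A A' B B' C D : Finset 𝒩}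
    (hC : IsDisjUnion A A' C) (hD : IsDisjUnion B B' D) (e : A ≃ B) (e' : A' ≃ B') : C ≃ D :=
  hC.sumEquiv.symm.trans ((Equiv.sumCongr e e').trans hD.sumEquiv)

/-- A list of pairwise distinct names `a₁, …, aₙ` with underlying set `A` is a bijection
`Fin n ≃ A`. This is the concatenation of two such lists. -/
noncomputable def IsDisjUnion.append {𝒩 : Type w} {A B C : Finset 𝒩} {m n : ℕ}
    (h : IsDisjUnion A B C) (a : Fin m ≃ A) (b : Fin n ≃ B) : Fin (m + n) ≃ C :=
  finSumFinEquiv.symm.trans ((Equiv.sumCongr a b).trans h.sumEquiv)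

open Classical in
/-- The group of finite permutations of the names: those generated by transpositions. -/
abbrev FinPerm (𝒩 : Type w) : Type w :=
  ↥(Subgroup.closure {π : Equiv.Perm 𝒩 | π.IsSwap})

/-- `π · A = {π a | a ∈ A}`. -/
def FinPerm.act {𝒩 : Type w} (π : FinPerm 𝒩) (A : Finset 𝒩) : Finset 𝒩 :=
  A.map π.1.toEmbedding

/-- The bijection `π_A : A → π · A`, `a ↦ π a`. -/
def FinPerm.onSet {𝒩 : Type w} (π : FinPerm 𝒩) {A C : Finset 𝒩} (h : π.act A = C) : A ≃ C where
  toFun x := ⟨π.1 x, h ▸ Finset.mem_map_of_mem π.1.toEmbedding x.2⟩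
  invFun y := ⟨π.1.symm y, by
    have hy := y.2
    simp only [← h, FinPerm.act, Finset.mem_map_equiv] at hy
    exact hy⟩
  left_inv x := by simp
  right_inv y := by simp

/-! ## Nominal PROPs -/

/-- A nominal PROP: a category whose objects are the finite sets of names, with all bijections
`A → B` as arrows ("renamings"), and with a partial tensor `⊎` that is defined on pairs of arrows
with disjoint domains and disjoint codomains, is commutative and associative, has the empty
function as a unit, and satisfies the interchange law. The permutation action on arrows is
`π · f = (π_A)⁻¹ ; f ; π_B`. As in a PROP, distinct bijections may become equal as arrows. -/
structure NPROP (𝒩 : Type w) where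
  /-- arrows `A → B` -/
  Hom : Finset 𝒩 → Finset 𝒩 → Type u
  /-- identities -/
  id : ∀ A, Hom A A
  /-- sequential composition `f ; g` -/
  comp : ∀ {A B C}, Hom A B → Hom B C → Hom A C
  /-- parallel composition `f ⊎ g` -/
  tensor : ∀ {A B A' B' C D}, Hom A B → Hom A' B' → IsDisjUnion A A' C → IsDisjUnion B B' D →
    Hom C D
  /-- the arrow given by a bijection -/
  ren : ∀ {A B : Finset 𝒩}, (A ≃ B) → Hom A B
  id_comp : ∀ {A B} (f : Hom A B), comp (id A) f = f
  comp_id : ∀ {A B} (f : Hom A B), comp f (id B) = f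
  assoc : ∀ {A B C D} (f : Hom A B) (g : Hom B C) (h : Hom C D),
    comp (comp f g) h = comp f (comp g h)
  ren_refl : ∀ A : Finset 𝒩, ren (Equiv.refl A) = id A
  ren_trans : ∀ {A B C : Finset 𝒩} (e : A ≃ B) (e' : B ≃ C),
    ren (e.trans e') = comp (ren e) (ren e')
  ren_tensor : ∀ {A B A' B' C D : Finset 𝒩} (e : A ≃ B) (e' : A' ≃ B') (hC : IsDisjUnion A A' C)
    (hD : IsDisjUnion B B' D), ren (hC.congr hD e e') = tensor (ren e) (ren e') hC hD
  tensor_comm : ∀ {A B A' B' C D} (f : Hom A B) (g : Hom A' B') (hC : IsDisjUnion A A' C)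
    (hD : IsDisjUnion B B' D) (hC' : IsDisjUnion A' A C) (hD' : IsDisjUnion B' B D),
    tensor f g hC hD = tensor g f hC' hD'
  tensor_assoc : ∀ {A₁ B₁ A₂ B₂ A₃ B₃ I J I' J' C D}
    (f : Hom A₁ B₁) (g : Hom A₂ B₂) (h : Hom A₃ B₃)
    (h₁ : IsDisjUnion A₁ A₂ I) (h₂ : IsDisjUnion B₁ B₂ J) (h₃ : IsDisjUnion I A₃ C)
    (h₄ : IsDisjUnion J B₃ D) (h₅ : IsDisjUnion A₂ A₃ I') (h₆ : IsDisjUnion B₂ B₃ J')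
    (h₇ : IsDisjUnion A₁ I' C) (h₈ : IsDisjUnion B₁ J' D),
    tensor (tensor f g h₁ h₂) h h₃ h₄ = tensor f (tensor g h h₅ h₆) h₇ h₈
  unit_tensor : ∀ {A B} (f : Hom A B) (hA : IsDisjUnion ∅ A A) (hB : IsDisjUnion ∅ B B),
    tensor (id ∅) f hA hB = f
  interchange : ∀ {A B C A' B' C' I J K} (f : Hom A B) (g : Hom B C) (f' : Hom A' B')
    (g' : Hom B' C') (hI : IsDisjUnion A A' I) (hJ : IsDisjUnion B B' J)
    (hK : IsDisjUnion C C' K),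
    tensor (comp f g) (comp f' g') hI hK = comp (tensor f f' hI hJ) (tensor g g' hJ hK)

/-- The permutation action on arrows: `π · f = (π_A)⁻¹ ; f ; π_B : π · A → π · B`. -/
def NPROP.act {𝒩 : Type w} (T : NPROP.{u} 𝒩) (π : FinPerm 𝒩) {A B A' B' : Finset 𝒩}
    (hA : π.act A = A') (hB : π.act B = B') (f : T.Hom A B) : T.Hom A' B' :=
  T.comp (T.ren (π.onSet hA).symm) (T.comp f (T.ren (π.onSet hB)))

/-- An isomorphism of nominal PROPs: a strict monoidal functor that is the identity on objects and
on bijections (hence equivariant), and that is bijective on arrows. -/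
structure NPROP.Iso {𝒩 : Type w} (P : NPROP.{u} 𝒩) (Q : NPROP.{v} 𝒩) where
  /-- the bijection on arrows -/
  equiv : ∀ A B, P.Hom A B ≃ Q.Hom A B
  map_id : ∀ A, equiv A A (P.id A) = Q.id A
  map_comp : ∀ {A B C} (f : P.Hom A B) (g : P.Hom B C),
    equiv A C (P.comp f g) = Q.comp (equiv A B f) (equiv B C g)
  map_tensor : ∀ {A B A' B' C D} (f : P.Hom A B) (g : P.Hom A' B') (hC : IsDisjUnion A A' C)
    (hD : IsDisjUnion B B' D),
    equiv C D (P.tensor f g hC hD) = Q.tensor (equiv A B f) (equiv A' B' g) hC hD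
  map_ren : ∀ {A B : Finset 𝒩} (e : A ≃ B), equiv A B (P.ren e) = Q.ren e

/-! ## Nominal monoidal theories -/

/-- The nominal terms over a signature. The nominal generators are `[a⟩ γ ⟨b]`, with lists `a`, `b`
enumerating `A`, `B`. The empty diagram `empty : ∅ → ∅` is the unit of `⊎`. The formal permutation
`π · t` is allowed for all finite permutations `π`, which are the products of transpositions. -/
inductive NTrm (𝒩 : Type w) (S : Signature.{s}) : Finset 𝒩 → Finset 𝒩 → Type (max s w)
  | gen {A B : Finset 𝒩} (γ : S.Gen) (a : Fin (S.ar γ) ≃ A) (b : Fin (S.coar γ) ≃ B) : NTrm 𝒩 S A B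
  | empty : NTrm 𝒩 S ∅ ∅
  | id (x : 𝒩) : NTrm 𝒩 S {x} {x}
  | delta (x y : 𝒩) : NTrm 𝒩 S {x} {y}
  | par {A B A' B' C D : Finset 𝒩} (t : NTrm 𝒩 S A B) (t' : NTrm 𝒩 S A' B')
      (hC : IsDisjUnion A A' C) (hD : IsDisjUnion B B' D) : NTrm 𝒩 S C D
  | seq {A B C : Finset 𝒩} (t : NTrm 𝒩 S A B) (t' : NTrm 𝒩 S B C) : NTrm 𝒩 S A C
  | perm {A B A' B' : Finset 𝒩} (π : FinPerm 𝒩) (t : NTrm 𝒩 S A B) (hA : π.act A = A')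
      (hB : π.act B = B') : NTrm 𝒩 S A' B'

/-- The list `l` enumerates the set `A` without repetitions. -/
structure Enumerates {𝒩 : Type w} (l : List 𝒩) (A : Finset 𝒩) : Prop where
  nodup : l.Nodup
  mem_iff : ∀ x, x ∈ A ↔ x ∈ l

namespace Enumerates

variable {𝒩 : Type w}

theorem eq_empty {A : Finset 𝒩} (h : Enumerates [] A) : ∅ = A := by
  ext x; simp [h.mem_iff]

/-- The set of elements of the tail of a list without repetitions. -/
def tailSet {x : 𝒩} {l : List 𝒩} {A : Finset 𝒩} (h : Enumerates (x :: l) A) : Finset 𝒩 :=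
  ⟨l, (List.nodup_cons.1 h.nodup).2⟩

theorem tail {x : 𝒩} {l : List 𝒩} {A : Finset 𝒩} (h : Enumerates (x :: l) A) :
    Enumerates l h.tailSet :=
  ⟨(List.nodup_cons.1 h.nodup).2, fun _ => Iff.rfl⟩

theorem isDisjUnion {x : 𝒩} {l : List 𝒩} {A B : Finset 𝒩} (h : Enumerates (x :: l) A)
    (hB : Enumerates l B) : IsDisjUnion {x} B A where
  disjoint := by
    rw [Finset.disjoint_singleton_left, hB.mem_iff]
    exact (List.nodup_cons.1 h.nodup).1
  mem_iff y := by simp [h.mem_iff, hB.mem_iff]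

end Enumerates

namespace NTrm

variable {𝒩 : Type w} {S : Signature.{s}}

/-- The empty diagram, for any name of the empty set. -/
def emptyOf {A B : Finset 𝒩} (hA : ∅ = A) (hB : ∅ = B) : NTrm 𝒩 S A B := hA ▸ hB ▸ empty

/-- The term `id_A = id_{a₁} ⊎ … ⊎ id_{aₙ}`, for an enumeration `a₁, …, aₙ` of `A`. -/
def idn : (l : List 𝒩) → {A : Finset 𝒩} → Enumerates l A → NTrm 𝒩 S A A
  | [], _, h => emptyOf h.eq_empty h.eq_empty
  | x :: l, _, h => par (id x) (idn l h.tail) (h.isDisjUnion h.tail) (h.isDisjUnion h.tail)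

/-- The term `δ_{a₁ b₁} ⊎ … ⊎ δ_{aₙ bₙ}`, for a list of pairs `(a₁, b₁), …, (aₙ, bₙ)`. -/
def deltas : (l : List (𝒩 × 𝒩)) → {A B : Finset 𝒩} → Enumerates (l.map Prod.fst) A →
    Enumerates (l.map Prod.snd) B → NTrm 𝒩 S A B
  | [], _, _, hA, hB => emptyOf hA.eq_empty hB.eq_empty
  | p :: l, _, _, hA, hB => par (delta p.1 p.2) (deltas l hA.tail hB.tail)
      (hA.isDisjUnion hA.tail) (hB.isDisjUnion hB.tail)

end NTrm

/-- A family of equations between nominal terms with equal domain and codomain. -/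
abbrev NTrmEqs (𝒩 : Type w) (S : Signature.{s}) :=
  ∀ A B : Finset 𝒩, NTrm 𝒩 S A B → NTrm 𝒩 S A B → Prop

open NTrm in
/-- The equations that hold in every nominal monoidal theory. -/
inductive NMTAx (𝒩 : Type w) (S : Signature.{s}) :
    ∀ A B : Finset 𝒩, NTrm 𝒩 S A B → NTrm 𝒩 S A B → Prop
  -- identities and sequential composition obey the laws of a category
  | seq_assoc {A B C D} (t : NTrm 𝒩 S A B) (t' : NTrm 𝒩 S B C) (t'' : NTrm 𝒩 S C D) :
      NMTAx 𝒩 S A D (seq (seq t t') t'') (seq t (seq t' t''))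
  | id_seq {A B} (t : NTrm 𝒩 S A B) (l : List 𝒩) (h : Enumerates l A) :
      NMTAx 𝒩 S A B (seq (idn l h) t) t
  | seq_id {A B} (t : NTrm 𝒩 S A B) (l : List 𝒩) (h : Enumerates l B) :
      NMTAx 𝒩 S A B (seq t (idn l h)) t
  -- `⊎` is a monoid
  | par_assoc {A₁ B₁ A₂ B₂ A₃ B₃ I J I' J' C D}
      (t₁ : NTrm 𝒩 S A₁ B₁) (t₂ : NTrm 𝒩 S A₂ B₂) (t₃ : NTrm 𝒩 S A₃ B₃)
      (h₁ : IsDisjUnion A₁ A₂ I) (h₂ : IsDisjUnion B₁ B₂ J) (h₃ : IsDisjUnion I A₃ C)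
      (h₄ : IsDisjUnion J B₃ D) (h₅ : IsDisjUnion A₂ A₃ I') (h₆ : IsDisjUnion B₂ B₃ J')
      (h₇ : IsDisjUnion A₁ I' C) (h₈ : IsDisjUnion B₁ J' D) :
      NMTAx 𝒩 S C D (par (par t₁ t₂ h₁ h₂) t₃ h₃ h₄) (par t₁ (par t₂ t₃ h₅ h₆) h₇ h₈)
  | empty_par {A B} (t : NTrm 𝒩 S A B) (hA : IsDisjUnion ∅ A A) (hB : IsDisjUnion ∅ B B) :
      NMTAx 𝒩 S A B (par empty t hA hB) t
  -- `⊎` is commutative and satisfies the interchange law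
  | par_comm {A B A' B' C D} (t : NTrm 𝒩 S A B) (t' : NTrm 𝒩 S A' B') (hC : IsDisjUnion A A' C)
      (hD : IsDisjUnion B B' D) (hC' : IsDisjUnion A' A C) (hD' : IsDisjUnion B' B D) :
      NMTAx 𝒩 S C D (par t t' hC hD) (par t' t hC' hD')
  | interchange {A B C A' B' C' I J K} (t : NTrm 𝒩 S A B) (t' : NTrm 𝒩 S B C)
      (u : NTrm 𝒩 S A' B') (u' : NTrm 𝒩 S B' C') (hI : IsDisjUnion A A' I)
      (hJ : IsDisjUnion B B' J) (hK : IsDisjUnion C C' K) :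
      NMTAx 𝒩 S I K (par (seq t t') (seq u u') hI hK) (seq (par t u hI hJ) (par t' u' hJ hK))
  -- permutation actions
  | perm_one {A B} (t : NTrm 𝒩 S A B) (hA : FinPerm.act 1 A = A) (hB : FinPerm.act 1 B = B) :
      NMTAx 𝒩 S A B (perm 1 t hA hB) t
  | perm_mul {A B A' B' A'' B''} (π ρ : FinPerm 𝒩) (t : NTrm 𝒩 S A B) (hA : ρ.act A = A')
      (hB : ρ.act B = B') (hA' : π.act A' = A'') (hB' : π.act B' = B'')
      (hA'' : (π * ρ).act A = A'') (hB'' : (π * ρ).act B = B'') :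
      NMTAx 𝒩 S A'' B'' (perm (π * ρ) t hA'' hB'') (perm π (perm ρ t hA hB) hA' hB')
  | perm_empty (π : FinPerm 𝒩) (h : π.act ∅ = ∅) : NMTAx 𝒩 S ∅ ∅ (perm π empty h h) empty
  | perm_id (π : FinPerm 𝒩) (x : 𝒩) (h : π.act {x} = {π.1 x}) :
      NMTAx 𝒩 S {π.1 x} {π.1 x} (perm π (id x) h h) (id (π.1 x))
  | perm_delta (π : FinPerm 𝒩) (x y : 𝒩) (hx : π.act {x} = {π.1 x}) (hy : π.act {y} = {π.1 y}) :
      NMTAx 𝒩 S {π.1 x} {π.1 y} (perm π (delta x y) hx hy) (delta (π.1 x) (π.1 y))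
  | perm_gen (π : FinPerm 𝒩) (γ : S.Gen) {A B A' B' : Finset 𝒩} (a : Fin (S.ar γ) ≃ A)
      (b : Fin (S.coar γ) ≃ B) (hA : π.act A = A') (hB : π.act B = B') :
      NMTAx 𝒩 S A' B' (perm π (gen γ a b) hA hB)
        (gen γ (a.trans (π.onSet hA)) (b.trans (π.onSet hB)))
  | perm_par (π : FinPerm 𝒩) {A B A' B' C D A₁ B₁ A₁' B₁' C₁ D₁} (t : NTrm 𝒩 S A B)
      (t' : NTrm 𝒩 S A' B') (hC : IsDisjUnion A A' C) (hD : IsDisjUnion B B' D)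
      (hC₁ : IsDisjUnion A₁ A₁' C₁) (hD₁ : IsDisjUnion B₁ B₁' D₁)
      (hπA : π.act A = A₁) (hπB : π.act B = B₁) (hπA' : π.act A' = A₁') (hπB' : π.act B' = B₁')
      (hπC : π.act C = C₁) (hπD : π.act D = D₁) :
      NMTAx 𝒩 S C₁ D₁ (perm π (par t t' hC hD) hπC hπD)
        (par (perm π t hπA hπB) (perm π t' hπA' hπB') hC₁ hD₁)
  | perm_seq (π : FinPerm 𝒩) {A B C A₁ B₁ C₁} (t : NTrm 𝒩 S A B) (t' : NTrm 𝒩 S B C)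
      (hA : π.act A = A₁) (hB : π.act B = B₁) (hC : π.act C = C₁) :
      NMTAx 𝒩 S A₁ C₁ (perm π (seq t t') hA hC) (seq (perm π t hA hB) (perm π t' hB hC))
  -- renamings
  | delta_self (x : 𝒩) : NMTAx 𝒩 S {x} {x} (delta x x) (id x)
  | delta_delta (x y z : 𝒩) : NMTAx 𝒩 S {x} {z} (seq (delta x y) (delta y z)) (delta x z)
  -- `(δ_{x aᵢ} ⊎ id_{A₀}) ; [a₁ … aᵢ … aₘ⟩ γ ⟨b] = [a₁ … x … aₘ⟩ γ ⟨b]` with `A = {aᵢ} ⊎ A₀`;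
  -- here `a'` is the list `a` with the `i`-th entry replaced by `x = a' i`
  | delta_left (γ : S.Gen) {A A' A₀ B : Finset 𝒩} (a : Fin (S.ar γ) ≃ A) (a' : Fin (S.ar γ) ≃ A')
      (b : Fin (S.coar γ) ≃ B) (i : Fin (S.ar γ)) (ha : ∀ j, j ≠ i → (a' j : 𝒩) = a j)
      (l : List 𝒩) (hl : Enumerates l A₀) (hA' : IsDisjUnion {(a' i : 𝒩)} A₀ A')
      (hA : IsDisjUnion {(a i : 𝒩)} A₀ A) :
      NMTAx 𝒩 S A' B
        (seq (par (delta (a' i : 𝒩) (a i : 𝒩)) (idn l hl) hA' hA) (gen γ a b)) (gen γ a' b)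
  -- `[a⟩ γ ⟨b₁ … bᵢ … bₙ] ; (id_{B₀} ⊎ δ_{bᵢ x}) = [a⟩ γ ⟨b₁ … x … bₙ]` with `B = B₀ ⊎ {bᵢ}`
  | delta_right (γ : S.Gen) {A B B' B₀ : Finset 𝒩} (a : Fin (S.ar γ) ≃ A)
      (b : Fin (S.coar γ) ≃ B) (b' : Fin (S.coar γ) ≃ B') (i : Fin (S.coar γ))
      (hb : ∀ j, j ≠ i → (b' j : 𝒩) = b j) (l : List 𝒩) (hl : Enumerates l B₀)
      (hB : IsDisjUnion B₀ {(b i : 𝒩)} B) (hB' : IsDisjUnion B₀ {(b' i : 𝒩)} B') :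
      NMTAx 𝒩 S A B'
        (seq (gen γ a b) (par (idn l hl) (delta (b i : 𝒩) (b' i : 𝒩)) hB hB')) (gen γ a b')

/-- The deductive closure of a set of equations between nominal terms. -/
inductive NTh {𝒩 : Type w} {S : Signature.{s}} (R : NTrmEqs 𝒩 S) :
    ∀ A B : Finset 𝒩, NTrm 𝒩 S A B → NTrm 𝒩 S A B → Prop
  | ax {A B} {t t' : NTrm 𝒩 S A B} : R A B t t' → NTh R A B t t'
  | refl {A B} (t : NTrm 𝒩 S A B) : NTh R A B t t
  | symm {A B} {t t' : NTrm 𝒩 S A B} : NTh R A B t t' → NTh R A B t' t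
  | trans {A B} {t t' t'' : NTrm 𝒩 S A B} : NTh R A B t t' → NTh R A B t' t'' → NTh R A B t t''
  | seq {A B C} {t u : NTrm 𝒩 S A B} {t' u' : NTrm 𝒩 S B C} :
      NTh R A B t u → NTh R B C t' u' → NTh R A C (t.seq t') (u.seq u')
  | par {A B A' B' C D} {t u : NTrm 𝒩 S A B} {t' u' : NTrm 𝒩 S A' B'}
      (hC : IsDisjUnion A A' C) (hD : IsDisjUnion B B' D) :
      NTh R A B t u → NTh R A' B' t' u' → NTh R C D (t.par t' hC hD) (u.par u' hC hD)
  | perm (π : FinPerm 𝒩) {A B A' B'} {t u : NTrm 𝒩 S A B} (hA : π.act A = A')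
      (hB : π.act B = B') : NTh R A B t u → NTh R A' B' (t.perm π hA hB) (u.perm π hA hB)

/-- A nominal monoidal theory `⟨Σ, E⟩`. It is not required that `E` is closed under permutations,
since the deductive closure is. -/
structure NMT (𝒩 : Type w) where
  /-- the generators -/
  sig : Signature.{s}
  /-- the equations -/
  eqs : NTrmEqs 𝒩 sig

/-- Provable equality `Th(E ∪ NMT)` of terms of a nominal monoidal theory. -/
def NMT.Eqv {𝒩 : Type w} (T : NMT.{w, s} 𝒩) (A B : Finset 𝒩) :
    NTrm 𝒩 T.sig A B → NTrm 𝒩 T.sig A B → Prop :=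
  NTh (fun A B t t' => T.eqs A B t t' ∨ NMTAx 𝒩 T.sig A B t t') A B

namespace NMT

open NTrm

variable {𝒩 : Type w} {T : NMT.{w, s} 𝒩}

theorem eqv_equivalence (T : NMT.{w, s} 𝒩) (A B : Finset 𝒩) : Equivalence (T.Eqv A B) :=
  ⟨NTh.refl, NTh.symm, NTh.trans⟩

/-- Terms modulo provable equality. -/
instance setoid (T : NMT.{w, s} 𝒩) (A B : Finset 𝒩) : Setoid (NTrm 𝒩 T.sig A B) :=
  ⟨T.Eqv A B, T.eqv_equivalence A B⟩

/-- Arrows of the presented nominal PROP. -/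
def Arr (T : NMT.{w, s} 𝒩) (A B : Finset 𝒩) : Type (max s w) := Quotient (T.setoid A B)

/-- The class of a term. -/
def cls {A B : Finset 𝒩} (t : NTrm 𝒩 T.sig A B) : T.Arr A B := Quotient.mk _ t

theorem cls_eq {A B} {t t' : NTrm 𝒩 T.sig A B} : cls t = cls t' ↔ T.Eqv A B t t' := Quotient.eq

theorem cls_ax {A B} {t t' : NTrm 𝒩 T.sig A B} (h : NMTAx 𝒩 T.sig A B t t') : cls t = cls t' :=
  Quotient.sound (NTh.ax (Or.inr h))

/-- Sequential composition of classes. -/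
def comp {A B C : Finset 𝒩} (f : T.Arr A B) (g : T.Arr B C) : T.Arr A C :=
  Quotient.map₂ NTrm.seq (fun _ _ h _ _ h' => NTh.seq h h') f g

/-- Parallel composition of classes. -/
def tensor {A B A' B' C D : Finset 𝒩} (f : T.Arr A B) (g : T.Arr A' B') (hC : IsDisjUnion A A' C)
    (hD : IsDisjUnion B B' D) : T.Arr C D :=
  Quotient.map₂ (fun t t' => NTrm.par t t' hC hD) (fun _ _ h _ _ h' => NTh.par hC hD h h') f g

theorem exists_cls {A B} (f : T.Arr A B) : ∃ t, cls t = f := Quotient.exists_rep f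

theorem enumerates_toList (A : Finset 𝒩) : Enumerates A.toList A :=
  ⟨A.nodup_toList, fun _ => Finset.mem_toList.symm⟩

theorem id_comp {A B} (f : T.Arr A B) (l : List 𝒩) (h : Enumerates l A) :
    comp (cls (idn l h)) f = f := by
  obtain ⟨t, rfl⟩ := exists_cls f; exact cls_ax (.id_seq t l h)

theorem comp_id {A B} (f : T.Arr A B) (l : List 𝒩) (h : Enumerates l B) :
    comp f (cls (idn l h)) = f := by
  obtain ⟨t, rfl⟩ := exists_cls f; exact cls_ax (.seq_id t l h)

theorem assoc {A B C D} (f : T.Arr A B) (g : T.Arr B C) (h : T.Arr C D) :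
    comp (comp f g) h = comp f (comp g h) := by
  obtain ⟨t, rfl⟩ := exists_cls f
  obtain ⟨t', rfl⟩ := exists_cls g
  obtain ⟨t'', rfl⟩ := exists_cls h
  exact cls_ax (.seq_assoc t t' t'')

theorem tensor_comm {A B A' B' C D} (f : T.Arr A B) (g : T.Arr A' B') (hC : IsDisjUnion A A' C)
    (hD : IsDisjUnion B B' D) (hC' : IsDisjUnion A' A C) (hD' : IsDisjUnion B' B D) :
    tensor f g hC hD = tensor g f hC' hD' := by
  obtain ⟨t, rfl⟩ := exists_cls f
  obtain ⟨t', rfl⟩ := exists_cls g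
  exact cls_ax (.par_comm t t' hC hD hC' hD')

theorem tensor_assoc {A₁ B₁ A₂ B₂ A₃ B₃ I J I' J' C D}
    (f : T.Arr A₁ B₁) (g : T.Arr A₂ B₂) (h : T.Arr A₃ B₃)
    (h₁ : IsDisjUnion A₁ A₂ I) (h₂ : IsDisjUnion B₁ B₂ J) (h₃ : IsDisjUnion I A₃ C)
    (h₄ : IsDisjUnion J B₃ D) (h₅ : IsDisjUnion A₂ A₃ I') (h₆ : IsDisjUnion B₂ B₃ J')
    (h₇ : IsDisjUnion A₁ I' C) (h₈ : IsDisjUnion B₁ J' D) :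
    tensor (tensor f g h₁ h₂) h h₃ h₄ = tensor f (tensor g h h₅ h₆) h₇ h₈ := by
  obtain ⟨t, rfl⟩ := exists_cls f
  obtain ⟨t', rfl⟩ := exists_cls g
  obtain ⟨t'', rfl⟩ := exists_cls h
  exact cls_ax (.par_assoc t t' t'' _ _ _ _ _ _ _ _)

theorem unit_tensor {A B} (f : T.Arr A B) (hA : IsDisjUnion ∅ A A) (hB : IsDisjUnion ∅ B B) :
    tensor (cls .empty) f hA hB = f := by
  obtain ⟨t, rfl⟩ := exists_cls f; exact cls_ax (.empty_par t hA hB)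

theorem interchange {A B C A' B' C' I J K} (f : T.Arr A B) (g : T.Arr B C) (f' : T.Arr A' B')
    (g' : T.Arr B' C') (hI : IsDisjUnion A A' I) (hJ : IsDisjUnion B B' J)
    (hK : IsDisjUnion C C' K) :
    tensor (comp f g) (comp f' g') hI hK = comp (tensor f f' hI hJ) (tensor g g' hJ hK) := by
  obtain ⟨t, rfl⟩ := exists_cls f
  obtain ⟨t', rfl⟩ := exists_cls g
  obtain ⟨u, rfl⟩ := exists_cls f'
  obtain ⟨u', rfl⟩ := exists_cls g'
  exact cls_ax (.interchange t t' u u' hI hJ hK)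

theorem idn_eq (l l' : List 𝒩) {A : Finset 𝒩} (h : Enumerates l A) (h' : Enumerates l' A) :
    cls (T := T) (idn l h) = cls (idn l' h') := by
  rw [← comp_id (cls (idn l h)) l' h', id_comp]

/-- The class of `deltas`. -/
def cd (T : NMT.{w, s} 𝒩) (l : List (𝒩 × 𝒩)) {A B : Finset 𝒩} (hA : Enumerates (l.map Prod.fst) A)
    (hB : Enumerates (l.map Prod.snd) B) : T.Arr A B := cls (deltas l hA hB)

theorem cd_nil (hA : Enumerates [] (∅ : Finset 𝒩)) (hB : Enumerates [] (∅ : Finset 𝒩)) :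
    T.cd [] hA hB = cls .empty := rfl

theorem cd_cons (p : 𝒩 × 𝒩) (l : List (𝒩 × 𝒩)) {A B A' B' : Finset 𝒩}
    (hA : Enumerates ((p :: l).map Prod.fst) A) (hB : Enumerates ((p :: l).map Prod.snd) B)
    (hA' : Enumerates (l.map Prod.fst) A') (hB' : Enumerates (l.map Prod.snd) B') :
    T.cd (p :: l) hA hB = tensor (cls (delta p.1 p.2)) (T.cd l hA' hB')
      (Enumerates.isDisjUnion hA hA') (Enumerates.isDisjUnion hB hB') := by
  obtain rfl : (Enumerates.tailSet hA) = A' := by ext x; rw [hA'.mem_iff]; rfl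
  obtain rfl : (Enumerates.tailSet hB) = B' := by ext x; rw [hB'.mem_iff]; rfl
  rfl

theorem tensor_left_comm {A₁ B₁ A₂ B₂ A₃ B₃ I J I' J' C D}
    (f : T.Arr A₁ B₁) (g : T.Arr A₂ B₂) (h : T.Arr A₃ B₃)
    (h₁ : IsDisjUnion A₂ A₃ I) (h₂ : IsDisjUnion B₂ B₃ J) (h₃ : IsDisjUnion A₁ I C)
    (h₄ : IsDisjUnion B₁ J D) (h₅ : IsDisjUnion A₁ A₃ I') (h₆ : IsDisjUnion B₁ B₃ J')
    (h₇ : IsDisjUnion A₂ I' C) (h₈ : IsDisjUnion B₂ J' D) :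
    tensor f (tensor g h h₁ h₂) h₃ h₄ = tensor g (tensor f h h₅ h₆) h₇ h₈ := by
  obtain ⟨X, hX, hX'⟩ := h₁.exists_assoc h₃
  obtain ⟨Y, hY, hY'⟩ := h₂.exists_assoc h₄
  rw [← tensor_assoc f g h hX hY hX' hY', tensor_comm f g hX hY hX.symm hY.symm, tensor_assoc]

theorem _root_.Enumerates.perm {l l' : List 𝒩} {A : Finset 𝒩} (h : Enumerates l A)
    (hl : l.Perm l') : Enumerates l' A :=
  ⟨hl.nodup_iff.1 h.nodup, fun x => (h.mem_iff x).trans hl.mem_iff⟩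

theorem _root_.Enumerates.exists_tail {x : 𝒩} {l : List 𝒩} {A : Finset 𝒩}
    (h : Enumerates (x :: l) A) : ∃ B, Enumerates l B := ⟨_, h.tail⟩

theorem cd_perm {l l' : List (𝒩 × 𝒩)} (hl : l.Perm l') {A B : Finset 𝒩}
    (hA : Enumerates (l.map Prod.fst) A) (hB : Enumerates (l.map Prod.snd) B)
    (hA' : Enumerates (l'.map Prod.fst) A) (hB' : Enumerates (l'.map Prod.snd) B) :
    T.cd l hA hB = T.cd l' hA' hB' := by
  induction hl generalizing A B with
  | nil => rfl
  | cons p hl ih =>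
    obtain ⟨A', h1⟩ := hA.exists_tail
    obtain ⟨B', h2⟩ := hB.exists_tail
    rw [cd_cons p _ hA hB h1 h2, cd_cons p _ hA' hB' (h1.perm (hl.map _)) (h2.perm (hl.map _)),
      ih h1 h2]
  | swap p q l =>
    obtain ⟨A₁, h1⟩ := hA.exists_tail
    obtain ⟨B₁, h2⟩ := hB.exists_tail
    obtain ⟨A₂, h3⟩ := h1.exists_tail
    obtain ⟨B₂, h4⟩ := h2.exists_tail
    obtain ⟨A₃, h5⟩ := hA'.exists_tail
    obtain ⟨B₃, h6⟩ := hB'.exists_tail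
    rw [cd_cons q _ hA hB h1 h2, cd_cons p _ h1 h2 h3 h4,
      cd_cons p _ hA' hB' h5 h6, cd_cons q _ h5 h6 h3 h4]
    exact tensor_left_comm _ _ _ _ _ _ _ _ _ _ _
  | trans hl₁ hl₂ ih₁ ih₂ =>
    exact (ih₁ hA hB (hA.perm (hl₁.map _)) (hB.perm (hl₁.map _))).trans (ih₂ _ _ hA' hB')

theorem cd_append (l l' : List (𝒩 × 𝒩)) {A B A' B' C D : Finset 𝒩}
    (hA : Enumerates (l.map Prod.fst) A) (hB : Enumerates (l.map Prod.snd) B)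
    (hA' : Enumerates (l'.map Prod.fst) A') (hB' : Enumerates (l'.map Prod.snd) B')
    (hAA : Enumerates ((l ++ l').map Prod.fst) C) (hBB : Enumerates ((l ++ l').map Prod.snd) D)
    (hC : IsDisjUnion A A' C) (hD : IsDisjUnion B B' D) :
    T.cd (l ++ l') hAA hBB = tensor (T.cd l hA hB) (T.cd l' hA' hB') hC hD := by
  induction l generalizing A B C D with
  | nil =>
    obtain rfl := hA.eq_empty
    obtain rfl := hB.eq_empty
    obtain rfl := hC.unique (IsDisjUnion.empty_left _)
    obtain rfl := hD.unique (IsDisjUnion.empty_left _)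
    exact (unit_tensor _ _ _).symm
  | cons p l ih =>
    obtain ⟨A₁, h1⟩ := hA.exists_tail
    obtain ⟨B₁, h2⟩ := hB.exists_tail
    obtain ⟨C₁, h3⟩ := hAA.exists_tail
    obtain ⟨D₁, h4⟩ := hBB.exists_tail
    have key : ∀ {A₁ A' C₁ : Finset 𝒩} {l l' : List 𝒩}, Enumerates l A₁ →
        Enumerates l' A' → Enumerates (l ++ l') C₁ → IsDisjUnion A₁ A' C₁ := by
      intro A₁ A' C₁ l l' h h' h''
      refine ⟨Finset.disjoint_left.2 fun x hx hx' => ?_, fun x => ?_⟩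
      · exact List.disjoint_of_nodup_append h''.nodup ((h.mem_iff x).1 hx) ((h'.mem_iff x).1 hx')
      · rw [h''.mem_iff, h.mem_iff, h'.mem_iff, List.mem_append]
    have e1 : IsDisjUnion A₁ A' C₁ := key h1 hA' (by simpa using h3)
    have e2 : IsDisjUnion B₁ B' D₁ := key h2 hB' (by simpa using h4)
    change T.cd (p :: (l ++ l')) _ _ = _
    rw [cd_cons p (l ++ l') hAA hBB h3 h4, cd_cons p l hA hB h1 h2, ih h1 h2 h3 h4 e1 e2,
      tensor_assoc]

theorem cd_diag (l : List 𝒩) {A : Finset 𝒩} (h : Enumerates l A)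
    (h₁ : Enumerates ((l.map fun x => (x, x)).map Prod.fst) A)
    (h₂ : Enumerates ((l.map fun x => (x, x)).map Prod.snd) A) :
    T.cd (l.map fun x => (x, x)) h₁ h₂ = cls (idn l h) := by
  induction l generalizing A with
  | nil => rfl
  | cons x l ih =>
    obtain ⟨A', h3⟩ := h₁.exists_tail
    have h3' : Enumerates ((l.map fun x => (x, x)).map Prod.fst) A' := h3
    have h4 : Enumerates ((l.map fun x => (x, x)).map Prod.snd) A' := by
      simpa [Function.comp_def] using h3'
    have h5 : Enumerates l A' := by simpa [Function.comp_def] using h3'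
    obtain rfl : h.tailSet = A' := by ext x; rw [h5.mem_iff]; rfl
    change T.cd ((x, x) :: _) h₁ h₂ = _
    rw [cd_cons (x, x) _ h₁ h₂ h3 h4, ih h5]
    exact congrArg₂ (fun f g => tensor f g _ _) (cls_ax (.delta_self x)) rfl

theorem cd_comp {ι : Type*} (l : List ι) (a b c : ι → 𝒩) {A B C : Finset 𝒩}
    (hA : Enumerates ((l.map fun i => (a i, b i)).map Prod.fst) A)
    (hB : Enumerates ((l.map fun i => (a i, b i)).map Prod.snd) B)
    (hB' : Enumerates ((l.map fun i => (b i, c i)).map Prod.fst) B)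
    (hC : Enumerates ((l.map fun i => (b i, c i)).map Prod.snd) C)
    (hA' : Enumerates ((l.map fun i => (a i, c i)).map Prod.fst) A)
    (hC' : Enumerates ((l.map fun i => (a i, c i)).map Prod.snd) C) :
    comp (T.cd _ hA hB) (T.cd _ hB' hC) = T.cd _ hA' hC' := by
  induction l generalizing A B C with
  | nil =>
    obtain rfl := hA.eq_empty
    obtain rfl := hB.eq_empty
    obtain rfl := hC.eq_empty
    exact id_comp (cls .empty) [] hA
  | cons i l ih =>
    obtain ⟨A₁, h1⟩ := hA.exists_tail
    obtain ⟨B₁, h2⟩ := hB.exists_tail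
    obtain ⟨B₂, h3⟩ := hB'.exists_tail
    obtain ⟨C₁, h4⟩ := hC.exists_tail
    obtain rfl : B₁ = B₂ := by ext x; rw [h2.mem_iff, h3.mem_iff]; simp
    have h5 : Enumerates ((l.map fun i => (a i, c i)).map Prod.fst) A₁ := by
      simpa [Function.comp_def] using h1
    have h6 : Enumerates ((l.map fun i => (a i, c i)).map Prod.snd) C₁ := by
      simpa [Function.comp_def] using h4
    have e1 := cd_cons (T := T) (a i, b i) (l.map fun i => (a i, b i)) hA hB h1 h2
    have e2 := cd_cons (T := T) (b i, c i) (l.map fun i => (b i, c i)) hB' hC h3 h4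
    have e3 := cd_cons (T := T) (a i, c i) (l.map fun i => (a i, c i)) hA' hC' h5 h6
    refine (congrArg₂ comp e1 e2).trans (Eq.trans ?_ e3.symm)
    rw [← interchange, ih h1 h2 h3 h4 h5 h6]
    exact congrArg₂ (fun f g => tensor f g _ _) (cls_ax (.delta_delta _ _ _)) rfl

/-- The graph of a bijection, as a list of pairs. -/
noncomputable def graph {A B : Finset 𝒩} (e : A ≃ B) : List (𝒩 × 𝒩) :=
  A.attach.toList.map fun x : A => ((x : 𝒩), (e x : 𝒩))

theorem graph_fst {A B : Finset 𝒩} (e : A ≃ B) : Enumerates ((graph e).map Prod.fst) A := by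
  constructor
  · rw [graph, List.map_map]
    exact A.attach.nodup_toList.map Subtype.val_injective
  · intro x; simp [graph]

theorem graph_snd {A B : Finset 𝒩} (e : A ≃ B) : Enumerates ((graph e).map Prod.snd) B := by
  constructor
  · rw [graph, List.map_map]
    exact A.attach.nodup_toList.map (Subtype.val_injective.comp e.injective)
  · intro x
    simp only [graph, List.map_map, List.mem_map, Finset.mem_toList, Finset.mem_attach, true_and,
      Function.comp]
    exact ⟨fun hx => ⟨e.symm ⟨x, hx⟩, by simp⟩, by rintro ⟨y, rfl⟩; exact (e y).2⟩

theorem graph_nodup {A B : Finset 𝒩} (e : A ≃ B) : (graph e).Nodup :=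
  List.Nodup.of_map _ (graph_fst e).nodup

theorem mem_graph {A B : Finset 𝒩} (e : A ≃ B) (p : 𝒩 × 𝒩) :
    p ∈ graph e ↔ ∃ x : A, p = ((x : 𝒩), (e x : 𝒩)) := by
  simp [graph, eq_comm]

/-- The arrow given by a bijection `e`: the parallel composition of the renamings `δ_{a (e a)}`. -/
noncomputable def ren {A B : Finset 𝒩} (e : A ≃ B) : T.Arr A B :=
  cls (deltas (graph e) (graph_fst e) (graph_snd e))

theorem ren_eq {A B : Finset 𝒩} (e : A ≃ B) (l : List (𝒩 × 𝒩)) (hl : l.Nodup)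
    (h : ∀ p, p ∈ l ↔ ∃ x : A, p = ((x : 𝒩), (e x : 𝒩))) (hA : Enumerates (l.map Prod.fst) A)
    (hB : Enumerates (l.map Prod.snd) B) : ren e = T.cd l hA hB :=
  cd_perm ((List.perm_ext_iff_of_nodup (graph_nodup e) hl).2 fun p =>
    (mem_graph e p).trans (h p).symm) _ _ _ _

/-- The nominal PROP `nTrm(Σ)/Th(E ∪ NMT)` presented by a nominal monoidal theory. -/
noncomputable def toNPROP (T : NMT.{w, s} 𝒩) : NPROP.{max s w} 𝒩 where
  Hom := T.Arr
  id A := cls (idn A.toList (enumerates_toList A))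
  comp := comp
  tensor := tensor
  ren := ren
  id_comp f := id_comp f _ _
  comp_id f := comp_id f _ _
  assoc := assoc
  ren_refl A := by
    have h := enumerates_toList A
    have h₁ : Enumerates ((A.toList.map fun x => (x, x)).map Prod.fst) A := by
      simpa [Function.comp_def] using h
    have h₂ : Enumerates ((A.toList.map fun x => (x, x)).map Prod.snd) A := by
      simpa [Function.comp_def] using h
    rw [ren_eq (Equiv.refl A) (A.toList.map fun x => (x, x)) (List.Nodup.of_map _ h₁.nodup)
      (by
        rintro ⟨p, q⟩
        simp only [List.mem_map, Finset.mem_toList, Prod.mk.injEq, Equiv.refl_apply]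
        exact ⟨by rintro ⟨x, hx, rfl, rfl⟩; exact ⟨⟨x, hx⟩, rfl, rfl⟩,
          by rintro ⟨x, rfl, rfl⟩; exact ⟨x, x.2, rfl, rfl⟩⟩) h₁ h₂]
    exact cd_diag _ h h₁ h₂
  ren_trans {A B C} e e' := by
    have h := graph_fst e
    have h' := graph_snd e
    have h'' := graph_snd (e.trans e')
    have hB : Enumerates ((A.attach.toList.map fun x : A => ((e x : 𝒩), (e' (e x) : 𝒩))).map Prod.fst)
        B := by simpa [graph, Function.comp_def] using h'
    have hC : Enumerates ((A.attach.toList.map fun x : A => ((e x : 𝒩), (e' (e x) : 𝒩))).map Prod.snd)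
        C := by simpa [graph, Function.comp_def] using h''
    rw [ren_eq (T := T) e' _ (List.Nodup.of_map _ hB.nodup) ?_ hB hC]
    · exact (cd_comp A.attach.toList (fun x : A => (x : 𝒩)) (fun x : A => (e x : 𝒩))
        (fun x : A => (e' (e x) : 𝒩)) h h' hB hC _ h'').symm
    · intro p
      simp only [List.mem_map, Finset.mem_toList, Finset.mem_attach, true_and]
      exact ⟨by rintro ⟨x, rfl⟩; exact ⟨e x, rfl⟩,
        by rintro ⟨y, rfl⟩; exact ⟨e.symm y, by simp⟩⟩
  ren_tensor {A B A' B' C D} e e' hC hD := by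
    have h1 : ∀ x : A, (((hC.congr hD e e') ⟨x, (hC.mem_iff x).2 (Or.inl x.2)⟩ : D) : 𝒩) = e x := by
      intro x
      have : hC.sumEquiv.symm ⟨x, (hC.mem_iff x).2 (Or.inl x.2)⟩ = Sum.inl x := by
        rw [Equiv.symm_apply_eq]; rfl
      simp only [IsDisjUnion.congr, Equiv.trans_apply, this]
      rfl
    have h2 : ∀ x : A', (((hC.congr hD e e') ⟨x, (hC.mem_iff x).2 (Or.inr x.2)⟩ : D) : 𝒩) =
        e' x := by
      intro x
      have : hC.sumEquiv.symm ⟨x, (hC.mem_iff x).2 (Or.inr x.2)⟩ = Sum.inr x := by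
        rw [Equiv.symm_apply_eq]; rfl
      simp only [IsDisjUnion.congr, Equiv.trans_apply, this]
      rfl
    have key : ∀ {A A' C : Finset 𝒩} {l l' : List 𝒩}, Enumerates l A → Enumerates l' A' →
        IsDisjUnion A A' C → Enumerates (l ++ l') C := by
      intro A A' C l l' h h' hC
      refine ⟨List.nodup_append'.2 ⟨h.nodup, h'.nodup, fun x hx hx' => ?_⟩, fun x => ?_⟩
      · exact Finset.disjoint_left.1 hC.disjoint ((h.mem_iff x).2 hx) ((h'.mem_iff x).2 hx')
      · rw [hC.mem_iff, h.mem_iff, h'.mem_iff, List.mem_append]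
    have h3 : Enumerates ((graph e ++ graph e').map Prod.fst) C := by
      rw [List.map_append]; exact key (graph_fst e) (graph_fst e') hC
    have h4 : Enumerates ((graph e ++ graph e').map Prod.snd) D := by
      rw [List.map_append]; exact key (graph_snd e) (graph_snd e') hD
    rw [ren_eq (T := T) (hC.congr hD e e') (graph e ++ graph e')
      (List.Nodup.of_map _ h3.nodup) ?_ h3 h4]
    · exact cd_append _ _ (graph_fst e) (graph_snd e) (graph_fst e') (graph_snd e') h3 h4 hC hD
    · intro p
      rw [List.mem_append, mem_graph, mem_graph]
      constructor
      · rintro (⟨x, rfl⟩ | ⟨x, rfl⟩)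
        · exact ⟨_, by rw [h1 x]⟩
        · exact ⟨_, by rw [h2 x]⟩
      · rintro ⟨⟨x, hx⟩, rfl⟩
        rcases (hC.mem_iff x).1 hx with h | h
        · exact Or.inl ⟨⟨x, h⟩, by rw [← h1 ⟨x, h⟩]⟩
        · exact Or.inr ⟨⟨x, h⟩, by rw [← h2 ⟨x, h⟩]⟩
  tensor_comm := tensor_comm
  tensor_assoc := tensor_assoc
  unit_tensor f hA hB := by
    rw [idn_eq (T := T) (∅ : Finset 𝒩).toList [] (enumerates_toList ∅) ⟨by simp, by simp⟩]
    exact unit_tensor f hA hB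
  interchange := interchange

end NMT

/-! ## The PROP of a nominal PROP -/

/-- The symbols `⟨a] f [b⟩ : n → m`, for an arrow `f : A → B` of a nominal PROP and lists `a`, `b`
of length `n`, `m` that enumerate `A`, `B`. -/
structure Dia {𝒩 : Type w} (T : NPROP.{u} 𝒩) where
  {A : Finset 𝒩}
  {B : Finset 𝒩}
  {n : ℕ}
  {m : ℕ}
  a : Fin n ≃ A
  f : T.Hom A B
  b : Fin m ≃ B

namespace NPROP

variable {𝒩 : Type w} (T : NPROP.{u} 𝒩)

/-- The signature consisting of the symbols `⟨a] f [b⟩`. -/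
def ordSig : Signature.{max u w} where
  Gen := Dia T
  ar d := d.n
  coar d := d.m

variable {T}

/-- The symbol `⟨a] f [b⟩`, as a term. -/
def dia {A B : Finset 𝒩} {n m : ℕ} (a : Fin n ≃ A) (f : T.Hom A B) (b : Fin m ≃ B) :
    Trm T.ordSig n m :=
  Trm.gen (S := T.ordSig) (Dia.mk a f b)

variable (T)

open Trm in
/-- The equations between the symbols `⟨a] f [b⟩`. For two lists `a`, `a'` that enumerate the same
set, `⟨a|a'⟩` is the bijection `i ↦ j` whenever `a i = a' j`, that is, `a.trans a'.symm`. For two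
lists `a`, `b` of the same length, `[a|b]` is the renaming `a i ↦ b i`, that is,
`a.symm.trans b`. -/
inductive OrdEq : ∀ n m : ℕ, Trm T.ordSig n m → Trm T.ordSig n m → Prop
  -- `⟨a] f ; g [c⟩ = ⟨a] f [b⟩ ; ⟨b] g [c⟩`
  | comp {A B C : Finset 𝒩} {n m k : ℕ} (f : T.Hom A B) (g : T.Hom B C) (a : Fin n ≃ A)
      (b : Fin m ≃ B) (c : Fin k ≃ C) :
      OrdEq n k (dia a (T.comp f g) c) (seq (dia a f b) (dia b g c))
  -- `⟨a ++ a'] f ⊎ g [b ++ b'⟩ = ⟨a] f [b⟩ ⊕ ⟨a'] g [b'⟩`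
  | tensor {A B A' B' C D : Finset 𝒩} {n m n' m' : ℕ} (f : T.Hom A B) (g : T.Hom A' B')
      (hC : IsDisjUnion A A' C) (hD : IsDisjUnion B B' D) (a : Fin n ≃ A) (b : Fin m ≃ B)
      (a' : Fin n' ≃ A') (b' : Fin m' ≃ B') :
      OrdEq (n + n') (m + m') (dia (hC.append a a') (T.tensor f g hC hD) (hD.append b b'))
        (par (dia a f b) (dia a' g b') rfl rfl)
  -- `⟨a] id [a⟩ = id`
  | id {A : Finset 𝒩} {n : ℕ} (a : Fin n ≃ A) : OrdEq n n (dia a (T.id A) a) (idn n)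
  -- `⟨a] [a'|b] ; f [c⟩ = ⟨a|a'⟩ ; ⟨b] f [c⟩`
  | ren_left {A B C : Finset 𝒩} {n n' m : ℕ} (f : T.Hom B C) (a : Fin n ≃ A) (a' : Fin n' ≃ A)
      (b : Fin n' ≃ B) (c : Fin m ≃ C) :
      OrdEq n m (dia a (T.comp (T.ren (a'.symm.trans b)) f) c)
        (seq (bij (a.trans a'.symm)) (dia b f c))
  -- `⟨a] f ; [b|c] [c'⟩ = ⟨a] f [b⟩ ; ⟨c|c'⟩`
  | ren_right {A B C : Finset 𝒩} {n m m' : ℕ} (f : T.Hom A B) (a : Fin n ≃ A) (b : Fin m ≃ B)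
      (c : Fin m ≃ C) (c' : Fin m' ≃ C) :
      OrdEq n m' (dia a (T.comp f (T.ren (b.symm.trans c))) c')
        (seq (dia a f b) (bij (c.trans c'.symm)))
  -- `⟨a] f [b⟩ = ⟨π · a] π · f [π · b⟩`
  | perm {A B A' B' : Finset 𝒩} {n m : ℕ} (π : FinPerm 𝒩) (hA : π.act A = A') (hB : π.act B = B')
      (f : T.Hom A B) (a : Fin n ≃ A) (b : Fin m ≃ B) :
      OrdEq n m (dia a f b)
        (dia (a.trans (π.onSet hA)) (T.act π hA hB f) (b.trans (π.onSet hB)))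

/-- The PROP `ORD(T)`, generated by arrows `⟨a] f [b⟩ : n → m` for all arrows `f : A → B` of `T` and
all lists `a`, `b` enumerating `A`, `B`, subject to the equations `OrdEq`. -/
def ORD : PROP.{max u w} :=
  SMT.toPROP ⟨T.ordSig, T.OrdEq⟩

end NPROP

/-! ## The translation of nominal monoidal theories into symmetric monoidal theories -/

/-- The normal form `nfSmt(⟨a] t [b⟩)` of the embedding of a nominal term into ordinary string
diagrams. It depends on a choice `ch` of an enumeration of each finite set of names, which provides
the lists of names for the interfaces of subterms. -/
noncomputable def NTrm.nfSmt {𝒩 : Type w} {S : Signature.{s}} (ch : ∀ A : Finset 𝒩, Fin A.card ≃ A) :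
    ∀ {A B : Finset 𝒩}, NTrm 𝒩 S A B → ∀ {n m : ℕ}, (Fin n ≃ A) → (Fin m ≃ B) → Trm S n m
  | _, _, .gen γ a' b', _, _, a, b =>
      .seq (.bij (a.trans a'.symm)) (.seq (.gen γ) (.bij (b'.trans b.symm)))
  | _, _, .empty, _, _, a, b =>
      Trm.empty.cast (by simpa using (Fintype.card_congr a).symm)
        (by simpa using (Fintype.card_congr b).symm)
  | _, _, .id _, _, _, a, b =>
      Trm.id.cast (by simpa using (Fintype.card_congr a).symm)
        (by simpa using (Fintype.card_congr b).symm)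
  | _, _, .delta _ _, _, _, a, b =>
      Trm.id.cast (by simpa using (Fintype.card_congr a).symm)
        (by simpa using (Fintype.card_congr b).symm)
  | _, _, .par (A := A) (B := B) (A' := A') (B' := B') f g hC hD, _, _, a, b =>
      .seq (.bij (a.trans (hC.append (ch A) (ch A')).symm))
        (.seq (.par (nfSmt ch f (ch A) (ch B)) (nfSmt ch g (ch A') (ch B')) rfl rfl)
          (.bij ((hD.append (ch B) (ch B')).trans b.symm)))
  | _, _, .seq (B := B) f g, _, _, a, c => .seq (nfSmt ch f a (ch B)) (nfSmt ch g (ch B) c)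
  | _, _, .perm π f hA hB, _, _, a, b =>
      nfSmt ch f (a.trans (π.onSet hA).symm) (b.trans (π.onSet hB).symm)

/-- The equations `nfSmt(dia(E))`: all `nfSmt(⟨a] t [b⟩) = nfSmt(⟨a] t' [b⟩)` with `t = t'` in `E` and
lists `a`, `b` enumerating the domain and the codomain. -/
inductive NMT.SmtEq {𝒩 : Type w} (T : NMT.{w, s} 𝒩) (ch : ∀ A : Finset 𝒩, Fin A.card ≃ A) :
    ∀ n m : ℕ, Trm T.sig n m → Trm T.sig n m → Prop
  | mk {A B : Finset 𝒩} {n m : ℕ} {t t' : NTrm 𝒩 T.sig A B} (h : T.eqs A B t t') (a : Fin n ≃ A)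
      (b : Fin m ≃ B) : SmtEq T ch n m (t.nfSmt ch a b) (t'.nfSmt ch a b)

/-- The translated symmetric monoidal theory `Smt⟨Σ, E⟩ = ⟨Σ, nfSmt(dia(E))⟩`. -/
def NMT.toSMT {𝒩 : Type w} (T : NMT.{w, s} 𝒩) (ch : ∀ A : Finset 𝒩, Fin A.card ≃ A) : SMT.{s} :=
  ⟨T.sig, T.SmtEq ch⟩

/-! ## Completeness -/

/-- A symmetric monoidal theory is complete for a PROP if it presents the PROP up to isomorphism. -/
def SMT.IsCompleteFor (T : SMT.{s}) (C : PROP.{u}) : Prop :=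
  Nonempty (PROP.Iso T.toPROP C)

/-- A nominal monoidal theory is complete for a nominal PROP if it presents the nominal PROP up to
isomorphism. -/
def NMT.IsCompleteFor {𝒩 : Type w} (T : NMT.{w, s} 𝒩) (nC : NPROP.{u} 𝒩) : Prop :=
  Nonempty (NPROP.Iso T.toNPROP nC)

/-! Both PROPs are given by generators and equations. So it suffices to interpret the generators of
each in the other, to check the equations, and to see that the two interpretations are mutually
inverse on generators (`isoOfEval`). The symbol `⟨a] t [b⟩` goes to the class of its normal form; a
generator `γ` goes to `⟨a] [a⟩γ⟨b] [b⟩` for some enumerations `a`, `b`.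

The combinatorial base is coherence: in a presented PROP, the wiring terms of bijections respect
composition, sums and block transpositions (`cls_bij_trans`, `cls_bij_finSum`, `cls_bij_rot`). It
follows that changing the outer enumerations of a normal form only adds permutations at its two ends
(`nf_change`). Hence the choices made inside a normal form are immaterial (`nf_seq`, `nf_par`), and
every law of nominal theories holds for normal forms (`nf_ax`): commutativity of `⊎` is naturality
and involutivity of the symmetry, and the laws of `δ` hold because both sides wire the same
bijection. So the normal form is defined on arrows of the presented nominal PROP and satisfies the
relations of `ORD`.

Conversely, `⟨a] [a⟩γ⟨b] [b⟩` does not depend on `a`, `b` (`D_gen`), since generators absorb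
renamings (`ren_comp_gen`, `gen_comp_ren`). The axioms absorb only the change of one name, and
infinitely many names are needed to build every renaming from such changes (`enum_connected`). The
same absorption identifies formal permutations with conjugation by bijections (`cls_perm`). By
induction on `t`, the normal form read back in `ORD` is then `⟨a] t [b⟩` (`eval_smtGen_nfSmt`). This
yields the equations of the translated theory and one inverse law; the other one is `nf_gen_self`.

For the consequence, the relations of `ORD` only involve structure that isomorphisms of nominal
PROPs preserve, so `ORD` respects isomorphism (`Iso.ord`). -/

namespace SMT

open Trm

variable {T : SMT.{s}}

/-! ### Adjacent crossings and the move of a single wire -/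

theorem sOne_one {k : ℕ} (hk : 1 + 1 = k) : T.sOne 1 hk hk = hk ▸ cls .sym := by
  subst hk
  rw [sOne_succ (T := T) 0 (i := 1) (j := 1) (i' := 2) rfl rfl rfl rfl rfl rfl rfl rfl,
    sOne_zero, tensor_id, id_comp]
  exact cls_ax (.empty_par _)

theorem sT_one (n : ℕ) {k l : ℕ} (hk : 1 + n = k) (hl : n + 1 = l) :
    T.sT 1 n hk hl = T.sOne n hk hl := by
  subst hl
  obtain rfl : n + 1 = k := by omega
  rw [sT_succ (T := T) 0 n (i := n + 1) (j := n + 1) (x := n + 1) (y := n) (z := n)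
    (by omega) (by omega) (by omega) (by omega) (by omega) (by omega) (by omega) (by omega)
    (by omega) (by omega), sT_zero, tensor_id, comp_id]
  exact unit_tensor _

theorem sT_one_one {k : ℕ} (hk : 1 + 1 = k) : T.sT 1 1 hk hk = hk ▸ cls .sym := by
  rw [sT_one, sOne_one]

theorem sT_natural {m n o p k l i j : ℕ} (f : T.Arr m n) (g : T.Arr o p) (hk : m + o = k)
    (hl : n + p = l) (hi : p + n = i) (hj : o + m = j) :
    comp (tensor f g hk hl) (T.sT n p hl hi) = comp (T.sT m o hk hj) (tensor g f hj hi) := by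
  subst hk hl hi hj
  exact symm_natural f g

/-- The crossing of the wires `k` and `k + 1`, followed by `p` further wires. -/
def adj (T : SMT.{s}) (k p : ℕ) {n : ℕ} (h : k + 2 + p = n) : T.Arr n n :=
  tensor (tensor (cls (idn k)) (cls .sym) rfl rfl) (cls (idn p)) h h

theorem adj_eq (k p : ℕ) {n : ℕ} (h : k + 2 + p = n) {x : ℕ} (hx : 2 + p = x) (hx' : k + x = n) :
    T.adj k p h = tensor (cls (idn k)) (tensor (cls .sym) (cls (idn p)) hx hx) hx' hx' :=
  tensor_assoc _ _ _ _ _ _ _ _ _ _ _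

theorem adj_comp_adj (k p : ℕ) {n : ℕ} (h : k + 2 + p = n) :
    comp (T.adj k p h) (T.adj k p h) = cls (idn n) := by
  rw [adj, ← comp_tensor_id, ← id_tensor_comp, ← cls_seq, cls_ax .sym_sym, tensor_id, tensor_id]

theorem tensor_adj (m k p : ℕ) {n l k' : ℕ} (h : k + 2 + p = n) (hl : m + n = l) (hk : m + k = k')
    (h' : k' + 2 + p = l) :
    tensor (cls (idn m)) (T.adj k p h) hl hl = T.adj k' p h' := by
  rw [adj_eq k p h (x := 2 + p) rfl (by omega), adj_eq k' p h' (x := 2 + p) rfl (by omega)]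
  exact id_id_tensor _ _ _ _ _ _ _ _ hk _ _

theorem adj_tensor (m k p : ℕ) {n l p' : ℕ} (h : k + 2 + p = n) (hl : n + m = l) (hp : p + m = p')
    (h' : k + 2 + p' = l) :
    tensor (T.adj k p h) (cls (idn m)) hl hl = T.adj k p' h' :=
  tensor_id_id _ _ _ _ _ _ _ _ hp _ _

/-- The arrow that moves the first wire past the `p` next ones, with `q` further wires. -/
def mv (T : SMT.{s}) (p q : ℕ) {n : ℕ} (h : p + q + 1 = n) : T.Arr n n :=
  tensor (T.sT 1 p rfl (Nat.add_comm p 1)) (cls (idn q)) (by omega) (by omega)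

theorem cls_move {n : ℕ} (k : Fin (n + 1)) {q : ℕ} (hq : k.val + q = n) :
    cls (T := T) (move k) = T.mv k.val q (by omega) := by
  obtain ⟨k, hk⟩ := k
  obtain rfl : q = n - k := by simp only at hq; omega
  -- The codomain of `symT 1 k` in `move` agrees with the one in `mv` only up to a proof; `key`
  -- absorbs the transport.
  have key : ∀ {a b b' c d x y : ℕ} (t : T.Arr a b) (u : T.Arr c d) (hb : b = b')
      (h₁ : a + c = x) (h₂ : b + d = y) (h₃ : b' + d = y),
      tensor t u h₁ h₂ = tensor (hb ▸ t : T.Arr a b') u h₁ h₃ := by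
    intros; subst_vars; rfl
  exact key (cls (symT 1 k)) (cls (idn (n - k))) (Nat.add_comm k 1) (by omega) (by omega) (by omega)

theorem mv_zero (q : ℕ) {n : ℕ} (h : 0 + q + 1 = n) : T.mv 0 q h = cls (idn n) := by
  rw [mv, sT_right_zero, tensor_id]

/-- By `sT_add` for `σ_{1,p+1}`, passing `p + 1` wires is passing `p` of them and then crossing one
more. -/
theorem mv_comp_adj_self (p q : ℕ) {n : ℕ} (h : p + (q + 1) + 1 = n) (h' : p + 2 + q = n)
    (h'' : p + 1 + q + 1 = n) :
    comp (T.mv p (q + 1) h) (T.adj p q h') = T.mv (p + 1) q h'' := by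
  have e := sT_add (T := T) 1 p 1 (k := 1 + (p + 1)) (l := 1 + (p + 1)) (i := 1 + p) (j := 1 + p)
    (x := 1 + (p + 1)) (y := 2) (z := 2) (by omega) (by omega) (by omega) (by omega) (by omega)
    (by omega) (by omega) (by omega) (by omega) (by omega)
  rw [mv, mv, e, sT_one_one,
    comp_tensor_id (j := n) q _ _ _ (by omega) _,
    tensor_id_id 1 q (q + 1) _ _ _ _ _ (by omega) (by omega) (by omega)]
  congr 1
  rw [adj]
  have key : ∀ {a b : ℕ} (ha : p + 2 = a) (hb : p + 2 = b) (h₁ : a + q = n) (h₂ : b + q = n),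
    tensor (T := T) (tensor (cls (idn p)) (cls .sym) ha ha) (cls (idn q)) h₁ h₁ =
    tensor (tensor (cls (idn p)) (cls .sym) hb hb) (cls (idn q)) h₂ h₂ := by
    intros; subst_vars; rfl
  exact key _ _ _ _

theorem mv_succ_comp_adj (p q : ℕ) {n : ℕ} (h : p + (q + 1) + 1 = n) (h' : p + 2 + q = n)
    (h'' : p + 1 + q + 1 = n) :
    comp (T.mv (p + 1) q h'') (T.adj p q h') = T.mv p (q + 1) h := by
  rw [← mv_comp_adj_self p q h h' h'', assoc, adj_comp_adj, comp_id]

/-- The crossing only touches wires that the move leaves alone, so this is interchange. -/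
theorem mv_comp_adj_of_lt (p d r : ℕ) {n q : ℕ} (hq : d + 2 + r = q) (h : p + q + 1 = n)
    {k : ℕ} (hk : p + 1 + d = k) (h' : k + 2 + r = n) :
    comp (T.mv p q h) (T.adj k r h') = comp (T.adj k r h') (T.mv p q h) := by
  rw [← tensor_adj (T := T) (1 + p) d r hq (by omega) (by omega) h', mv]
  exact (tensor_comm (T.sT 1 p rfl (Nat.add_comm p 1)) (T.adj d r hq) _ _ _ _).symm

/-- The crossing touches wires that the moving wire passes, so it slides through the move by
naturality of the symmetry. Before the move these wires sit one place later, hence `k' = 1 + k`,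
with one wire fewer behind them. -/
theorem mv_comp_adj_of_gt (k d q : ℕ) {n p : ℕ} (hp : k + 2 + d = p) (h : p + q + 1 = n)
    {r : ℕ} (hr : d + 1 + q = r) (h' : k + 2 + r = n) {k' r' : ℕ} (hk' : 1 + k = k')
    (hr' : d + q = r') (h'' : k' + 2 + r' = n) :
    comp (T.mv p q h) (T.adj k r h') = comp (T.adj k' r' h'') (T.mv p q h) := by
  rw [← adj_tensor (T := T) q k (d + 1) (n := 1 + p) (by omega) (by omega) (by omega) h',
    ← adj_tensor (T := T) q k' d (n := 1 + p) (by omega) (by omega) (by omega) h'', mv,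
    ← comp_tensor_id, ← comp_tensor_id,
    ← adj_tensor (T := T) 1 k d hp (by omega) (by omega) (by omega),
    ← tensor_adj (T := T) 1 k d (k' := k') (l := 1 + p) hp rfl hk' (by omega), sT_natural]

end SMT

/-! ### The recursion that defines the wiring term of a bijection -/

namespace Trm

/-- The bijection between the wires other than the first one and those other than its image. -/
def bijTail {n m : ℕ} (e : Fin (n + 1) ≃ Fin (m + 1)) : Fin n ≃ Fin m :=
  Equiv.removeNone ((finSuccEquiv n).symm.trans (e.trans (finSuccEquiv' (e 0))))

theorem succAbove_bijTail {n m : ℕ} (e : Fin (n + 1) ≃ Fin (m + 1)) (i : Fin n) :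
    (e 0).succAbove (bijTail e i) = e i.succ := by
  have h := Equiv.removeNone_some
    ((finSuccEquiv n).symm.trans (e.trans (finSuccEquiv' (e 0)))) (x := i) (by
      have : e i.succ ≠ e 0 := fun h => Fin.succ_ne_zero i (e.injective h)
      obtain ⟨j, hj⟩ := Fin.exists_succAbove_eq this
      exact ⟨j, by simp [← hj, finSuccEquiv'_succAbove]⟩)
  have h' := congrArg (finSuccEquiv' (e 0)).symm h
  simpa [bijTail] using h'

theorem bijTail_eq {n m : ℕ} (e : Fin (n + 1) ≃ Fin (m + 1)) (e' : Fin n ≃ Fin m)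
    (h : ∀ i, e i.succ = (e 0).succAbove (e' i)) : bijTail e = e' := by
  ext i
  rw [(Fin.succAbove_right_injective (p := e 0)) ((succAbove_bijTail e i).trans (h i))]

end Trm

namespace SMT

open Trm

variable {T : SMT.{s}}

/-- The tail `e'` is characterised by its values only, so that applications never have to unfold
`Equiv.removeNone`. -/
theorem cls_bij_succ {n m : ℕ} (e : Fin (n + 1) ≃ Fin (m + 1)) (e' : Fin n ≃ Fin m)
    (h : ∀ i, e i.succ = (e 0).succAbove (e' i)) {q : ℕ} (hq : (e 0).val + q = m) :
    cls (T := T) (bij e) = comp (tensor (cls (idn 1)) (cls (bij e')) (Nat.add_comm 1 n)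
      (Nat.add_comm 1 m)) (T.mv (e 0).val q (by omega)) := by
  rw [← bijTail_eq e e' h, ← cls_move (e 0) hq, ← cls_id]
  rfl

theorem cls_bij_refl (n : ℕ) : cls (T := T) (bij (Equiv.refl (Fin n))) = cls (idn n) := by
  induction n with
  | zero => rfl
  | succ n ih =>
    rw [cls_bij_succ (Equiv.refl (Fin (n + 1))) (Equiv.refl (Fin n)) (by intro i; rfl)
      (q := n) (by simp), ih, tensor_id]
    exact (congrArg (comp _) (mv_zero n _)).trans (comp_id _)

end SMT

/-! ### Coherence: wiring terms compose like bijections -/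

namespace SMT

open Trm

variable {T : SMT.{s}}

theorem succAbove_val {n : ℕ} (p : Fin (n + 1)) (i : Fin n) :
    (p.succAbove i).val = if i.val < p.val then i.val else i.val + 1 := by
  rw [Fin.succAbove]
  split_ifs <;> simp_all [Fin.lt_def]

theorem swap_val {n : ℕ} (a b i : Fin n) :
    (Equiv.swap a b i).val =
      if i.val = a.val then b.val else if i.val = b.val then a.val else i.val := by
  simp only [Equiv.swap_apply_def, Fin.ext_iff]
  split_ifs <;> rfl

/-- Induction on the number of wires. The term of `e` routes the tail and then moves the first wire
to `p = e 0`. According to the position of `p` relative to `k` and `k + 1`, the crossing either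
passes the move and acts on the tail, or lengthens or shortens the move by one place. -/
theorem cls_bij_trans_swap {n : ℕ} (e : Fin n ≃ Fin n) (k r : ℕ) (h : k + 2 + r = n) :
    cls (T := T) (bij (e.trans (Equiv.swap ⟨k, by omega⟩ ⟨k + 1, by omega⟩))) =
      comp (cls (bij e)) (T.adj k r h) := by
  induction n generalizing k r with
  | zero => omega
  | succ n ih =>
    have hp := (e 0).isLt
    set p := (e 0).val with hpdef
    set σ : Equiv.Perm (Fin (n + 1)) := Equiv.swap ⟨k, by omega⟩ ⟨k + 1, by omega⟩ with hσ
    have hσ' : ∀ i : Fin (n + 1), (σ i).val =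
      if i.val = k then k + 1 else if i.val = k + 1 then k else i.val := fun i => swap_val _ _ i
    have he := succAbove_bijTail e
    have he' : ∀ i, (e (Fin.succ i)).val =
        if (bijTail e i).val < p then (bijTail e i).val else (bijTail e i).val + 1 := fun i => by
      rw [← he i, succAbove_val]
    have e0 : ((e.trans σ) 0).val = if p = k then k + 1 else if p = k + 1 then k else p := hσ' _
    obtain ⟨q, hq⟩ : ∃ q, p + q = n := ⟨n - p, by omega⟩
    rw [cls_bij_succ e (bijTail e) (fun i => (he i).symm) hq, assoc]
    have mv_congr : ∀ {a b c d : ℕ} (h : a + b + 1 = n + 1) (h' : c + d + 1 = n + 1), a = c →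
        T.mv a b h = T.mv c d h' := by
      intro a b c d h h' hac
      obtain rfl : b = d := by omega
      subst hac; rfl
    rcases lt_trichotomy p k with hpk | hpk | hpk
    -- The crossing lies beyond the target of the moved wire. It commutes with the move and swaps
    -- the places `p + d = k - 1` and `k` of the tail, whose wires are counted without the moved
    -- one.
    · obtain ⟨d, rfl⟩ : ∃ d, k = p + 1 + d := ⟨k - (p + 1), by omega⟩
      rw [if_neg (by omega), if_neg (by omega)] at e0
      rw [cls_bij_succ (e.trans σ) ((bijTail e).trans (Equiv.swap ⟨p + d, by omega⟩
          ⟨p + d + 1, by omega⟩)) (q := q) ?_ (by omega), ih _ (p + d) r (by omega),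
        id_tensor_comp (j := n + 1) 1 _ _ _ (by omega) _, assoc,
        tensor_adj (T := T) 1 (p + d) r _ _ (by omega) h,
        mv_comp_adj_of_lt (T := T) p d r (q := q) (by omega) (by omega) rfl h]
      · exact congrArg _ (congrArg _ (mv_congr _ _ e0))
      · intro i
        apply Fin.ext
        rw [succAbove_val, e0, Equiv.trans_apply, Equiv.trans_apply, hσ', he', swap_val]
        grind
    -- The moved wire lands on `k`: the crossing prolongs its move and the tail is unchanged.
    · subst hpk
      rw [if_pos rfl] at e0
      obtain ⟨q, rfl⟩ : ∃ q', q = q' + 1 := ⟨q - 1, by omega⟩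
      obtain rfl : q = r := by omega
      rw [cls_bij_succ (e.trans σ) (bijTail e) (q := q) ?_ (by omega),
        mv_comp_adj_self (T := T) p q _ _ (by omega)]
      · exact congrArg _ (mv_congr _ _ e0)
      · intro i
        apply Fin.ext
        rw [succAbove_val, e0, Equiv.trans_apply, hσ', he']
        grind
    · rcases Nat.lt_or_ge (k + 1) p with hpk' | hpk'
      -- The moved wire passes both crossing wires, so their places in the tail are still `k` and `k
      -- + 1`.
      · obtain ⟨d, hd⟩ : ∃ d, k + 2 + d = p := ⟨p - (k + 2), by omega⟩
        rw [if_neg (by omega), if_neg (by omega)] at e0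
        rw [cls_bij_succ (e.trans σ) ((bijTail e).trans (Equiv.swap ⟨k, by omega⟩
            ⟨k + 1, by omega⟩)) (q := q) ?_ (by omega), ih _ k (d + q) (by omega),
          id_tensor_comp (j := n + 1) 1 _ _ _ (by omega) _, assoc,
          tensor_adj (T := T) 1 k (d + q) _ _ rfl (by omega),
          mv_comp_adj_of_gt (T := T) k d q hd (by omega) (by omega) h rfl rfl (by omega)]
        · exact congrArg _ (congrArg _ (mv_congr _ _ e0))
        · intro i
          apply Fin.ext
          rw [succAbove_val, e0, Equiv.trans_apply, Equiv.trans_apply, hσ', he', swap_val]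
          grind
      -- The moved wire lands on `k + 1`: the crossing undoes the last step of its move.
      · have hkp : k + 1 = p := by omega
        rw [if_neg (by omega), if_pos (by omega)] at e0
        obtain rfl : q = r := by omega
        have := mv_succ_comp_adj (T := T) k q (n := n + 1) (by omega) h (by omega)
        rw [cls_bij_succ (e.trans σ) (bijTail e) (q := q + 1) ?_ (by omega)]
        · refine congrArg _ ((mv_congr _ (by omega) e0).trans (this.symm.trans ?_))
          exact congrArg₂ comp (mv_congr _ _ (by omega)) rfl
        · intro i
          apply Fin.ext
          rw [succAbove_val, e0, Equiv.trans_apply, hσ', he']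
          grind

theorem cls_bij_swap {n : ℕ} (k r : ℕ) (h : k + 2 + r = n) :
    cls (T := T) (bij (Equiv.swap (⟨k, by omega⟩ : Fin n) ⟨k + 1, by omega⟩)) = T.adj k r h := by
  have := cls_bij_trans_swap (T := T) (Equiv.refl (Fin n)) k r h
  rwa [cls_bij_refl, id_comp, Equiv.refl_trans] at this

/-- Adjacent transpositions generate the symmetric group even as a monoid, so no case for inverses
is needed. -/
theorem perm_induction {n : ℕ} {P : Equiv.Perm (Fin n) → Prop} (one : P (Equiv.refl _))
    (swap : ∀ (k r : ℕ) (h : k + 2 + r = n),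
      P (Equiv.swap (⟨k, by omega⟩ : Fin n) ⟨k + 1, by omega⟩))
    (trans : ∀ σ τ : Equiv.Perm (Fin n), P σ → P τ → P (σ.trans τ)) (σ : Equiv.Perm (Fin n)) :
    P σ := by
  cases n with
  | zero => rwa [Subsingleton.elim σ (Equiv.refl _)]
  | succ n =>
    have h : σ ∈ Submonoid.closure
        (Set.range fun i : Fin n => Equiv.swap i.castSucc i.succ) := by
      rw [Equiv.Perm.mclosure_swap_castSucc_succ]; trivial
    induction h using Submonoid.closure_induction with
    | mem x hx =>
      obtain ⟨i, rfl⟩ := hx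
      exact swap i.val (n - 1 - i.val) (by omega)
    | one => exact one
    -- The product `x * y` applies `y` first.
    | mul x y _ _ hx hy => exact trans y x hy hx

/-- The term `bij` is one particular wiring; this says that all wirings obtained by composing such
terms agree. The second factor is a product of adjacent transpositions, each handled by
`cls_bij_trans_swap`; the first factor stays arbitrary throughout the induction. -/
theorem cls_bij_trans {n m o : ℕ} (e : Fin n ≃ Fin m) (e' : Fin m ≃ Fin o) :
    cls (T := T) (bij (e.trans e')) = comp (cls (bij e)) (cls (bij e')) := by
  obtain rfl : n = m := by simpa using Fintype.card_congr e
  obtain rfl : n = o := by simpa using Fintype.card_congr e'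
  refine perm_induction (P := fun σ => ∀ e : Fin n ≃ Fin n,
    cls (T := T) (bij (e.trans σ)) = comp (cls (bij e)) (cls (bij σ))) ?_ ?_ ?_ e' e
  · intro e; rw [cls_bij_refl, comp_id, Equiv.trans_refl]
  · intro k r h e; rw [cls_bij_trans_swap e k r h, cls_bij_swap k r h]
  · intro σ τ hσ hτ e
    rw [← Equiv.trans_assoc, hτ, hσ, hτ σ, assoc]

end SMT

/-! ### Sums of bijections and block transpositions -/

/-- The parallel composition of two bijections. -/
def finSum {m n o p : ℕ} (e : Fin m ≃ Fin n) (e' : Fin o ≃ Fin p) : Fin (m + o) ≃ Fin (n + p) :=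
  finSumFinEquiv.symm.trans ((Equiv.sumCongr e e').trans finSumFinEquiv)

theorem finSum_castAdd {m n o p : ℕ} (e : Fin m ≃ Fin n) (e' : Fin o ≃ Fin p) (i : Fin m) :
    finSum e e' (Fin.castAdd o i) = Fin.castAdd p (e i) := by
  simp [finSum]

theorem finSum_natAdd {m n o p : ℕ} (e : Fin m ≃ Fin n) (e' : Fin o ≃ Fin p) (i : Fin o) :
    finSum e e' (Fin.natAdd m i) = Fin.natAdd n (e' i) := by
  simp [finSum]

theorem finSum_trans {m n o m' n' o' : ℕ} (e : Fin m ≃ Fin n) (f : Fin n ≃ Fin o)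
    (e' : Fin m' ≃ Fin n') (f' : Fin n' ≃ Fin o') :
    finSum (e.trans f) (e'.trans f') = (finSum e e').trans (finSum f f') := by
  ext i
  induction i using Fin.addCases <;> simp [finSum_castAdd, finSum_natAdd]

theorem finSum_refl (m n : ℕ) :
    finSum (Equiv.refl (Fin m)) (Equiv.refl (Fin n)) = Equiv.refl _ := by
  ext i
  induction i using Fin.addCases <;> simp [finSum_castAdd, finSum_natAdd]

namespace SMT

open Trm

variable {T : SMT.{s}}

/-- Since `e ⊕ e' = (e ⊕ id) ; (id ⊕ e')`, one factor may be taken to be the identity. That case is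
compatible with composition, and an adjacent transposition with idle wires added is again an
adjacent transposition. -/
theorem cls_bij_finSum {m n o p : ℕ} (e : Fin m ≃ Fin n) (e' : Fin o ≃ Fin p) :
    cls (T := T) (bij (finSum e e')) = tensor (cls (bij e)) (cls (bij e')) rfl rfl := by
  obtain rfl : m = n := by simpa using Fintype.card_congr e
  obtain rfl : o = p := by simpa using Fintype.card_congr e'
  have h1 : ∀ e : Equiv.Perm (Fin m), cls (T := T) (bij (finSum e (Equiv.refl (Fin o)))) =
      tensor (cls (bij e)) (cls (idn o)) rfl rfl := by
    refine perm_induction ?_ ?_ ?_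
    · rw [finSum_refl, cls_bij_refl, cls_bij_refl, tensor_id]
    · intro k r h
      have : finSum (Equiv.swap (⟨k, by omega⟩ : Fin m) ⟨k + 1, by omega⟩) (Equiv.refl (Fin o)) =
          Equiv.swap ⟨k, by omega⟩ ⟨k + 1, by omega⟩ := by
        ext i
        rw [swap_val]
        induction i using Fin.addCases with
        | left i => rw [finSum_castAdd, Fin.val_castAdd, swap_val, Fin.val_castAdd]
        | right i =>
          rw [finSum_natAdd, Fin.val_natAdd, Equiv.refl_apply, Fin.val_natAdd]
          grind
      rw [this, cls_bij_swap k r h, cls_bij_swap k (r + o) (by omega),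
        adj_tensor (T := T) o k r h rfl rfl (by omega)]
    · intro σ τ hσ hτ
      rw [← Equiv.refl_trans (Equiv.refl (Fin o)), finSum_trans, cls_bij_trans, hσ, hτ,
        cls_bij_trans, ← comp_tensor_id]
  have h2 : ∀ e : Equiv.Perm (Fin o), cls (T := T) (bij (finSum (Equiv.refl (Fin m)) e)) =
      tensor (cls (idn m)) (cls (bij e)) rfl rfl := by
    refine perm_induction ?_ ?_ ?_
    · rw [finSum_refl, cls_bij_refl, cls_bij_refl, tensor_id]
    · intro k r h
      have : finSum (Equiv.refl (Fin m)) (Equiv.swap (⟨k, by omega⟩ : Fin o) ⟨k + 1, by omega⟩) =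
          Equiv.swap ⟨m + k, by omega⟩ ⟨m + k + 1, by omega⟩ := by
        ext i
        rw [swap_val]
        induction i using Fin.addCases with
        | left i =>
          rw [finSum_castAdd, Fin.val_castAdd, Equiv.refl_apply, Fin.val_castAdd]
          grind
        | right i =>
          rw [finSum_natAdd, Fin.val_natAdd, swap_val, Fin.val_natAdd]
          grind
      rw [this, cls_bij_swap k r h, cls_bij_swap (m + k) r (by omega),
        tensor_adj (T := T) m k r h rfl rfl (by omega)]
    · intro σ τ hσ hτ
      rw [← Equiv.refl_trans (Equiv.refl (Fin m)), finSum_trans, cls_bij_trans, hσ, hτ,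
        cls_bij_trans, ← id_tensor_comp]
  rw [← Equiv.trans_refl e, ← Equiv.refl_trans e', finSum_trans, cls_bij_trans, h1, h2,
    ← interchange, comp_id, id_comp, Equiv.trans_refl, Equiv.refl_trans]

/-- The parallel composition of two bijections, with flexible sizes. -/
def finSumCast {m n o p k l : ℕ} (e : Fin m ≃ Fin n) (e' : Fin o ≃ Fin p) (hk : m + o = k)
    (hl : n + p = l) : Fin k ≃ Fin l :=
  (finCongr hk.symm).trans ((finSum e e').trans (finCongr hl))

theorem finSumCast_val {m n o p k l : ℕ} (e : Fin m ≃ Fin n) (e' : Fin o ≃ Fin p)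
    (hk : m + o = k) (hl : n + p = l) (i : Fin k) : (finSumCast e e' hk hl i).val =
      if h : i.val < m then (e ⟨i, h⟩).val else n + (e' ⟨i - m, by omega⟩).val := by
  subst hk hl
  induction i using Fin.addCases with
  | left i => simp [finSumCast, finSum_castAdd]
  | right i => simp [finSumCast, finSum_natAdd]

theorem cls_bij_finSumCast {m n o p k l : ℕ} (e : Fin m ≃ Fin n) (e' : Fin o ≃ Fin p)
    (hk : m + o = k) (hl : n + p = l) :
    cls (T := T) (bij (finSumCast e e' hk hl)) = tensor (cls (bij e)) (cls (bij e')) hk hl := by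
  subst hk hl
  exact cls_bij_finSum e e'

theorem cls_bij_eq_idn {n : ℕ} (e : Fin n ≃ Fin n) (h : ∀ i, (e i).val = i.val) :
    cls (T := T) (bij e) = cls (idn n) := by
  rw [← cls_bij_refl]
  congr 2
  ext i
  exact h i

/-- The block transposition, with flexible sizes. -/
def rot (m n : ℕ) {k l : ℕ} (hk : m + n = k) (hl : n + m = l) : Fin k ≃ Fin l :=
  (finCongr hk.symm).trans (finAddFlip.trans (finCongr hl))

theorem rot_val (m n : ℕ) {k l : ℕ} (hk : m + n = k) (hl : n + m = l) (i : Fin k) :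
    (rot m n hk hl i).val = if i.val < m then n + i.val else i.val - m := by
  subst hk hl
  induction i using Fin.addCases with
  | left i => simp [rot]
  | right i => simp [rot]

theorem cls_bij_rot_one (n : ℕ) {k l : ℕ} (hk : 1 + n = k) (hl : n + 1 = l) :
    cls (T := T) (bij (rot 1 n hk hl)) = T.sOne n hk hl := by
  induction n generalizing k l with
  | zero =>
    obtain rfl : k = l := by omega
    rw [sOne_zero]
    refine cls_bij_eq_idn _ fun i => ?_
    rw [rot_val]; split_ifs <;> omega
  | succ n ih =>
    obtain rfl : k = l := by omega
    rw [sOne_succ (T := T) n (i := n + 1) (j := n + 1) (i' := k) (by omega) (by omega)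
      (by omega) (by omega) (by omega) (by omega) (by omega) (by omega),
      ← ih (by omega) (by omega), ← cls_bij_refl, ← cls_bij_refl]
    have hsym : cls (T := T) .sym = cls (bij (rot 1 1 rfl rfl)) := by
      have : rot 1 1 rfl rfl = Equiv.swap (⟨0, by omega⟩ : Fin 2) ⟨1, by omega⟩ := by
        ext i; rw [rot_val, swap_val]; grind
      rw [this, cls_bij_swap 0 0 (by omega)]
      exact ((tensor_unit _).trans (unit_tensor _)).symm
    rw [hsym, ← cls_bij_finSumCast, ← cls_bij_finSumCast, ← cls_bij_trans]
    congr 2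
    ext i
    simp only [Equiv.trans_apply, rot_val, finSumCast_val, Equiv.refl_apply]
    grind

/-- Along the recursion for `σ_{m,n}` all factors become wiring terms. By coherence what remains is
an equality of bijections, checked on values. -/
theorem cls_bij_rot (m n : ℕ) {k l : ℕ} (hk : m + n = k) (hl : n + m = l) :
    cls (T := T) (bij (rot m n hk hl)) = T.sT m n hk hl := by
  induction m generalizing k l with
  | zero =>
    obtain rfl : k = l := by omega
    rw [sT_zero]
    refine cls_bij_eq_idn _ fun i => ?_
    rw [rot_val]; split_ifs <;> omega
  | succ m ih =>
    obtain rfl : k = l := by omega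
    rw [sT_succ (T := T) m n (i := n + 1) (j := n + 1) (x := k) (y := m + n) (z := n + m)
      (by omega) (by omega) (by omega) (by omega) (by omega) (by omega) (by omega) (by omega)
      (by omega) (by omega), ← ih, ← cls_bij_rot_one, ← cls_bij_refl, ← cls_bij_refl,
      ← cls_bij_finSumCast, ← cls_bij_finSumCast, ← cls_bij_trans]
    congr 2
    ext i
    simp only [Equiv.trans_apply, rot_val, finSumCast_val, Equiv.refl_apply]
    grind

end SMT

/-! ### Interpretation of terms and isomorphisms of presented PROPs -/

namespace Trm

open SMT

/-- The interpretation of terms in a presented PROP, given an interpretation of the generators. -/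
def eval {S : Signature.{u}} {T : SMT.{v}} (g : ∀ γ : S.Gen, T.Arr (S.ar γ) (S.coar γ)) :
    ∀ {m n : ℕ}, Trm S m n → T.Arr m n
  | _, _, gen γ => g γ
  | _, _, empty => cls empty
  | _, _, id => cls id
  | _, _, sym => cls sym
  | _, _, par t t' hk hl => tensor (eval g t) (eval g t') hk hl
  | _, _, seq t t' => comp (eval g t) (eval g t')

section

variable {S : Signature.{u}} {T : SMT.{v}} (g : ∀ γ : S.Gen, T.Arr (S.ar γ) (S.coar γ))

theorem eval_idn (n : ℕ) : eval g (idn n) = cls (idn n) := by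
  induction n with
  | zero => rfl
  | succ n ih => simp only [idn, eval, ih]; rfl

theorem eval_symOne (n : ℕ) : eval g (symOne n) = cls (symOne n) := by
  induction n with
  | zero => rfl
  | succ n ih => simp only [symOne, eval, ih, eval_idn]; rfl

theorem eval_symT (m n : ℕ) : eval g (symT m n) = cls (symT m n) := by
  induction m with
  | zero => simp only [symT, eval, eval_idn]; rfl
  | succ m ih => simp only [symT, eval, ih, eval_idn, eval_symOne]; rfl

theorem eval_bij {m n : ℕ} (e : Fin m ≃ Fin n) : eval g (bij e) = cls (bij e) := by
  induction m generalizing n with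
  | zero =>
    cases n with
    | zero => rfl
    | succ n => exact (e.symm 0).elim0
  | succ m ih =>
    cases n with
    | zero => exact (e 0).elim0
    | succ n => simp only [bij, move, eval, ih, eval_idn, eval_symT]; rfl

theorem eval_ax {m n : ℕ} {t t' : Trm S m n} (h : SMTAx S m n t t') : eval g t = eval g t' := by
  cases h with
  | seq_assoc => exact SMT.assoc _ _ _
  | id_seq => simp only [eval, eval_idn, SMT.id_comp]
  | seq_id => simp only [eval, eval_idn, SMT.comp_id]
  | par_assoc => exact SMT.tensor_assoc _ _ _ _ _ _ _ _ _ _ _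
  | empty_par => exact SMT.unit_tensor _
  | par_empty => exact SMT.tensor_unit _
  | sym_sym => rw [eval_idn]; exact cls_ax .sym_sym
  | interchange => exact SMT.interchange _ _ _ _ _ _ _
  | natural => simp only [eval, eval_symT, SMT.symm_natural]

theorem eval_th {R : TrmEqs S} (hR : ∀ {m n} {t t' : Trm S m n}, R m n t t' → eval g t = eval g t')
    {m n : ℕ} {t t' : Trm S m n} (h : Th R m n t t') : eval g t = eval g t' := by
  induction h with
  | ax h => exact hR h
  | refl => rfl
  | symm _ ih => exact ih.symm
  | trans _ _ ih ih' => exact ih.trans ih'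
  | seq _ _ ih ih' => simp only [eval, ih, ih']
  | par _ _ _ _ ih ih' => simp only [eval, ih, ih']

end

end Trm

namespace SMT

open Trm

/-- The functor of presented PROPs given by an interpretation of the generators. -/
def map {T : SMT.{u}} {U : SMT.{v}} (g : ∀ γ : T.sig.Gen, U.Arr (T.sig.ar γ) (T.sig.coar γ))
    (hg : ∀ {m n} {t t' : Trm T.sig m n}, T.eqs m n t t' → eval g t = eval g t') {m n : ℕ}
    (f : T.Arr m n) : U.Arr m n :=
  Quotient.lift (eval g) (fun _ _ h => eval_th g (fun h => h.elim hg (eval_ax g)) h) f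

/-- A functor out of a presented PROP is determined by its values on generators; this is one half of
an inverse law in `isoOfEval`. -/
theorem map_eval {T : SMT.{u}} {U : SMT.{v}}
    (g : ∀ γ : T.sig.Gen, U.Arr (T.sig.ar γ) (T.sig.coar γ))
    (hg : ∀ {m n} {t t' : Trm T.sig m n}, T.eqs m n t t' → eval g t = eval g t')
    (h : ∀ γ : U.sig.Gen, T.Arr (U.sig.ar γ) (U.sig.coar γ))
    (hgh : ∀ γ, map g hg (h γ) = cls (gen γ)) {m n : ℕ} (t : Trm U.sig m n) :
    map g hg (eval h t) = cls t := by
  induction t with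
  | gen γ => exact hgh γ
  | empty => rfl
  | id => rfl
  | sym => rfl
  | par t t' hk hl ih ih' =>
    rw [cls_par, ← ih, ← ih', eval]
    -- `map` computes on classes of terms, so representatives of both factors are chosen.
    obtain ⟨x, hx⟩ := exists_cls (eval h t)
    obtain ⟨y, hy⟩ := exists_cls (eval h t')
    rw [← hx, ← hy]
    rfl
  | seq t t' ih ih' =>
    rw [cls_seq, ← ih, ← ih', eval]
    obtain ⟨x, hx⟩ := exists_cls (eval h t)
    obtain ⟨y, hy⟩ := exists_cls (eval h t')
    rw [← hx, ← hy]
    rfl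

/-- Two interpretations of generators that are inverse to each other give an isomorphism. -/
def isoOfEval {T : SMT.{u}} {U : SMT.{v}}
    (g : ∀ γ : T.sig.Gen, U.Arr (T.sig.ar γ) (T.sig.coar γ))
    (hg : ∀ {m n} {t t' : Trm T.sig m n}, T.eqs m n t t' → eval g t = eval g t')
    (h : ∀ γ : U.sig.Gen, T.Arr (U.sig.ar γ) (U.sig.coar γ))
    (hh : ∀ {m n} {t t' : Trm U.sig m n}, U.eqs m n t t' → eval h t = eval h t')
    (hgh : ∀ γ, map g hg (h γ) = cls (gen γ)) (hhg : ∀ γ, map h hh (g γ) = cls (gen γ)) :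
    PROP.Iso T.toPROP U.toPROP where
  equiv m n :=
    { toFun := map g hg
      invFun := map h hh
      left_inv := by
        intro f
        obtain ⟨t, rfl⟩ := exists_cls f
        exact map_eval h hh g hhg t
      right_inv := by
        intro f
        obtain ⟨t, rfl⟩ := exists_cls f
        exact map_eval g hg h hgh t }
  map_id n := eval_idn g n
  map_comp f f' := by
    obtain ⟨t, rfl⟩ := exists_cls f
    obtain ⟨t', rfl⟩ := exists_cls f'
    rfl
  map_tensor f f' hk hl := by
    obtain ⟨t, rfl⟩ := exists_cls f
    obtain ⟨t', rfl⟩ := exists_cls f'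
    rfl
  map_symm m n := eval_symT g m n

end SMT

/-- The composite of two isomorphisms of PROPs. -/
def PROP.Iso.trans {P Q : PROP} {R : PROP} (i : PROP.Iso P Q) (j : PROP.Iso Q R) :
    PROP.Iso P R where
  equiv m n := (i.equiv m n).trans (j.equiv m n)
  map_id n := by simp only [Equiv.trans_apply, i.map_id, j.map_id]
  map_comp f g := by simp only [Equiv.trans_apply, i.map_comp, j.map_comp]
  map_tensor f g hk hl := by simp only [Equiv.trans_apply, i.map_tensor, j.map_tensor]
  map_symm m n := by simp only [Equiv.trans_apply, i.map_symm, j.map_symm]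

/-- The inverse of an isomorphism of PROPs. -/
def PROP.Iso.symm {P Q : PROP} (i : PROP.Iso P Q) : PROP.Iso Q P where
  equiv m n := (i.equiv m n).symm
  map_id n := by rw [Equiv.symm_apply_eq, i.map_id]
  map_comp f g := by simp only [Equiv.symm_apply_eq, i.map_comp, Equiv.apply_symm_apply]
  map_tensor f g hk hl := by
    simp only [Equiv.symm_apply_eq, i.map_tensor, Equiv.apply_symm_apply]
  map_symm m n := by rw [Equiv.symm_apply_eq, i.map_symm]

/-- The inverse of an isomorphism of nominal PROPs. -/
def NPROP.Iso.symm {𝒩 : Type w} {P : NPROP.{u} 𝒩} {Q : NPROP.{v} 𝒩} (i : NPROP.Iso P Q) :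
    NPROP.Iso Q P where
  equiv A B := (i.equiv A B).symm
  map_id A := by rw [Equiv.symm_apply_eq, i.map_id]
  map_comp f g := by simp only [Equiv.symm_apply_eq, i.map_comp, Equiv.apply_symm_apply]
  map_tensor f g hC hD := by
    simp only [Equiv.symm_apply_eq, i.map_tensor, Equiv.apply_symm_apply]
  map_ren e := by rw [Equiv.symm_apply_eq, i.map_ren]

/-! ### `ORD` respects isomorphisms -/

namespace NPROP

open Trm SMT

variable {𝒩 : Type w}

/-- The action is conjugation by bijections, which an isomorphism fixes. -/
theorem Iso.map_act {P : NPROP.{u} 𝒩} {Q : NPROP.{v} 𝒩} (i : NPROP.Iso P Q) (π : FinPerm 𝒩)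
    {A B A' B' : Finset 𝒩} (hA : π.act A = A') (hB : π.act B = B') (f : P.Hom A B) :
    i.equiv A' B' (P.act π hA hB f) = Q.act π hA hB (i.equiv A B f) := by
  simp only [act, i.map_comp, i.map_ren]

/-- The presentation of `ORD(T)`. -/
abbrev ordSMT (T : NPROP.{u} 𝒩) : SMT.{max u w} := ⟨T.ordSig, T.OrdEq⟩

/-- The class of the symbol `⟨a] f [b⟩`. -/
def D {T : NPROP.{u} 𝒩} {A B : Finset 𝒩} {n m : ℕ} (a : Fin n ≃ A) (f : T.Hom A B)
    (b : Fin m ≃ B) : T.ordSMT.Arr n m := cls (T := T.ordSMT) (dia a f b)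

theorem sound {T : NPROP.{u} 𝒩} {n m : ℕ} {t t' : Trm T.ordSig n m} (h : T.OrdEq n m t t') :
    cls (T := T.ordSMT) t = cls (T := T.ordSMT) t' := Quotient.sound (Th.ax (Or.inl h))

/-- The interpretation of `⟨a] f [b⟩` along an isomorphism of nominal PROPs. -/
def Iso.ordGen {P : NPROP.{u} 𝒩} {Q : NPROP.{v} 𝒩} (i : NPROP.Iso P Q) (γ : P.ordSMT.sig.Gen) :
    Q.ordSMT.Arr (P.ordSMT.sig.ar γ) (P.ordSMT.sig.coar γ) :=
  D (Dia.a γ) (i.equiv _ _ (Dia.f γ)) (Dia.b γ)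

theorem Iso.eval_dia {P : NPROP.{u} 𝒩} {Q : NPROP.{v} 𝒩} (i : NPROP.Iso P Q) {A B : Finset 𝒩}
    {n m : ℕ} (a : Fin n ≃ A) (f : P.Hom A B) (b : Fin m ≃ B) :
    eval i.ordGen (dia a f b) = D a (i.equiv _ _ f) b := rfl

theorem Iso.eval_ordGen {P : NPROP.{u} 𝒩} {Q : NPROP.{v} 𝒩} (i : NPROP.Iso P Q) {m n : ℕ}
    {t t' : Trm P.ordSig m n} (h : P.OrdEq m n t t') : eval i.ordGen t = eval i.ordGen t' := by
  cases h with
  | comp f g a b c => simp only [eval, Iso.eval_dia, i.map_comp]; exact sound (.comp _ _ _ _ _)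
  | tensor f g hC hD a b a' b' =>
    simp only [eval, Iso.eval_dia, i.map_tensor]; exact sound (.tensor _ _ _ _ _ _ _ _)
  | id a => simp only [Iso.eval_dia, i.map_id, eval_idn]; exact sound (.id _)
  | ren_left f a a' b c =>
    simp only [eval, Iso.eval_dia, i.map_comp, i.map_ren, eval_bij]
    exact sound (.ren_left _ _ _ _ _)
  | ren_right f a b c c' =>
    simp only [eval, Iso.eval_dia, i.map_comp, i.map_ren, eval_bij]
    exact sound (.ren_right _ _ _ _ _)
  | perm π hA hB f a b =>
    simp only [Iso.eval_dia, i.map_act]; exact sound (.perm _ _ _ _ _ _)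

/-- Isomorphic nominal PROPs have isomorphic PROPs. -/
def Iso.ord {P : NPROP.{u} 𝒩} {Q : NPROP.{v} 𝒩} (i : NPROP.Iso P Q) : PROP.Iso P.ORD Q.ORD :=
  isoOfEval (T := P.ordSMT) (U := Q.ordSMT) i.ordGen i.eval_ordGen i.symm.ordGen
    i.symm.eval_ordGen
    (fun γ => (i.eval_dia (Dia.a γ) _ (Dia.b γ)).trans
      (congrArg (fun f => D (Dia.a γ) f (Dia.b γ)) ((i.equiv _ _).apply_symm_apply _)))
    (fun γ => (i.symm.eval_dia (Dia.a γ) _ (Dia.b γ)).trans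
      (congrArg (fun f => D (Dia.a γ) f (Dia.b γ)) ((i.equiv _ _).symm_apply_apply _)))

end NPROP

/-! ### Calculus of bijections in a presented PROP -/

namespace SMT

open Trm

variable {T : SMT.{s}}

/-- The arrow of a presented PROP given by a bijection. -/
def bj (T : SMT.{s}) {n m : ℕ} (e : Fin n ≃ Fin m) : T.Arr n m := cls (bij e)

theorem bj_refl (n : ℕ) : T.bj (Equiv.refl (Fin n)) = cls (idn n) := cls_bij_refl n

theorem bj_trans {n m o : ℕ} (e : Fin n ≃ Fin m) (e' : Fin m ≃ Fin o) :
    T.bj (e.trans e') = comp (T.bj e) (T.bj e') := cls_bij_trans e e'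

theorem bj_self {n : ℕ} {α : Type*} (a : Fin n ≃ α) : T.bj (a.trans a.symm) = cls (idn n) := by
  rw [Equiv.self_trans_symm, bj_refl]

/-- This is `⟨a|a₀⟩ ; ⟨a₀|b⟩ = ⟨a|b⟩`, where a general `x` in place of `b.symm` also allows a
renaming in between. -/
theorem bj_merge {α : Type*} {n k m : ℕ} (a : Fin n ≃ α) (a₀ : Fin k ≃ α) (x : α ≃ Fin m) :
    comp (T.bj (a.trans a₀.symm)) (T.bj (a₀.trans x)) = T.bj (a.trans x) := by
  rw [← bj_trans]
  congr 1
  ext i; simp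

theorem bj_merge_assoc {α : Type*} {n k m o : ℕ} (a : Fin n ≃ α) (a₀ : Fin k ≃ α)
    (x : α ≃ Fin m) (f : T.Arr m o) :
    comp (T.bj (a.trans a₀.symm)) (comp (T.bj (a₀.trans x)) f) = comp (T.bj (a.trans x)) f := by
  rw [← assoc, bj_merge]

theorem bj_finSum {m n o p : ℕ} (e : Fin m ≃ Fin n) (e' : Fin o ≃ Fin p) :
    T.bj (finSum e e') = tensor (T.bj e) (T.bj e') rfl rfl := cls_bij_finSum e e'

theorem bj_rot (m n : ℕ) : T.bj (rot m n rfl rfl) = cls (symT m n) := cls_bij_rot m n rfl rfl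

/-- An expression with permutations at both ends absorbs further ones, which settles the cases of
generators and of `⊎` in `nf_change`. -/
theorem bj_conj {α β : Type*} {n n' n'' m m' m'' : ℕ} (a : Fin n ≃ α) (a' : Fin n' ≃ α)
    (a'' : Fin n'' ≃ α) (b : Fin m ≃ β) (b' : Fin m' ≃ β) (b'' : Fin m'' ≃ β)
    (f : T.Arr n'' m'') :
    comp (T.bj (a.trans a'.symm)) (comp (comp (T.bj (a'.trans a''.symm))
      (comp f (T.bj (b''.trans b'.symm)))) (T.bj (b'.trans b.symm))) =
    comp (T.bj (a.trans a''.symm)) (comp f (T.bj (b''.trans b.symm))) := by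
  simp only [assoc, bj_merge_assoc, bj_merge]

theorem cls_cast {m n m' n' : ℕ} (hm : m = m') (hn : n = n') {t t' : Trm T.sig m n}
    (h : cls t = cls t') : cls (Trm.cast hm hn t) = cls (Trm.cast hm hn t') := by
  subst hm hn; exact h

theorem cls_cast_idn {k m n : ℕ} (hm : k = m) (hn : k = n) (e : Fin m ≃ Fin n)
    (he : ∀ i, (e i).val = i.val) : cls (T := T) (Trm.cast hm hn (idn k)) = T.bj e := by
  subst hm hn; exact (cls_bij_eq_idn e he).symm

/-- On at most one wire every bijection is the identity; hence here and in `cls_cast_id` the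
bijection `e` is arbitrary. -/
theorem cls_cast_empty {m n : ℕ} (hm : 0 = m) (hn : 0 = n) (e : Fin m ≃ Fin n) :
    cls (T := T) (Trm.cast hm hn .empty) = T.bj e :=
  cls_cast_idn hm hn e (fun i => by subst hm; exact i.elim0)

theorem cls_cast_id {m n : ℕ} (hm : 1 = m) (hn : 1 = n) (e : Fin m ≃ Fin n) :
    cls (T := T) (Trm.cast hm hn .id) = T.bj e :=
  (cls_cast hm hn cls_id).trans (cls_cast_idn hm hn e (fun i => by subst hm hn; omega))

end SMT

/-! ### Concatenation of enumerations -/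

section append

variable {𝒩 : Type w}

theorem IsDisjUnion.append_castAdd {A B C : Finset 𝒩} {m n : ℕ} (h : IsDisjUnion A B C)
    (a : Fin m ≃ A) (b : Fin n ≃ B) (i : Fin m) :
    ((h.append a b (Fin.castAdd n i) : C) : 𝒩) = a i := by
  simp [append, sumEquiv]

theorem IsDisjUnion.append_natAdd {A B C : Finset 𝒩} {m n : ℕ} (h : IsDisjUnion A B C)
    (a : Fin m ≃ A) (b : Fin n ≃ B) (i : Fin n) :
    ((h.append a b (Fin.natAdd m i) : C) : 𝒩) = b i := by
  simp [append, sumEquiv]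

theorem IsDisjUnion.append_val {A B C : Finset 𝒩} {m n : ℕ} (h : IsDisjUnion A B C)
    (a : Fin m ≃ A) (b : Fin n ≃ B) (i : Fin (m + n)) :
    ((h.append a b i : C) : 𝒩) =
      if hi : i.val < m then (a ⟨i, hi⟩ : 𝒩) else b ⟨i - m, by omega⟩ := by
  induction i using Fin.addCases with
  | left i => simp [append_castAdd]
  | right i => simp [append_natAdd]

theorem IsDisjUnion.congr_left {A A' B B' C D : Finset 𝒩} (hC : IsDisjUnion A A' C)
    (hD : IsDisjUnion B B' D) (e : A ≃ B) (e' : A' ≃ B') (x : C) (hx : (x : 𝒩) ∈ A) :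
    ((hC.congr hD e e' x : D) : 𝒩) = e ⟨x, hx⟩ := by
  have : hC.sumEquiv.symm x = Sum.inl ⟨x, hx⟩ := by
    rw [Equiv.symm_apply_eq]; rfl
  simp only [IsDisjUnion.congr, Equiv.trans_apply, this]
  rfl

theorem IsDisjUnion.congr_right {A A' B B' C D : Finset 𝒩} (hC : IsDisjUnion A A' C)
    (hD : IsDisjUnion B B' D) (e : A ≃ B) (e' : A' ≃ B') (x : C) (hx : (x : 𝒩) ∈ A') :
    ((hC.congr hD e e' x : D) : 𝒩) = e' ⟨x, hx⟩ := by
  have : hC.sumEquiv.symm x = Sum.inr ⟨x, hx⟩ := by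
    rw [Equiv.symm_apply_eq]; rfl
  simp only [IsDisjUnion.congr, Equiv.trans_apply, this]
  rfl

theorem IsDisjUnion.append_trans_congr {A A' B B' C D : Finset 𝒩} {m n : ℕ}
    (hC : IsDisjUnion A A' C) (hD : IsDisjUnion B B' D) (e : A ≃ B) (e' : A' ≃ B')
    (a : Fin m ≃ A) (a' : Fin n ≃ A') :
    (hC.append a a').trans (hC.congr hD e e') = hD.append (a.trans e) (a'.trans e') := by
  ext i
  simp [append, congr]

theorem IsDisjUnion.append_trans_symm {A B C : Finset 𝒩} {m n m' n' : ℕ} (h : IsDisjUnion A B C)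
    (a : Fin m ≃ A) (b : Fin n ≃ B) (a' : Fin m' ≃ A) (b' : Fin n' ≃ B) :
    (h.append a b).trans (h.append a' b').symm =
      finSum (a.trans a'.symm) (b.trans b'.symm) := by
  ext i
  simp [append, finSum]

theorem IsDisjUnion.congr_refl {A B C : Finset 𝒩} (h h' : IsDisjUnion A B C) :
    h.congr h' (Equiv.refl A) (Equiv.refl B) = Equiv.refl C := by
  ext x
  simp [congr]

/-- The source of the symmetries: exchanging the two parts of `A ⊎ B` exchanges two blocks of wires.
-/
theorem IsDisjUnion.append_symm {A B C : Finset 𝒩} {m n : ℕ} (h : IsDisjUnion A B C)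
    (h' : IsDisjUnion B A C) (a : Fin m ≃ A) (b : Fin n ≃ B) :
    (h.append a b).trans (h'.append b a).symm = SMT.rot m n rfl rfl := by
  have : h.append a b = (SMT.rot m n rfl rfl).trans (h'.append b a) := by
    ext i
    induction i using Fin.addCases with
    | left i => simp [SMT.rot, append_castAdd, append_natAdd]
    | right i => simp [SMT.rot, append_castAdd, append_natAdd]
  rw [this, Equiv.trans_assoc, Equiv.self_trans_symm, Equiv.trans_refl]

end append

/-! ### Normal forms under change of enumerations -/

namespace NTrm

open SMT

variable {𝒩 : Type w} {U : SMT.{s}} (ch : ∀ A : Finset 𝒩, Fin A.card ≃ A)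

/-- The arrow of a presented PROP that interprets `⟨a] t [b⟩`. -/
noncomputable def nf {A B : Finset 𝒩} (t : NTrm 𝒩 U.sig A B) {n m : ℕ} (a : Fin n ≃ A)
    (b : Fin m ≃ B) : U.Arr n m := cls (t.nfSmt ch a b)

theorem nf_gen {A B : Finset 𝒩} (γ : U.sig.Gen) (a' : Fin (U.sig.ar γ) ≃ A)
    (b' : Fin (U.sig.coar γ) ≃ B) {n m : ℕ} (a : Fin n ≃ A) (b : Fin m ≃ B) :
    nf ch (gen γ a' b') a b = comp (U.bj (a.trans a'.symm))
      (comp (cls (.gen γ)) (U.bj (b'.trans b.symm))) := rfl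

theorem nf_perm {A B A' B' : Finset 𝒩} (π : FinPerm 𝒩) (t : NTrm 𝒩 U.sig A B) (hA : π.act A = A')
    (hB : π.act B = B') {n m : ℕ} (a : Fin n ≃ A') (b : Fin m ≃ B') :
    nf ch (perm π t hA hB) a b = nf ch t (a.trans (π.onSet hA).symm) (b.trans (π.onSet hB).symm) :=
  rfl

theorem nf_par_ch {A B A' B' C D : Finset 𝒩} (t : NTrm 𝒩 U.sig A B) (t' : NTrm 𝒩 U.sig A' B')
    (hC : IsDisjUnion A A' C) (hD : IsDisjUnion B B' D) {k l : ℕ} (c : Fin k ≃ C) (d : Fin l ≃ D) :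
    nf ch (par t t' hC hD) c d = comp (U.bj (c.trans (hC.append (ch A) (ch A')).symm))
      (comp (tensor (nf ch t (ch A) (ch B)) (nf ch t' (ch A') (ch B')) rfl rfl)
        (U.bj ((hD.append (ch B) (ch B')).trans d.symm))) := rfl

/-- Normal forms of generators and of `⊎` already begin and end with permutations that absorb the
change. A composite passes the change to its two ends, a formal permutation relabels all
enumerations alike, and the remaining terms have at most one wire. -/
theorem nf_change {A B : Finset 𝒩} (t : NTrm 𝒩 U.sig A B) {n m n' m' : ℕ} (a : Fin n ≃ A)
    (b : Fin m ≃ B) (a' : Fin n' ≃ A) (b' : Fin m' ≃ B) : nf ch t a b =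
      comp (U.bj (a.trans a'.symm)) (comp (nf ch t a' b') (U.bj (b'.trans b.symm))) := by
  have triv : ∀ {n m n' m' : ℕ} (e : Fin n' ≃ Fin m') (f : Fin n ≃ Fin n')
      (g : Fin m' ≃ Fin m), U.bj (f.trans (e.trans g)) = comp (U.bj f) (comp (U.bj e) (U.bj g)) :=
    by intros; rw [bj_trans, bj_trans]
  induction t generalizing n m n' m' with
  | gen γ a'' b'' => simp only [nf_gen, bj_conj]
  | empty =>
    have e := (a'.trans b'.symm)
    rw [nf, nf, nfSmt, nfSmt, cls_cast_empty _ _ e, ← triv]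
    exact cls_cast_empty _ _ _
  | id x =>
    have e := (a'.trans b'.symm)
    rw [nf, nf, nfSmt, nfSmt, cls_cast_id _ _ e, ← triv]
    exact cls_cast_id _ _ _
  | delta x y =>
    have e := (a'.trans ((Equiv.ofUnique ({x} : Finset 𝒩) ({y} : Finset 𝒩)).trans b'.symm))
    rw [nf, nf, nfSmt, nfSmt, cls_cast_id _ _ e, ← triv]
    exact cls_cast_id _ _ _
  | par f g hC hD ihf ihg =>
    rw [nf_par_ch, nf_par_ch, bj_conj]
  | seq f g ihf ihg =>
    -- The middle enumeration is kept, so its permutation is trivial and only the outer ones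
    -- survive.
    have h1 := ihf a (ch _) a' (ch _)
    have h2 := ihg (ch _) b (ch _) b'
    rw [bj_self, comp_id] at h1
    rw [bj_self, id_comp] at h2
    exact (congrArg₂ comp h1 h2).trans ((assoc _ _ _).trans (congrArg _ (assoc _ _ _).symm))
  | perm π t hA hB ih =>
    have key : ∀ {α β : Type w} {n n' : ℕ} (a : Fin n ≃ α) (a' : Fin n' ≃ α) (e : α ≃ β),
        (a.trans e).trans (a'.trans e).symm = a.trans a'.symm := by
      intros; ext; simp
    rw [nf_perm, nf_perm, ih _ _ (a'.trans (π.onSet hA).symm) (b'.trans (π.onSet hB).symm), key,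
      key]

/-- Replacing the chosen middle enumeration by `b` inserts `⟨ch B|b⟩` and its inverse, which cancel.
-/
theorem nf_seq {A B C : Finset 𝒩} (t : NTrm 𝒩 U.sig A B) (t' : NTrm 𝒩 U.sig B C) {n m o : ℕ}
    (a : Fin n ≃ A) (b : Fin m ≃ B) (c : Fin o ≃ C) :
    nf ch (seq t t') a c = comp (nf ch t a b) (nf ch t' b c) := by
  have h1 := nf_change ch t a b a (ch B)
  have h2 := nf_change ch t' b c (ch B) c
  rw [bj_self, id_comp] at h1
  rw [bj_self, comp_id] at h2
  rw [h1, h2, assoc, bj_merge_assoc, bj_self, id_comp]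
  rfl

/-- The changes of the inner enumerations add up to permutations of the concatenations, which merge
with the outer permutations. -/
theorem nf_par {A B A' B' C D : Finset 𝒩} (t : NTrm 𝒩 U.sig A B) (t' : NTrm 𝒩 U.sig A' B')
    (hC : IsDisjUnion A A' C) (hD : IsDisjUnion B B' D) {n m n' m' k l : ℕ} (a : Fin n ≃ A)
    (b : Fin m ≃ B) (a' : Fin n' ≃ A') (b' : Fin m' ≃ B') (c : Fin k ≃ C) (d : Fin l ≃ D) :
    nf ch (par t t' hC hD) c d = comp (U.bj (c.trans (hC.append a a').symm))
      (comp (tensor (nf ch t a b) (nf ch t' a' b') rfl rfl)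
        (U.bj ((hD.append b b').trans d.symm))) := by
  rw [nf_change ch t a b (ch A) (ch B), nf_change ch t' a' b' (ch A') (ch B'),
    SMT.interchange _ _ _ _ rfl rfl rfl, SMT.interchange _ _ _ _ rfl rfl rfl, ← bj_finSum,
    ← bj_finSum, ← hC.append_trans_symm, ← hD.append_trans_symm, SMT.assoc, SMT.assoc, bj_merge,
    bj_merge_assoc]
  rfl

theorem nf_par_append {A B A' B' C D : Finset 𝒩} (t : NTrm 𝒩 U.sig A B)
    (t' : NTrm 𝒩 U.sig A' B') (hC : IsDisjUnion A A' C) (hD : IsDisjUnion B B' D)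
    {n m n' m' : ℕ} (a : Fin n ≃ A) (b : Fin m ≃ B) (a' : Fin n' ≃ A') (b' : Fin m' ≃ B') :
    nf ch (par t t' hC hD) (hC.append a a') (hD.append b b') =
      tensor (nf ch t a b) (nf ch t' a' b') rfl rfl := by
  rw [nf_par ch t t' hC hD a b a' b', bj_self, bj_self, id_comp, comp_id]

/-- It suffices to compare two terms for one choice of enumerations. -/
theorem nf_eq_of {A B : Finset 𝒩} {t t' : NTrm 𝒩 U.sig A B} {n' m' : ℕ} (a' : Fin n' ≃ A)
    (b' : Fin m' ≃ B) (h : nf ch t a' b' = nf ch t' a' b') {n m : ℕ} (a : Fin n ≃ A)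
    (b : Fin m ≃ B) : nf ch t a b = nf ch t' a b := by
  rw [nf_change ch t a b a' b', nf_change ch t' a b a' b', h]

/-! ### Nominal terms that denote bijections -/

/-- The term `t` is interpreted by the bijection `e`. -/
def IsRen {A B : Finset 𝒩} (t : NTrm 𝒩 U.sig A B) (e : A ≃ B) : Prop :=
  ∀ (n m : ℕ) (a : Fin n ≃ A) (b : Fin m ≃ B), nf ch t a b = U.bj (a.trans (e.trans b.symm))

theorem isRen_empty (e : (∅ : Finset 𝒩) ≃ (∅ : Finset 𝒩)) : IsRen (U := U) ch .empty e :=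
  fun _ _ _ _ => cls_cast_empty _ _ _

theorem isRen_id (x : 𝒩) (e : ({x} : Finset 𝒩) ≃ ({x} : Finset 𝒩)) :
    IsRen (U := U) ch (.id x) e := fun _ _ _ _ => cls_cast_id _ _ _

theorem isRen_delta (x y : 𝒩) (e : ({x} : Finset 𝒩) ≃ ({y} : Finset 𝒩)) :
    IsRen (U := U) ch (.delta x y) e := fun _ _ _ _ => cls_cast_id _ _ _

theorem isRen_emptyOf {A B : Finset 𝒩} (hA : ∅ = A) (hB : ∅ = B) (e : A ≃ B) :
    IsRen (U := U) ch (emptyOf hA hB) e := by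
  subst hA hB; exact isRen_empty ch e

variable {ch}

theorem IsRen.par {A B A' B' C D : Finset 𝒩} {t : NTrm 𝒩 U.sig A B} {t' : NTrm 𝒩 U.sig A' B'}
    {e : A ≃ B} {e' : A' ≃ B'} (ht : IsRen ch t e) (ht' : IsRen ch t' e')
    (hC : IsDisjUnion A A' C) (hD : IsDisjUnion B B' D) :
    IsRen ch (.par t t' hC hD) (hC.congr hD e e') := by
  intro n m a b
  have h := hD.append_trans_symm ((ch A).trans e) ((ch A').trans e') (ch B) (ch B')
  rw [nf_par ch t t' hC hD (ch A) (ch B) (ch A') (ch B'), ht, ht', ← bj_finSum,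
    ← Equiv.trans_assoc, ← Equiv.trans_assoc, ← h, bj_merge, ← hC.append_trans_congr hD,
    Equiv.trans_assoc, bj_merge]

theorem IsRen.seq {A B C : Finset 𝒩} {t : NTrm 𝒩 U.sig A B} {t' : NTrm 𝒩 U.sig B C}
    {e : A ≃ B} {e' : B ≃ C} (ht : IsRen ch t e) (ht' : IsRen ch t' e') :
    IsRen ch (.seq t t') (e.trans e') := by
  intro n m a b
  rw [nf_seq ch t t' a (ch B) b, ht, ht', ← Equiv.trans_assoc, bj_merge]
  rfl

/-- The normal form of such a term depends on the bijection only; laws between identities and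
renamings reduce to equalities of bijections. -/
theorem IsRen.nf_eq {A B : Finset 𝒩} {t t' : NTrm 𝒩 U.sig A B} {e : A ≃ B} (ht : IsRen ch t e)
    (ht' : IsRen ch t' e) {n m : ℕ} (a : Fin n ≃ A) (b : Fin m ≃ B) :
    nf ch t a b = nf ch t' a b := by rw [ht, ht']

theorem isRen_idn (l : List 𝒩) {A : Finset 𝒩} (h : Enumerates l A) :
    IsRen (U := U) ch (idn l h) (Equiv.refl A) := by
  induction l generalizing A with
  | nil => exact isRen_emptyOf ch _ _ _
  | cons x l ih =>
    have := (isRen_id (U := U) ch x (Equiv.refl _)).par (ih h.tail) (h.isDisjUnion h.tail)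
      (h.isDisjUnion h.tail)
    rwa [IsDisjUnion.congr_refl] at this

/-- Needed for the arrows `ren e`, whose terms list the graph of `e`. By induction on the list: the
head is a single `δ`, and `e` restricts to a bijection between the names of the tail. -/
theorem isRen_deltas (l : List (𝒩 × 𝒩)) {A B : Finset 𝒩} (hA : Enumerates (l.map Prod.fst) A)
    (hB : Enumerates (l.map Prod.snd) B) (e : A ≃ B) (he : ∀ x : A, ((x : 𝒩), (e x : 𝒩)) ∈ l) :
    IsRen (U := U) ch (deltas l hA hB) e := by
  induction l generalizing A B with
  | nil => exact isRen_emptyOf ch _ _ _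
  | cons p l ih =>
    have hdA : IsDisjUnion {p.1} hA.tailSet A := hA.isDisjUnion hA.tail
    have hdB : IsDisjUnion {p.2} hB.tailSet B := hB.isDisjUnion hB.tail
    have hp : p.1 ∉ hA.tailSet := fun h =>
      Finset.disjoint_left.1 hdA.disjoint (Finset.mem_singleton_self _) h
    have hmem : ∀ x : A, (x : 𝒩) ∈ hA.tailSet → ((x : 𝒩), (e x : 𝒩)) ∈ l := by
      intro x hx
      rcases List.mem_cons.1 (he x) with h | h
      · have h1 : (x : 𝒩) = p.1 := congrArg Prod.fst h
        exact absurd (by rwa [h1] at hx) hp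
      · exact h
    -- The name `p.1` does not recur as a first entry of the tail, so its pair is the head.
    have hself : (e ⟨p.1, (hdA.mem_iff _).2 (Or.inl (Finset.mem_singleton_self _))⟩ : 𝒩) = p.2 := by
      rcases List.mem_cons.1 (he ⟨p.1, (hdA.mem_iff _).2 (Or.inl (Finset.mem_singleton_self _))⟩)
        with h | h
      · exact congrArg Prod.snd h
      · exact absurd (show p.1 ∈ l.map Prod.fst from List.mem_map.2 ⟨_, h, rfl⟩) hp
    have hmem' : ∀ x : A, (x : 𝒩) ∈ hA.tailSet → (e x : 𝒩) ∈ hB.tailSet := fun x hx =>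
      List.mem_map.2 ⟨_, hmem x hx, rfl⟩
    let f : hA.tailSet → hB.tailSet := fun x =>
      ⟨e ⟨x, (hdA.mem_iff _).2 (Or.inr x.2)⟩, hmem' _ x.2⟩
    have hf : Function.Bijective f := by
      constructor
      · intro x y hxy
        have := e.injective (Subtype.ext (congrArg (fun z : hB.tailSet => (z : 𝒩)) hxy))
        exact Subtype.ext (congrArg (fun z : A => (z : 𝒩)) this)
      · intro y
        have hy : (y : 𝒩) ∈ B := (hdB.mem_iff _).2 (Or.inr y.2)
        -- If the preimage were `p.1`, then `y` would be `p.2`, which is not in the tail.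
        have hx : ((e.symm ⟨y, hy⟩ : A) : 𝒩) ∈ hA.tailSet := by
          rcases (hdA.mem_iff _).1 (e.symm ⟨y, hy⟩).2 with h | h
          · exfalso
            have h1 : e.symm ⟨y, hy⟩ =
                ⟨p.1, (hdA.mem_iff _).2 (Or.inl (Finset.mem_singleton_self _))⟩ :=
              Subtype.ext (Finset.mem_singleton.1 h)
            rw [← h1, Equiv.apply_symm_apply] at hself
            exact Finset.disjoint_left.1 hdB.disjoint
              (Finset.mem_singleton.2 hself) y.2
          · exact h
        exact ⟨⟨_, hx⟩, Subtype.ext (by simp [f])⟩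
    have := (isRen_delta (U := U) ch p.1 p.2 (Equiv.ofUnique _ _)).par
      (ih hA.tail hB.tail (Equiv.ofBijective f hf) (fun x =>
        hmem ⟨x, (hdA.mem_iff _).2 (Or.inr x.2)⟩ x.2)) hdA hdB
    have hcongr : hdA.congr hdB (Equiv.ofUnique _ _) (Equiv.ofBijective f hf) = e := by
      ext x
      rcases (hdA.mem_iff _).1 x.2 with h | h
      · rw [IsDisjUnion.congr_left hdA hdB _ _ x h]
        obtain rfl : x = ⟨p.1, (hdA.mem_iff _).2 (Or.inl (Finset.mem_singleton_self _))⟩ :=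
          Subtype.ext (Finset.mem_singleton.1 h)
        exact (Finset.mem_singleton.1 (Subtype.prop _)).trans hself.symm
      · rw [IsDisjUnion.congr_right hdA hdB _ _ x h]
        rfl
    rwa [hcongr] at this

end NTrm

/-- The combinatorial content of the rule `delta_left`. The entries of `a'` other than the `i`-th
lie in `A₀` because `a'` is injective. -/
theorem IsDisjUnion.trans_congr_of_left {𝒩 : Type w} {k : ℕ} {A A' A₀ : Finset 𝒩} (a : Fin k ≃ A)
    (a' : Fin k ≃ A') (i : Fin k) (ha : ∀ j, j ≠ i → (a' j : 𝒩) = a j)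
    (hA' : IsDisjUnion {(a' i : 𝒩)} A₀ A') (hA : IsDisjUnion {(a i : 𝒩)} A₀ A) :
    a'.trans (hA'.congr hA (Equiv.ofUnique _ _) (Equiv.refl A₀)) = a := by
  ext j
  by_cases hj : j = i
  · subst hj
    rw [Equiv.trans_apply, IsDisjUnion.congr_left hA' hA _ _ _ (Finset.mem_singleton_self _)]
    exact Finset.mem_singleton.1 (Subtype.prop _)
  · have h1 : (a' j : 𝒩) ∈ A₀ := by
      rcases (hA'.mem_iff _).1 (a' j).2 with h | h
      · exact absurd (a'.injective (Subtype.ext (Finset.mem_singleton.1 h))) hj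
      · exact h
    rw [Equiv.trans_apply, IsDisjUnion.congr_right hA' hA _ _ _ h1]
    exact ha j hj

theorem IsDisjUnion.congr_swap {𝒩 : Type w} {A A' B B' C D : Finset 𝒩} (hC : IsDisjUnion A A' C)
    (hD : IsDisjUnion B B' D) (e : A ≃ B) (e' : A' ≃ B') :
    hC.symm.congr hD.symm e' e = hC.congr hD e e' := by
  ext x
  rcases (hC.mem_iff _).1 x.2 with h | h
  · rw [congr_left hC hD _ _ _ h, congr_right hC.symm hD.symm _ _ _ h]
  · rw [congr_right hC hD _ _ _ h, congr_left hC.symm hD.symm _ _ _ h]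

theorem IsDisjUnion.trans_congr_of_right {𝒩 : Type w} {k : ℕ} {A A' A₀ : Finset 𝒩}
    (a : Fin k ≃ A) (a' : Fin k ≃ A') (i : Fin k) (ha : ∀ j, j ≠ i → (a' j : 𝒩) = a j)
    (hA : IsDisjUnion A₀ {(a i : 𝒩)} A) (hA' : IsDisjUnion A₀ {(a' i : 𝒩)} A') :
    a.trans (hA.congr hA' (Equiv.refl A₀) (Equiv.ofUnique _ _)) = a' := by
  rw [← IsDisjUnion.congr_swap]
  exact trans_congr_of_left a' a i (fun j hj => (ha j hj).symm) hA.symm hA'.symm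

/-! ### Normal forms satisfy the laws of nominal theories -/

namespace NTrm

open SMT

variable {𝒩 : Type w} {U : SMT.{s}} (ch : ∀ A : Finset 𝒩, Fin A.card ≃ A)

/-- Associativity and the unit law involve concatenations whose lengths agree only propositionally,
hence the explicit casts. -/
theorem nf_par_of {A B A' B' C D : Finset 𝒩} (t : NTrm 𝒩 U.sig A B)
    (t' : NTrm 𝒩 U.sig A' B') (hC : IsDisjUnion A A' C) (hD : IsDisjUnion B B' D)
    {n m n' m' k l : ℕ} (a : Fin n ≃ A) (b : Fin m ≃ B) (a' : Fin n' ≃ A') (b' : Fin m' ≃ B')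
    (c : Fin k ≃ C) (d : Fin l ≃ D) (hk : n + n' = k) (hl : m + m' = l)
    (hc : ∀ i : Fin k, (c i : 𝒩) = hC.append a a' (Fin.cast hk.symm i))
    (hd : ∀ i : Fin l, (d i : 𝒩) = hD.append b b' (Fin.cast hl.symm i)) :
    nf ch (par t t' hC hD) c d = tensor (nf ch t a b) (nf ch t' a' b') hk hl := by
  rw [nf_par ch t t' hC hD a b a' b']
  subst hk hl
  have h1 : c = hC.append a a' := by ext i; exact hc i
  have h2 : d = hD.append b b' := by ext i; exact hd i
  rw [h1, h2, bj_self, bj_self, id_comp, comp_id]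

theorem onSet_val (π : FinPerm 𝒩) {A C : Finset 𝒩} (h : π.act A = C) (x : A) :
    (π.onSet h x : 𝒩) = π.1 x := rfl

theorem onSet_symm_val (π : FinPerm 𝒩) {A C : Finset 𝒩} (h : π.act A = C) (x : C) :
    ((π.onSet h).symm x : 𝒩) = π.1.symm x := rfl

theorem nf_ax {A B : Finset 𝒩} {t t' : NTrm 𝒩 U.sig A B} (h : NMTAx 𝒩 U.sig A B t t') {n m : ℕ}
    (a : Fin n ≃ A) (b : Fin m ≃ B) : nf ch t a b = nf ch t' a b := by
  cases h with
  | @seq_assoc _ B C _ t t' t'' =>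
    rw [nf_seq ch _ _ a (ch C) b, nf_seq ch _ _ a (ch B) (ch C), nf_seq ch _ _ a (ch B) b,
      nf_seq ch _ _ (ch B) (ch C) b, assoc]
  | id_seq t l h =>
    rw [nf_seq ch _ _ a a b, isRen_idn l h, Equiv.refl_trans, bj_self, id_comp]
  | seq_id t l h =>
    rw [nf_seq ch _ _ a b b, isRen_idn l h, Equiv.refl_trans, bj_self, comp_id]
  | @par_assoc A₁ B₁ A₂ B₂ A₃ B₃ I J I' J' C D t₁ t₂ t₃ h₁ h₂ h₃ h₄ h₅ h₆ h₇ h₈ =>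
    -- Both bracketings list the three chosen enumerations in the same order, so strict
    -- associativity of the tensor applies.
    refine nf_eq_of ch (h₃.append (h₁.append (ch A₁) (ch A₂)) (ch A₃))
      (h₄.append (h₂.append (ch B₁) (ch B₂)) (ch B₃)) ?_ a b
    rw [nf_par_append, nf_par_append, nf_par_of ch t₁ (par t₂ t₃ h₅ h₆) h₇ h₈ (ch A₁) (ch B₁)
      (h₅.append (ch A₂) (ch A₃)) (h₆.append (ch B₂) (ch B₃)) _ _ (Nat.add_assoc _ _ _).symm
      (Nat.add_assoc _ _ _).symm, nf_par_append]
    · exact SMT.tensor_assoc _ _ _ _ _ _ _ _ _ _ _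
    all_goals
      intro i
      simp only [IsDisjUnion.append_val, Fin.val_cast]
      split_ifs <;> first | rfl | omega | (congr 3; omega)
  | empty_par t hA hB =>
    have e : Fin 0 ≃ (∅ : Finset 𝒩) := Equiv.equivOfIsEmpty _ _
    rw [nf_par_of ch .empty t' hA hB e e a b a b (Nat.zero_add _) (Nat.zero_add _), isRen_empty ch
      (Equiv.refl _), Equiv.refl_trans, bj_self]
    · exact SMT.unit_tensor _
    all_goals
      intro i
      simp [IsDisjUnion.append_val]
  | @par_comm A B A' B' C D t t' hC hD hC' hD' =>
    -- For these enumerations the right-hand side is `t' ⊕ t` between two symmetries; by naturality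
    -- these come together behind `t ⊕ t'` and cancel.
    refine nf_eq_of ch (hC.append (ch A) (ch A')) (hD.append (ch B) (ch B')) ?_ a b
    rw [nf_par_append, nf_par ch t' t hC' hD' (ch A') (ch B') (ch A) (ch B),
      hC.append_symm, hD'.append_symm, bj_rot, bj_rot, ← assoc, ← symm_natural, assoc]
    have := (SMT.toPROP U).symm_symm B.card B'.card
    exact ((SMT.comp_id _).symm).trans (congrArg (comp _) this.symm)
  | @interchange A B C A' B' C' I J K t t' u u' hI hJ hK =>
    refine nf_eq_of ch (hI.append (ch A) (ch A')) (hK.append (ch C) (ch C')) ?_ a b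
    rw [nf_par_append, nf_seq ch t t' _ (ch B), nf_seq ch u u' _ (ch B'),
      nf_seq ch _ _ _ (hJ.append (ch B) (ch B')), nf_par_append, nf_par_append,
      SMT.interchange]
  | perm_one t hA hB =>
    rw [nf_perm]
    congr 1
  | perm_mul π ρ t hA hB hA' hB' hA'' hB'' =>
    rw [nf_perm, nf_perm, nf_perm]
    congr 1
  | perm_empty π h =>
    rw [nf_perm, isRen_empty ch (Equiv.refl _), isRen_empty ch (Equiv.refl _)]
    congr 1; ext i; exact absurd (a i).2 (Finset.notMem_empty _)
  | perm_id π x h =>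
    rw [nf_perm, isRen_id ch x (Equiv.refl _), isRen_id ch (π.1 x) (Equiv.refl _)]
    congr 1; ext i; simp
  | perm_delta π x y hx hy =>
    rw [nf_perm, isRen_delta ch x y (Equiv.ofUnique _ _),
      isRen_delta ch (π.1 x) (π.1 y) (Equiv.ofUnique _ _)]
    congr 1
  | perm_gen π γ a' b' hA hB =>
    rw [nf_perm, nf_gen, nf_gen]
    rfl
  | @perm_par π A B A' B' C D A₁ B₁ A₁' B₁' C₁ D₁ t t' hC hD hC₁ hD₁ hπA hπB hπA' hπB' hπC hπD =>
    -- The image sets are enumerated through `π`, so that undoing `π` returns the chosen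
    -- enumerations.
    refine nf_eq_of ch (hC₁.append ((ch A).trans (π.onSet hπA)) ((ch A').trans (π.onSet hπA')))
      (hD₁.append ((ch B).trans (π.onSet hπB)) ((ch B').trans (π.onSet hπB'))) ?_ a b
    have key : ∀ {A A' C A₁ A₁' C₁ : Finset 𝒩} (hC : IsDisjUnion A A' C)
        (hC₁ : IsDisjUnion A₁ A₁' C₁) (hA : π.act A = A₁) (hA' : π.act A' = A₁')
        (hC' : π.act C = C₁), (hC₁.append ((ch A).trans (π.onSet hA))
          ((ch A').trans (π.onSet hA'))).trans (π.onSet hC').symm = hC.append (ch A) (ch A') := by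
      intro A A' C A₁ A₁' C₁ hC hC₁ hA hA' hC'
      ext i
      rw [Equiv.trans_apply, onSet_symm_val, IsDisjUnion.append_val, IsDisjUnion.append_val]
      split_ifs <;> simp [onSet_val]
    have key' : ∀ {A A₁ : Finset 𝒩} (h : π.act A = A₁),
        ((ch A).trans (π.onSet h)).trans (π.onSet h).symm = ch A := by
      intro A A₁ h; ext; simp
    rw [nf_perm, key hC hC₁, key hD hD₁, nf_par_append, nf_par_append, nf_perm, nf_perm, key',
      key', key', key']
  | @perm_seq π A B C A₁ B₁ C₁ t t' hA hB hC =>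
    rw [nf_perm, nf_seq ch t t' _ (ch B), nf_seq ch _ _ a ((ch B).trans (π.onSet hB)), nf_perm,
      nf_perm]
    congr 2 <;> (ext; simp)
  | delta_self x =>
    exact (isRen_delta ch x x (Equiv.refl _)).nf_eq (isRen_id ch x _) a b
  | delta_delta x y z =>
    exact ((isRen_delta ch x y (Equiv.ofUnique _ _)).seq
      (isRen_delta ch y z (Equiv.ofUnique _ _))).nf_eq (isRen_delta ch x z _) a b
  | @delta_left γ A A' A₀ B a₀ a' b₀ i ha l hl hA' hA =>
    -- The term in front of the generator denotes the bijection that carries `a'` to `a₀`; it turns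
    -- the permutation towards `a₀` into `⟨a|a'⟩`.
    have hr := (isRen_delta (U := U) ch (a' i : 𝒩) (a₀ i : 𝒩) (Equiv.ofUnique _ _)).par
      (isRen_idn l hl) hA' hA
    have e := IsDisjUnion.trans_congr_of_left a₀ a' i ha hA' hA
    rw [nf_seq ch _ _ a (ch A) b, hr, nf_gen, nf_gen, ← Equiv.trans_assoc, bj_merge_assoc]
    congr 2
    ext x
    rw [Equiv.trans_apply, Equiv.trans_apply, Equiv.trans_apply]
    congr 1
    rw [Equiv.symm_apply_eq]
    have := congrArg (fun f => f (a'.symm (a x))) e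
    simpa using this
  | @delta_right γ A B B' B₀ a₀ b₀ b' i hb l hl hB hB' =>
    have hr := (isRen_idn l hl).par
      (isRen_delta (U := U) ch (b₀ i : 𝒩) (b' i : 𝒩) (Equiv.ofUnique _ _)) hB hB'
    have e := IsDisjUnion.trans_congr_of_right b₀ b' i hb hB hB'
    rw [nf_seq ch _ _ a (ch B) b, hr, nf_gen, nf_gen, SMT.assoc, SMT.assoc, bj_merge,
      ← Equiv.trans_assoc, e]

theorem nf_th {R : NTrmEqs 𝒩 U.sig}
    (hR : ∀ {A B : Finset 𝒩} {t t' : NTrm 𝒩 U.sig A B}, R A B t t' → ∀ (n m : ℕ) (a : Fin n ≃ A)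
      (b : Fin m ≃ B), nf ch t a b = nf ch t' a b)
    {A B : Finset 𝒩} {t t' : NTrm 𝒩 U.sig A B} (h : NTh R A B t t') {n m : ℕ} (a : Fin n ≃ A)
    (b : Fin m ≃ B) : nf ch t a b = nf ch t' a b := by
  induction h generalizing n m with
  | ax h => exact hR h _ _ a b
  | refl => rfl
  | symm _ ih => exact (ih a b).symm
  | trans _ _ ih ih' => exact (ih a b).trans (ih' a b)
  | @seq A B C _ _ _ _ _ _ ih ih' =>
    rw [nf_seq ch _ _ a (ch B), nf_seq ch _ _ a (ch B), ih, ih']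
  | par hC hD _ _ ih ih' => rw [nf_par_ch, nf_par_ch, ih, ih']
  | perm π hA hB _ ih => rw [nf_perm, nf_perm, ih]

end NTrm

/-! ### Calculus of symbols in `ORD` and the permutation action -/

namespace NPROP

open SMT Trm

variable {𝒩 : Type w} {P : NPROP.{u} 𝒩}

theorem D_comp {A B C : Finset 𝒩} {n m k : ℕ} (f : P.Hom A B) (g : P.Hom B C) (a : Fin n ≃ A)
    (b : Fin m ≃ B) (c : Fin k ≃ C) : D a (P.comp f g) c = SMT.comp (D a f b) (D b g c) :=
  sound (.comp f g a b c)

theorem D_tensor {A B A' B' C E : Finset 𝒩} {n m n' m' : ℕ} (f : P.Hom A B) (g : P.Hom A' B')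
    (hC : IsDisjUnion A A' C) (hE : IsDisjUnion B B' E) (a : Fin n ≃ A) (b : Fin m ≃ B)
    (a' : Fin n' ≃ A') (b' : Fin m' ≃ B') :
    D (hC.append a a') (P.tensor f g hC hE) (hE.append b b') =
      SMT.tensor (D a f b) (D a' g b') rfl rfl :=
  sound (.tensor f g hC hE a b a' b')

/-- The relation `ren_left` for the trivial renaming `[b|b]` gives `⟨a] id [b⟩ = ⟨a|b⟩ ; ⟨b] id
[b⟩`. -/
theorem D_id {A : Finset 𝒩} {n m : ℕ} (a : Fin n ≃ A) (b : Fin m ≃ A) :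
    D a (P.id A) b = P.ordSMT.bj (a.trans b.symm) := by
  have h : D a (P.comp (P.ren (b.symm.trans b)) (P.id A)) b =
    SMT.comp (P.ordSMT.bj (a.trans b.symm)) (D b (P.id A) b) := sound (.ren_left (P.id A) a b b b)
  have h' : D b (P.id A) b = cls (T := P.ordSMT) (idn m) := sound (.id b)
  rwa [h', SMT.comp_id, Equiv.symm_trans_self, P.ren_refl, P.id_comp] at h

/-- Writing `e` as `[a|e a]` makes the permutation in `ren_left` trivial and shifts `e` into the
enumeration of an identity. -/
theorem D_ren {A B : Finset 𝒩} {n m : ℕ} (a : Fin n ≃ A) (e : A ≃ B) (b : Fin m ≃ B) :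
    D a (P.ren e) b = P.ordSMT.bj (a.trans (e.trans b.symm)) := by
  have h : D a (P.comp (P.ren (a.symm.trans (a.trans e))) (P.id B)) b =
    SMT.comp (P.ordSMT.bj (a.trans a.symm)) (D (a.trans e) (P.id B) b) :=
    sound (.ren_left (P.id B) a a (a.trans e) b)
  rwa [D_id, bj_self, SMT.id_comp, P.comp_id, ← Equiv.trans_assoc, Equiv.symm_trans_self,
    Equiv.refl_trans, Equiv.trans_assoc] at h

/-- The counterpart of `nf_change` in `ORD`: identities inserted at both ends become permutations.
-/
theorem D_change {A B : Finset 𝒩} {n m n' m' : ℕ} (f : P.Hom A B) (a : Fin n ≃ A)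
    (b : Fin m ≃ B) (a' : Fin n' ≃ A) (b' : Fin m' ≃ B) : D a f b =
      SMT.comp (P.ordSMT.bj (a.trans a'.symm))
        (SMT.comp (D a' f b') (P.ordSMT.bj (b'.trans b.symm))) := by
  rw [← D_id, ← D_id, ← D_comp, ← D_comp, P.comp_id, P.id_comp]

theorem D_act {A B A' B' : Finset 𝒩} {n m : ℕ} (π : FinPerm 𝒩) (hA : π.act A = A')
    (hB : π.act B = B') (f : P.Hom A B) (a : Fin n ≃ A') (b : Fin m ≃ B') :
    D a (P.act π hA hB f) b =
      D (a.trans (π.onSet hA).symm) f (b.trans (π.onSet hB).symm) := by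
  have h : D (a.trans (π.onSet hA).symm) f (b.trans (π.onSet hB).symm) = _ :=
    sound (.perm π hA hB f (a.trans (π.onSet hA).symm) (b.trans (π.onSet hB).symm))
  rw [h, Equiv.trans_assoc, Equiv.trans_assoc, Equiv.symm_trans_self, Equiv.symm_trans_self,
    Equiv.trans_refl, Equiv.trans_refl]
  rfl

theorem ren_ren {A B C D : Finset 𝒩} (e : A ≃ B) (e' : B ≃ C) (f : P.Hom C D) :
    P.comp (P.ren e) (P.comp (P.ren e') f) = P.comp (P.ren (e.trans e')) f := by
  rw [P.ren_trans, P.assoc]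

theorem ren_of_eq_refl {A : Finset 𝒩} (e : A ≃ A) (h : e = Equiv.refl A) : P.ren e = P.id A := by
  rw [h, P.ren_refl]

/-- This and the laws `act_comp`, `act_tensor`, `act_act` mirror the rules for formal permutations;
they drive the induction in `cls_perm`. -/
theorem act_ren (π : FinPerm 𝒩) {A B A' B' : Finset 𝒩} (hA : π.act A = A') (hB : π.act B = B')
    (e : A ≃ B) :
    P.act π hA hB (P.ren e) = P.ren ((π.onSet hA).symm.trans (e.trans (π.onSet hB))) := by
  rw [act, P.ren_trans, P.ren_trans]

theorem act_comp (π : FinPerm 𝒩) {A B C A' B' C' : Finset 𝒩} (hA : π.act A = A')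
    (hB : π.act B = B') (hC : π.act C = C') (f : P.Hom A B) (g : P.Hom B C) :
    P.act π hA hC (P.comp f g) = P.comp (P.act π hA hB f) (P.act π hB hC g) := by
  simp only [act, P.assoc]
  rw [ren_ren, ren_of_eq_refl _ (Equiv.self_trans_symm _), P.id_comp]

theorem act_tensor (π : FinPerm 𝒩) {A B A' B' C E A₁ B₁ A₁' B₁' C₁ E₁ : Finset 𝒩}
    (f : P.Hom A B) (g : P.Hom A' B') (hC : IsDisjUnion A A' C) (hE : IsDisjUnion B B' E)
    (hC₁ : IsDisjUnion A₁ A₁' C₁) (hE₁ : IsDisjUnion B₁ B₁' E₁) (hA : π.act A = A₁)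
    (hB : π.act B = B₁) (hA' : π.act A' = A₁') (hB' : π.act B' = B₁') (hπC : π.act C = C₁)
    (hπE : π.act E = E₁) :
    P.act π hπC hπE (P.tensor f g hC hE) =
      P.tensor (P.act π hA hB f) (P.act π hA' hB' g) hC₁ hE₁ := by
  rw [act, act, act, P.interchange _ _ _ _ hC₁ hC hE₁, P.interchange _ _ _ _ hC hE hE₁,
    ← P.ren_tensor, ← P.ren_tensor]
  congr 2
  · ext x
    rcases (hC₁.mem_iff _).1 x.2 with h | h
    · rw [IsDisjUnion.congr_left _ _ _ _ _ h]; rfl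
    · rw [IsDisjUnion.congr_right _ _ _ _ _ h]; rfl
  · congr 1
    ext x
    rcases (hE.mem_iff _).1 x.2 with h | h
    · rw [IsDisjUnion.congr_left _ _ _ _ _ h]; rfl
    · rw [IsDisjUnion.congr_right _ _ _ _ _ h]; rfl

theorem act_act (π ρ : FinPerm 𝒩) {A B A' B' A'' B'' : Finset 𝒩} (f : P.Hom A B)
    (hA : ρ.act A = A') (hB : ρ.act B = B') (hA' : π.act A' = A'') (hB' : π.act B' = B'')
    (hA'' : (π * ρ).act A = A'') (hB'' : (π * ρ).act B = B'') :
    P.act π hA' hB' (P.act ρ hA hB f) = P.act (π * ρ) hA'' hB'' f := by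
  have h : ∀ {A A' A'' : Finset 𝒩} (hA : ρ.act A = A') (hA' : π.act A' = A'')
      (hA'' : (π * ρ).act A = A''),
      (π * ρ).onSet hA'' = (ρ.onSet hA).trans (π.onSet hA') := fun _ _ _ => rfl
  rw [act, act, act, h hA hA', h hB hB', P.ren_trans, ← P.assoc, ← P.assoc, ← P.assoc, ← P.assoc,
    ← P.ren_trans, P.assoc, P.assoc, P.assoc]
  rfl

end NPROP

/-! ### Connecting enumerations by changes of single entries -/

section enum

variable {𝒩 : Type w} [Infinite 𝒩]

/-- Supplies the names on the interfaces of a generator when it is read as a symbol of `ORD`. -/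
theorem exists_enum (k : ℕ) : ∃ A : Finset 𝒩, Nonempty (Fin k ≃ A) := by
  obtain ⟨A, hA⟩ := Infinite.exists_subset_card_eq 𝒩 k
  exact ⟨A, ⟨(A.equivFinOfCardEq hA).symm⟩⟩

theorem exists_enum_of_injective {𝒩 : Type w} {k : ℕ} (f : Fin k → 𝒩) (hf : f.Injective) :
    ∃ (A : Finset 𝒩) (a : Fin k ≃ A), ∀ i, (a i : 𝒩) = f i := by
  classical
  refine ⟨Finset.univ.image f, Equiv.ofBijective
    (fun i => ⟨f i, Finset.mem_image_of_mem f (Finset.mem_univ i)⟩) ⟨fun i j h => ?_, fun y => ?_⟩,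
    fun i => rfl⟩
  · exact hf (congrArg Subtype.val h)
  · obtain ⟨i, _, hi⟩ := Finset.mem_image.1 y.2
    exact ⟨i, Subtype.ext hi⟩

/-- Any two enumerations of the same length are connected by changes of single entries. -/
theorem enum_connected {k : ℕ} (R : ∀ {A A' : Finset 𝒩}, (Fin k ≃ A) → (Fin k ≃ A') → Prop)
    (refl : ∀ {A : Finset 𝒩} (a : Fin k ≃ A), R a a)
    (symm : ∀ {A A' : Finset 𝒩} (a : Fin k ≃ A) (a' : Fin k ≃ A'), R a a' → R a' a)
    (trans : ∀ {A A' A'' : Finset 𝒩} (a : Fin k ≃ A) (a' : Fin k ≃ A') (a'' : Fin k ≃ A''),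
      R a a' → R a' a'' → R a a'')
    (step : ∀ {A A' : Finset 𝒩} (a : Fin k ≃ A) (a' : Fin k ≃ A') (i : Fin k),
      (∀ j, j ≠ i → (a' j : 𝒩) = a j) → R a' a)
    {A A' : Finset 𝒩} (a : Fin k ≃ A) (a' : Fin k ≃ A') : R a a' := by
  classical
  have eq : ∀ {A A' : Finset 𝒩} (a : Fin k ≃ A) (a' : Fin k ≃ A'),
      (∀ i, (a' i : 𝒩) = a i) → R a' a := by
    intro A A' a a' h
    obtain rfl : A = A' := by
      ext x
      constructor
      · intro hx
        have := (a' (a.symm ⟨x, hx⟩)).2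
        rwa [h, Equiv.apply_symm_apply] at this
      · intro hx
        have := (a (a'.symm ⟨x, hx⟩)).2
        rwa [← h, Equiv.apply_symm_apply] at this
    obtain rfl : a = a' := by ext i; exact (h i).symm
    exact refl a
  have disj : ∀ {A A' : Finset 𝒩} (a : Fin k ≃ A) (a' : Fin k ≃ A'), Disjoint A A' →
      R a' a := by
    intro A A' a a' hd
    have hne : ∀ i j, (a i : 𝒩) ≠ a' j := fun i j h =>
      Finset.disjoint_left.1 hd (a i).2 (h ▸ (a' j).2)
    -- Here `c` is `a` with the entries in `s` already replaced by those of `a'`; disjointness keeps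
    -- the mixed list free of repetitions.
    have key : ∀ (s : Finset (Fin k)) {C : Finset 𝒩} (c : Fin k ≃ C),
        (∀ i, (c i : 𝒩) = if i ∈ s then (a' i : 𝒩) else a i) → R c a := by
      intro s
      induction s using Finset.induction_on with
      | empty => intro C c hc; exact eq a c (by simpa using hc)
      | insert j s hj ih =>
        intro C c hc
        obtain ⟨C₁, c₁, hc₁⟩ := exists_enum_of_injective
          (fun i => if i ∈ s then (a' i : 𝒩) else a i) (by
            intro x y hxy
            have h1 := hne x y
            have h2 := hne y x
            simp only at hxy
            split_ifs at hxy
            · exact a'.injective (Subtype.ext hxy)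
            · exact absurd hxy.symm h2
            · exact absurd hxy h1
            · exact a.injective (Subtype.ext hxy))
        refine trans c c₁ a (step c₁ c j fun i hi => ?_) (ih c₁ hc₁)
        rw [hc, hc₁]
        simp [hi]
    exact key Finset.univ a' (by simp)
  -- Replacing entries of `a` by entries of `a'` directly could repeat a name, so the path goes
  -- through `k` names outside both sets.
  obtain ⟨B, hB, hB'⟩ := (Set.Finite.infinite_compl
    (A ∪ A' : Finset 𝒩).finite_toSet).exists_subset_card_eq k
  have b := (B.equivFinOfCardEq hB').symm
  have hd : ∀ x ∈ B, x ∉ A ∧ x ∉ A' := by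
    intro x hx
    have := hB hx
    simpa using this
  refine trans a b a' (symm b a (disj a b ?_)) (disj a' b ?_)
  · exact Finset.disjoint_right.2 fun x hx => (hd x hx).1
  · exact Finset.disjoint_right.2 fun x hx => (hd x hx).2

end enum

/-! ### Renamings and permutations in the presented nominal PROP -/

namespace NMT

open NTrm

variable {𝒩 : Type w} {T : NMT.{w, s} 𝒩}

theorem cls_idn_eq_ren {A : Finset 𝒩} (l : List 𝒩) (h : Enumerates l A) :
    cls (T := T) (idn l h) = ren (Equiv.refl A) :=
  (idn_eq l _ h (enumerates_toList A)).trans (T.toNPROP.ren_refl A).symm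

theorem cls_delta_eq_ren (x y : 𝒩) (e : ({x} : Finset 𝒩) ≃ ({y} : Finset 𝒩)) :
    cls (T := T) (delta x y) = ren e := by
  have hx : Enumerates ([(x, y)].map Prod.fst) {x} := ⟨by simp, by simp⟩
  have hy : Enumerates ([(x, y)].map Prod.snd) {y} := ⟨by simp, by simp⟩
  rw [ren_eq e [(x, y)] (by simp) _ hx hy, cd_cons (x, y) [] hx hy (A' := ∅) (B' := ∅)
    ⟨by simp, by simp⟩ ⟨by simp, by simp⟩, cd_nil,
    tensor_comm (hC' := (Enumerates.isDisjUnion hx ⟨by simp, by simp⟩).symm)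
      (hD' := (Enumerates.isDisjUnion hy ⟨by simp, by simp⟩).symm), unit_tensor]
  rintro ⟨p, q⟩
  constructor
  · intro h
    obtain ⟨rfl, rfl⟩ : p = x ∧ q = y := by simpa using h
    exact ⟨⟨p, by simp⟩, by simpa using (Finset.mem_singleton.1 (e ⟨p, by simp⟩).2).symm⟩
  · rintro ⟨z, hz⟩
    rw [hz, Finset.mem_singleton.1 z.2, Finset.mem_singleton.1 (e z).2]
    simp

theorem cls_id_eq_ren (x : 𝒩) (e : ({x} : Finset 𝒩) ≃ ({x} : Finset 𝒩)) :
    cls (T := T) (id x) = ren e :=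
  (cls_ax (.delta_self x)).symm.trans (cls_delta_eq_ren x x e)

theorem cls_empty_eq_ren (e : (∅ : Finset 𝒩) ≃ (∅ : Finset 𝒩)) :
    cls (T := T) .empty = ren e := by
  rw [Subsingleton.elim e (Equiv.refl _)]
  exact cls_idn_eq_ren [] ⟨by simp, by simp⟩

theorem ren_comp_of_eq_refl {A B : Finset 𝒩} (e : A ≃ A) (he : e = Equiv.refl A) (f : T.Arr A B) :
    comp (ren e) f = f := by
  subst he
  have h := T.toNPROP.ren_refl A
  change ren (Equiv.refl A) = _ at h
  rw [h]
  exact id_comp f _ _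

theorem comp_ren_of_eq_refl {A B : Finset 𝒩} (e : B ≃ B) (he : e = Equiv.refl B) (f : T.Arr A B) :
    comp f (ren e) = f := by
  subst he
  have h := T.toNPROP.ren_refl B
  change ren (Equiv.refl B) = _ at h
  rw [h]
  exact comp_id f _ _

theorem ren_trans {A B C : Finset 𝒩} (e : A ≃ B) (e' : B ≃ C) :
    ren (T := T) (e.trans e') = comp (ren e) (ren e') := T.toNPROP.ren_trans e e'

theorem isDisjUnion_erase [DecidableEq 𝒩] {A : Finset 𝒩} {x : 𝒩} (hx : x ∈ A) :
    IsDisjUnion {x} (A.erase x) A :=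
  ⟨by simp, fun y => by by_cases h : y = x <;> simp [h, hx]⟩

/-- Provides the set `A₀` of unchanged names for `delta_left` and `delta_right`. -/
theorem isDisjUnion_erase_of_update [DecidableEq 𝒩] {k : ℕ} {A A' : Finset 𝒩} (a : Fin k ≃ A)
    (a' : Fin k ≃ A') (i : Fin k) (h : ∀ j, j ≠ i → (a' j : 𝒩) = a j) :
    IsDisjUnion {(a' i : 𝒩)} (A.erase (a i)) A' := by
  constructor
  · rw [Finset.disjoint_singleton_left, Finset.mem_erase]
    rintro ⟨h1, h2⟩
    obtain ⟨j, hj⟩ := a.surjective ⟨a' i, h2⟩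
    have hji : j ≠ i := by rintro rfl; exact h1 (by rw [hj])
    have := h j hji
    rw [hj] at this
    exact hji (a'.injective (Subtype.ext this))
  · intro x
    rw [Finset.mem_singleton, Finset.mem_erase]
    constructor
    · intro hx
      obtain ⟨j, hj⟩ := a'.surjective ⟨x, hx⟩
      have hj' : (a' j : 𝒩) = x := by rw [hj]
      by_cases hji : j = i
      · left; rw [← hj', hji]
      · right
        rw [← hj', h j hji]
        exact ⟨fun h' => hji (a.injective (Subtype.ext h')), (a j).2⟩
    · rintro (rfl | ⟨h1, h2⟩)
      · exact (a' i).2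
      · obtain ⟨j, hj⟩ := a.surjective ⟨x, h2⟩
        have hj' : (a j : 𝒩) = x := by rw [hj]
        have hji : j ≠ i := by rintro rfl; exact h1 hj'.symm
        rw [← hj', ← h j hji]
        exact (a' j).2

/-- The rule `delta_left` is the case of a single changed entry. Renamings compose and invert, so
the claim is an equivalence relation between enumerations, and `enum_connected` gives the general
case. -/
theorem ren_comp_gen [Infinite 𝒩] (γ : T.sig.Gen) {A A' B : Finset 𝒩} (a : Fin (T.sig.ar γ) ≃ A)
    (a' : Fin (T.sig.ar γ) ≃ A') (b : Fin (T.sig.coar γ) ≃ B) :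
    comp (ren (a.symm.trans a')) (cls (gen γ a' b)) = cls (T := T) (gen γ a b) := by
  classical
  refine enum_connected (R := fun a a' => comp (ren (a.symm.trans a')) (cls (gen γ a' b)) =
    cls (T := T) (gen γ a b)) ?_ ?_ ?_ ?_ a a'
  · intro A a
    exact ren_comp_of_eq_refl _ (Equiv.symm_trans_self a) _
  · intro A A' a a' h
    rw [← h, ← assoc, ← ren_trans]
    exact ren_comp_of_eq_refl _ (by ext; simp) _
  · intro A A' A'' a a' a'' h h'
    rw [← h, ← h', ← assoc, ← ren_trans]
    refine congrArg (fun e => comp (ren e) _) ?_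
    ext; simp
  · intro A A' a a' i h
    have hA := isDisjUnion_erase (a i).2
    have hA' := isDisjUnion_erase_of_update a a' i h
    rw [← cls_ax (.delta_left γ a a' b i h _ (enumerates_toList _) hA' hA)]
    change _ = comp (tensor (cls _) (cls _) _ _) (cls (gen γ a b))
    refine congrArg (fun f => comp f _) ?_
    -- With both factors read as renamings, `δ ⊎ id` is the single renaming that carries `a'` to
    -- `a`.
    rw [cls_delta_eq_ren _ _ (Equiv.ofUnique _ _), cls_idn_eq_ren]
    refine Eq.trans ?_ (T.toNPROP.ren_tensor _ _ _ _)
    refine congrArg ren ?_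
    have := IsDisjUnion.trans_congr_of_left a a' i h hA' hA
    exact (congrArg (Equiv.trans a'.symm) this.symm).trans
      (by rw [← Equiv.trans_assoc, Equiv.symm_trans_self, Equiv.refl_trans])

theorem gen_comp_ren [Infinite 𝒩] (γ : T.sig.Gen) {A B B' : Finset 𝒩} (a : Fin (T.sig.ar γ) ≃ A)
    (b : Fin (T.sig.coar γ) ≃ B) (b' : Fin (T.sig.coar γ) ≃ B') :
    comp (cls (gen γ a b')) (ren (b'.symm.trans b)) = cls (T := T) (gen γ a b) := by
  classical
  refine enum_connected (R := fun b b' => comp (cls (gen γ a b')) (ren (b'.symm.trans b)) =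
    cls (T := T) (gen γ a b)) ?_ ?_ ?_ ?_ b b'
  · intro B b
    exact comp_ren_of_eq_refl _ (Equiv.symm_trans_self b) _
  · intro B B' b b' h
    rw [← h, assoc, ← ren_trans]
    exact comp_ren_of_eq_refl _ (by ext; simp) _
  · intro B B' B'' b b' b'' h h'
    rw [← h, ← h', assoc, ← ren_trans]
    refine congrArg (fun e => comp _ (ren e)) ?_
    ext; simp
  · intro B B' b b' i h
    have hB := (isDisjUnion_erase (b i).2).symm
    have hB' := (isDisjUnion_erase_of_update b b' i h).symm
    rw [← cls_ax (.delta_right γ a b b' i h _ (enumerates_toList _) hB hB')]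
    change _ = comp (cls (gen γ a b)) (tensor (cls _) (cls _) _ _)
    refine congrArg (comp _) ?_
    rw [cls_delta_eq_ren _ _ (Equiv.ofUnique _ _), cls_idn_eq_ren]
    refine Eq.trans ?_ (T.toNPROP.ren_tensor _ _ _ _)
    refine congrArg ren ?_
    have := IsDisjUnion.trans_congr_of_right b b' i h hB hB'
    exact (congrArg (Equiv.trans b.symm) this.symm).trans
      (by rw [← Equiv.trans_assoc, Equiv.symm_trans_self, Equiv.refl_trans])

/-- Formal permutations of terms agree with the permutation action of the nominal PROP. -/
theorem cls_perm [Infinite 𝒩] (π : FinPerm 𝒩) {A B A' B' : Finset 𝒩} (t : NTrm 𝒩 T.sig A B)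
    (hA : π.act A = A') (hB : π.act B = B') :
    cls (T := T) (perm π t hA hB) = T.toNPROP.act π hA hB (cls t) := by
  induction t generalizing π A' B' with
  | gen γ a b =>
    -- The relabelled generator is the original one between the renamings `π_A⁻¹` and `π_B`.
    rw [cls_ax (.perm_gen π γ a b hA hB), ← ren_comp_gen γ _ a, ← gen_comp_ren γ a _ b]
    have h1 : (a.trans (π.onSet hA)).symm.trans a = (π.onSet hA).symm := by ext; simp
    have h2 : b.symm.trans (b.trans (π.onSet hB)) = π.onSet hB := by ext; simp
    rw [h1, h2]
    rfl
  | empty =>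
    obtain rfl : ∅ = A' := by rw [← hA]; rfl
    obtain rfl : ∅ = B' := by rw [← hB]; rfl
    rw [cls_ax (.perm_empty π hA), cls_empty_eq_ren (Equiv.refl _)]
    -- Both sides become renamings between sets with at most one name, where bijections are unique;
    -- the same works for `id` and `delta`.
    refine Eq.trans ?_ (T.toNPROP.act_ren π hA hB _).symm
    exact congrArg ren (Subsingleton.elim _ _)
  | id x =>
    obtain rfl : {π.1 x} = A' := by rw [← hA]; simp [FinPerm.act]
    obtain rfl : {π.1 x} = B' := by rw [← hB]; simp [FinPerm.act]
    rw [cls_ax (.perm_id π x hA), cls_id_eq_ren x (Equiv.refl _),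
      cls_id_eq_ren (π.1 x) (Equiv.refl _)]
    refine Eq.trans ?_ (T.toNPROP.act_ren π hA hB _).symm
    exact congrArg ren (Subsingleton.elim _ _)
  | delta x y =>
    obtain rfl : {π.1 x} = A' := by rw [← hA]; simp [FinPerm.act]
    obtain rfl : {π.1 y} = B' := by rw [← hB]; simp [FinPerm.act]
    rw [cls_ax (.perm_delta π x y hA hB), cls_delta_eq_ren x y (Equiv.ofUnique _ _),
      cls_delta_eq_ren (π.1 x) (π.1 y) (Equiv.ofUnique _ _)]
    refine Eq.trans ?_ (T.toNPROP.act_ren π hA hB _).symm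
    exact congrArg ren (Subsingleton.elim _ _)
  | par t t' hC hD ih ih' =>
    have key : ∀ {A A' C C₁ : Finset 𝒩}, IsDisjUnion A A' C → π.act C = C₁ →
        IsDisjUnion (π.act A) (π.act A') C₁ := by
      rintro A A' C C₁ h rfl
      exact ⟨(Finset.disjoint_map _).2 h.disjoint, fun x => by
        simp only [FinPerm.act, Finset.mem_map_equiv, h.mem_iff]⟩
    rw [cls_ax (.perm_par π t t' hC hD (key hC hA) (key hD hB) rfl rfl rfl rfl hA hB)]
    change tensor (cls _) (cls _) _ _ = _
    rw [ih, ih']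
    exact (NPROP.act_tensor (P := T.toNPROP) π (cls t) (cls t') hC hD _ _ rfl rfl rfl rfl hA hB).symm
  | seq t t' ih ih' =>
    rw [cls_ax (.perm_seq π t t' hA rfl hB)]
    change comp (cls _) (cls _) = _
    rw [ih, ih']
    exact (NPROP.act_comp (P := T.toNPROP) π hA rfl hB (cls t) (cls t')).symm
  | perm ρ t hA' hB' ih =>
    have key : ∀ {A A' A'' : Finset 𝒩}, ρ.act A = A' → π.act A' = A'' → (π * ρ).act A = A'' := by
      rintro A _ _ rfl rfl
      simp only [FinPerm.act, Finset.map_map]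
      rfl
    rw [← cls_ax (.perm_mul π ρ t hA' hB' hA hB (key hA' hA) (key hB' hB)), ih, ih]
    exact (NPROP.act_act (P := T.toNPROP) π ρ (cls t) hA' hB' hA hB _ _).symm

end NMT

theorem NTrm.nf_gen_self {𝒩 : Type w} {U : SMT.{s}} (ch : ∀ A : Finset 𝒩, Fin A.card ≃ A)
    {A B : Finset 𝒩} (γ : U.sig.Gen) (a : Fin (U.sig.ar γ) ≃ A) (b : Fin (U.sig.coar γ) ≃ B) :
    nf ch (gen γ a b) a b = SMT.cls (.gen γ) := by
  rw [nf_gen, SMT.bj_self, SMT.bj_self, SMT.id_comp, SMT.comp_id]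

/-! ### The two interpretations and the isomorphism -/

namespace NMT

open SMT Trm

variable {𝒩 : Type w} (T : NMT.{w, s} 𝒩) (ch : ∀ A : Finset 𝒩, Fin A.card ≃ A)

/-- The equations of the theory are axioms of its translation by construction; the structural laws
are `nf_ax`. -/
theorem nf_sound {A B : Finset 𝒩} {t t' : NTrm 𝒩 T.sig A B} (h : T.Eqv A B t t') {n m : ℕ}
    (a : Fin n ≃ A) (b : Fin m ≃ B) :
    NTrm.nf (U := T.toSMT ch) ch t a b = NTrm.nf (U := T.toSMT ch) ch t' a b := by
  refine NTrm.nf_th (U := T.toSMT ch) ch ?_ h a b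
  rintro A B t t' (h | h) n m a b
  · exact Quotient.sound (Th.ax (Or.inl (SmtEq.mk h a b)))
  · exact NTrm.nf_ax ch h a b

/-- The arrow `⟨a] f [b⟩` of the PROP presented by the translated theory. -/
noncomputable def toSMTArr {A B : Finset 𝒩} (f : T.Arr A B) {n m : ℕ} (a : Fin n ≃ A)
    (b : Fin m ≃ B) : (T.toSMT ch).Arr n m :=
  Quotient.lift (fun t => NTrm.nf (U := T.toSMT ch) ch t a b)
    (fun _ _ h => T.nf_sound ch h a b) f

/-- The interpretation of the generators of `ORD(nProp T)` in `Prop(Smt T)`. -/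
noncomputable def ordGen (γ : T.toNPROP.ordSMT.sig.Gen) :
    (T.toSMT ch).Arr (T.toNPROP.ordSMT.sig.ar γ) (T.toNPROP.ordSMT.sig.coar γ) :=
  T.toSMTArr ch (Dia.f γ) (Dia.a γ) (Dia.b γ)

theorem eval_ordGen_dia {A B : Finset 𝒩} (t : NTrm 𝒩 T.sig A B) {n m : ℕ} (a : Fin n ≃ A)
    (b : Fin m ≃ B) : eval (T.ordGen ch) (NPROP.dia (T := T.toNPROP) a (cls t) b) =
      NTrm.nf (U := T.toSMT ch) ch t a b := rfl

theorem toSMTArr_ren {A B : Finset 𝒩} (e : A ≃ B) {n m : ℕ} (a : Fin n ≃ A) (b : Fin m ≃ B) :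
    eval (T.ordGen ch) (NPROP.dia (T := T.toNPROP) a (T.toNPROP.ren e) b) =
      (T.toSMT ch).bj (a.trans (e.trans b.symm)) :=
  (T.eval_ordGen_dia ch _ a b).trans (NTrm.isRen_deltas (U := T.toSMT ch) _ _ _ e
    (fun x => (mem_graph e _).2 ⟨x, rfl⟩) n m a b)

theorem eval_ordGen_comp {A B C : Finset 𝒩} (f : T.toNPROP.Hom A B) (g : T.toNPROP.Hom B C)
    {n m k : ℕ} (a : Fin n ≃ A) (b : Fin m ≃ B) (c : Fin k ≃ C) :
    eval (T.ordGen ch) (NPROP.dia (T := T.toNPROP) a (T.toNPROP.comp f g) c) =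
      SMT.comp (eval (T.ordGen ch) (NPROP.dia a f b)) (eval (T.ordGen ch) (NPROP.dia b g c)) := by
  obtain ⟨t, rfl⟩ := exists_cls f
  obtain ⟨t', rfl⟩ := exists_cls g
  exact NTrm.nf_seq (U := T.toSMT ch) ch t t' a b c

theorem eval_ordGen {m n : ℕ} {t t' : Trm T.toNPROP.ordSig m n} (h : T.toNPROP.OrdEq m n t t') :
    eval (T.ordGen ch) t = eval (T.ordGen ch) t' := by
  have change : ∀ {A B : Finset 𝒩} (f : T.toNPROP.Hom A B) {n m n' m' : ℕ} (a : Fin n ≃ A)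
      (b : Fin m ≃ B) (a' : Fin n' ≃ A) (b' : Fin m' ≃ B), eval (T.ordGen ch) (NPROP.dia a f b) =
        SMT.comp ((T.toSMT ch).bj (a.trans a'.symm)) (SMT.comp
          (eval (T.ordGen ch) (NPROP.dia a' f b')) ((T.toSMT ch).bj (b'.trans b.symm))) := by
    intro A B f n m n' m' a b a' b'
    obtain ⟨t, rfl⟩ := exists_cls f
    exact NTrm.nf_change (U := T.toSMT ch) ch t a b a' b'
  cases h with
  | comp f g a b c => exact T.eval_ordGen_comp ch f g a b c
  | tensor f g hC hD a b a' b' =>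
    obtain ⟨t, rfl⟩ := exists_cls f
    obtain ⟨t', rfl⟩ := exists_cls g
    exact NTrm.nf_par_append (U := T.toSMT ch) ch t t' hC hD a b a' b'
  | id a =>
    rw [← T.toNPROP.ren_refl, toSMTArr_ren, Equiv.refl_trans, bj_self, eval_idn]
  | ren_left f a a' b c =>
    rw [T.eval_ordGen_comp ch _ f a b c, toSMTArr_ren, Equiv.trans_assoc, Equiv.self_trans_symm,
      Equiv.trans_refl]
    exact congrArg (fun x => SMT.comp x _) (eval_bij _ _).symm
  | ren_right f a b c c' =>
    rw [T.eval_ordGen_comp ch f _ a b c', toSMTArr_ren, Equiv.trans_assoc, ← Equiv.trans_assoc b,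
      Equiv.self_trans_symm, Equiv.refl_trans]
    exact congrArg (SMT.comp _) (eval_bij _ _).symm
  | perm π hA hB f a b =>
    rw [NPROP.act, T.eval_ordGen_comp ch _ _ _ a _, T.eval_ordGen_comp ch _ _ _ b _,
      toSMTArr_ren, toSMTArr_ren]
    -- The enumerations are transported together with the arrow, so the two conjugating bijections
    -- are wired as identities.
    have h1 : (a.trans (π.onSet hA)).trans ((π.onSet hA).symm.trans a.symm) = Equiv.refl _ := by
      ext; simp
    have h2 : b.trans ((π.onSet hB).trans (b.trans (π.onSet hB)).symm) = Equiv.refl _ := by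
      ext; simp
    rw [h1, h2, bj_refl, bj_refl, SMT.id_comp, SMT.comp_id]

variable [Infinite 𝒩]

/-- The interpretation of the generators of `Smt T` in `ORD(nProp T)`. -/
noncomputable def smtGen (γ : (T.toSMT ch).sig.Gen) :
    T.toNPROP.ordSMT.Arr ((T.toSMT ch).sig.ar γ) ((T.toSMT ch).sig.coar γ) :=
  NPROP.D (T := T.toNPROP) (exists_enum (𝒩 := 𝒩) _).choose_spec.some
    (cls (T := T) (.gen γ (exists_enum (𝒩 := 𝒩) _).choose_spec.some
      (exists_enum (𝒩 := 𝒩) _).choose_spec.some)) (exists_enum (𝒩 := 𝒩) _).choose_spec.some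

/-- This makes the arbitrary enumerations in `smtGen` harmless. The generator on `a`, `b` is the one
on `a'`, `b'` between renamings, and a renaming read along corresponding enumerations is an
identity. -/
theorem D_gen (γ : T.sig.Gen) {A B A' B' : Finset 𝒩} (a : Fin (T.sig.ar γ) ≃ A)
    (b : Fin (T.sig.coar γ) ≃ B) (a' : Fin (T.sig.ar γ) ≃ A') (b' : Fin (T.sig.coar γ) ≃ B') :
    NPROP.D (T := T.toNPROP) a (cls (T := T) (.gen γ a b)) b =
      NPROP.D (T := T.toNPROP) a' (cls (T := T) (.gen γ a' b')) b' := by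
  rw [← ren_comp_gen γ a a' b, ← gen_comp_ren γ a' b b']
  refine (NPROP.D_comp (P := T.toNPROP) (ren (a.symm.trans a'))
    (comp (cls (.gen γ a' b')) (ren (b'.symm.trans b))) a a' b).trans ?_
  refine (congrArg (SMT.comp _) (NPROP.D_comp (P := T.toNPROP) (cls (.gen γ a' b'))
    (ren (b'.symm.trans b)) a' b' b)).trans ?_
  have h1 := NPROP.D_ren (P := T.toNPROP) a (a.symm.trans a') a'
  have h2 := NPROP.D_ren (P := T.toNPROP) b' (b'.symm.trans b) b
  rw [show a.trans ((a.symm.trans a').trans a'.symm) = Equiv.refl _ by ext; simp, bj_refl] at h1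
  rw [show b'.trans ((b'.symm.trans b).trans b.symm) = Equiv.refl _ by ext; simp, bj_refl] at h2
  refine (congrArg₂ SMT.comp h1 (congrArg (SMT.comp _) h2)).trans ?_
  rw [SMT.id_comp, SMT.comp_id]

/-- The normal form is built from `t` by the very relations of `ORD`, so reading it back gives the
symbol of `t`. Both the validity of the translated equations and one of the inverse laws follow. -/
theorem eval_smtGen_nfSmt {A B : Finset 𝒩} (t : NTrm 𝒩 T.sig A B) {n m : ℕ} (a : Fin n ≃ A)
    (b : Fin m ≃ B) : eval (T.smtGen ch) (t.nfSmt ch a b) =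
      NPROP.D (T := T.toNPROP) a (cls (T := T) t) b := by
  -- Equalities of wiring terms need no equations of the theory; proving them over the theory
  -- without equations lets `eval_th` carry them into `ORD`.
  have ren : ∀ {A B : Finset 𝒩} (f : T.Arr A B) (e : A ≃ B) (hf : f = ren e) {n m : ℕ}
      (a : Fin n ≃ A) (b : Fin m ≃ B) (t : Trm T.sig n m)
      (ht : SMT.cls (T := ⟨T.sig, fun _ _ _ _ => False⟩) t = SMT.cls (bij (a.trans (e.trans b.symm)))),
      eval (T.smtGen ch) t = NPROP.D (T := T.toNPROP) a f b := by
    rintro A B _ e rfl n m a b t ht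
    refine Eq.trans ?_ (NPROP.D_ren (P := T.toNPROP) a e b).symm
    refine Eq.trans ?_ (eval_bij (T.smtGen ch) _)
    exact eval_th (T.smtGen ch) (fun h => h.elim False.elim (eval_ax _)) 
      ((SMT.cls_eq (T := ⟨T.sig, fun _ _ _ _ => False⟩)).1 ht)
  induction t generalizing n m with
  | gen γ a' b' =>
    -- The enumerations `a'`, `b'` of the term are traded for those used by `smtGen`.
    have h := D_gen T γ a' b' (exists_enum (𝒩 := 𝒩) _).choose_spec.some
      (exists_enum (𝒩 := 𝒩) _).choose_spec.some
    refine Eq.trans ?_ (NPROP.D_change (P := T.toNPROP) _ a b a' b').symm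
    rw [h]
    exact congrArg₂ SMT.comp (eval_bij _ _) (congrArg (SMT.comp _) (eval_bij _ _))
  | empty => exact ren _ (Equiv.refl _) (cls_empty_eq_ren _) a b _ (cls_cast_empty _ _ _)
  | id x => exact ren _ (Equiv.refl _) (cls_id_eq_ren _ _) a b _ (cls_cast_id _ _ _)
  | delta x y =>
    exact ren _ (Equiv.ofUnique _ _) (cls_delta_eq_ren _ _ _) a b _ (cls_cast_id _ _ _)
  | @par A B A' B' C D t t' hC hD ih ih' =>
    -- The tensor relation of `ORD` speaks of concatenated enumerations only, so these are
    -- introduced first.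
    refine Eq.trans ?_ (NPROP.D_change (P := T.toNPROP) _ a b (hC.append (ch A) (ch A'))
      (hD.append (ch B) (ch B'))).symm
    refine congrArg₂ SMT.comp (eval_bij _ _) (congrArg₂ SMT.comp ?_ (eval_bij _ _))
    refine Eq.trans ?_ (NPROP.D_tensor (P := T.toNPROP) (cls t) (cls t') hC hD (ch A) (ch B)
      (ch A') (ch B')).symm
    rw [← ih, ← ih']
    rfl
  | @seq A B C t t' ih ih' =>
    refine Eq.trans ?_ (NPROP.D_comp (P := T.toNPROP) (cls t) (cls t') a (ch B) b).symm
    rw [← ih, ← ih']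
    rfl
  | perm π t hA hB ih =>
    -- The permutation in the term is formal, whereas the relation of `ORD` concerns conjugation by
    -- bijections.
    rw [cls_perm]
    refine Eq.trans ?_ (NPROP.D_act (P := T.toNPROP) π hA hB (cls t) a b).symm
    rw [← ih]
    rfl

theorem eval_smtGen {m n : ℕ} {t t' : Trm (T.toSMT ch).sig m n} (h : (T.toSMT ch).eqs m n t t') :
    eval (T.smtGen ch) t = eval (T.smtGen ch) t' := by
  cases h with
  | mk h a b =>
    rw [eval_smtGen_nfSmt, eval_smtGen_nfSmt]
    exact congrArg (fun f => NPROP.D (T := T.toNPROP) a f b)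
      (Quotient.sound (NTh.ax (Or.inl h)))

/-- The PROP of the presented nominal PROP is presented by the translated theory. -/
noncomputable def ordIso : PROP.Iso T.toNPROP.ORD (T.toSMT ch).toPROP :=
  isoOfEval (T := T.toNPROP.ordSMT) (U := T.toSMT ch) (T.ordGen ch) (T.eval_ordGen ch)
    (T.smtGen ch) (T.eval_smtGen ch)
    (by
      intro γ
      exact NTrm.nf_gen_self (U := T.toSMT ch) ch γ _ _)
    (by
      rintro ⟨a, f, b⟩
      obtain ⟨t, rfl⟩ := exists_cls f
      exact T.eval_smtGen_nfSmt ch t a b)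

end NMT

/-- Let `T = ⟨Σ, E⟩` be a nominal monoidal theory over a countably infinite set of names and let
`Smt T` be its translation, for any choice of enumerations of the finite sets of names. Then
`ORD(nProp T) ≅ Prop(Smt T)`, and if `T` is complete for `nC` and `ORD(nC) ≅ C`, then `Smt T` is
complete for `C`. -/
theorem mainTheorem3 {𝒩 : Type w} [Countable 𝒩] [Infinite 𝒩] (T : NMT.{w, s} 𝒩)
    (ch : ∀ A : Finset 𝒩, Fin A.card ≃ A) :
    Nonempty (PROP.Iso T.toNPROP.ORD (T.toSMT ch).toPROP) ∧
      ∀ (nC : NPROP.{u} 𝒩) (C : PROP.{v}), T.IsCompleteFor nC →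
        Nonempty (PROP.Iso nC.ORD C) → (T.toSMT ch).IsCompleteFor C := by
  refine ⟨⟨T.ordIso ch⟩, ?_⟩
  rintro nC C ⟨i⟩ ⟨j⟩
  -- The chain is `Prop(Smt T) ≅ ORD(nProp T) ≅ ORD(nC) ≅ C`.
  exact ⟨(T.ordIso ch).symm.trans (i.ord.trans j)⟩
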